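/- Let $0<\rho_1<\rho_2$, let $\Omega=\{x\in\mathbb{R}^2:\rho_1<|x|<\rho_2\}$, and let $B\in C^\infty(\overline{\Omega},\mathbb{R})$ be radial with $B_0=\inf_{\Omega}B>0$. Let $\phi$ be the solution of $\Delta\phi=B$ in $\Omega$, $\phi=0$ on $\partial\Omega$; it is radial, and we also write $\phi(r)$ for its value on the circle $|x|=r$. Let $\phi_{\min}$ be the minimum of $\phi$ on $\overline{\Omega}$ and $r_{\min}\in(\rho_1,\rho_2)$ the radius of the circle where it is attained; write $\phi''_{\min}=\phi''(r_{\min})$, and let $\partial_n\phi(\rho_1)=-\phi'(\rho_1)$, $\partial_n\phi(\rho_2)=\phi'(\rho_2)$ be the outward normal derivatives of $\phi$ on the two boundary circles. For $h>0$ and $m\in\mathbb{R}$ let $$d_{h,m}=-ih\Big(\partial_r+\frac{m+1/2}{r}-\frac{\phi'(r)}{h}\Big),\qquad d_{h,m}^{\times}=-ih\Big(\partial_r-\frac{m+1/2}{r}+\frac{\phi'(r)}{h}\Big),$$ and let $(\lambda_{j,m}(h))_{j\ge 1}$ be the non-decreasing sequence of eigenvalues, counted with multiplicity, of the self-adjoint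 operator $d_{h,m}d_{h,m}^{\times}$ on $L^2((\rho_1,\rho_2),\mathbb{C})$ with domain $H^1_0\cap H^2((\rho_1,\rho_2),\mathbb{C})$. Put $$f_{j,h}(m)=\frac{\lambda_{j,m}(h)}{\sqrt h}\,e^{-2\phi_{\min}/h}.$$ Then the following hold. (1) As $h\to0^+$, $f_{1,h}$ converges, uniformly on every compact subset of $\mathbb{R}$, to the function $f:\mathbb{R}\to[0,\infty)$ given by $$f(m)=2\sqrt{\frac{\phi''_{\min}}{\pi}}\left(\partial_n\phi(\rho_1)\Big(\frac{\rho_1}{r_{\min}}\Big)^{2m+1}+\partial_n\phi(\rho_2)\Big(\frac{\rho_2}{r_{\min}}\Big)^{2m+1}\right).$$ (2) Let $K>0$ and $h_0>0$. There exists $g:\mathbb{R}\to[0,\infty)$ coercive (that is, $g(m)\to+\infty$ as $|m|\to\infty$) such that for all $h\in(0,h_0]$ and all $m\in\mathbb{R}$ satisfying $f_{1,h}(m)\le K$, one has $f_{1,h}(m)\ge g(m)$. (3) For all $h>0$, $j\ge2$ and $m\in\mathbb{R}$, $f_{j,h}(m)\ge 2B_0\sqrt h\,e^{-2\phi_{\min}/h}$;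 equivalently, $\lambda_{j,m}(h)\ge 2hB_0$. -/

import Mathlib

open Set Filter Topology MeasureTheory
open scoped ContDiff

noncomputable section

/-- The Euclidean plane. -/
abbrev Plane : Type := EuclideanSpace ℝ (Fin 2)

/-- The open annulus `Ω = {ρ₁ < |x| < ρ₂}`. -/
def annulus (ρ₁ ρ₂ : ℝ) : Set Plane := {x | ρ₁ < ‖x‖ ∧ ‖x‖ < ρ₂}

/-- The closed annulus, i.e. the closure of `Ω`. -/
def closedAnnulus (ρ₁ ρ₂ : ℝ) : Set Plane := {x | ρ₁ ≤ ‖x‖ ∧ ‖x‖ ≤ ρ₂}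

/-- A function on the plane is radial on the closed annulus. -/
def IsRadialOn (ρ₁ ρ₂ : ℝ) (B : Plane → ℝ) : Prop :=
  ∀ x ∈ closedAnnulus ρ₁ ρ₂, ∀ y ∈ closedAnnulus ρ₁ ρ₂, ‖x‖ = ‖y‖ → B x = B y

/-- `B₀ = inf {B(x) : x ∈ Ω}`. -/
def fieldInf (ρ₁ ρ₂ : ℝ) (B : Plane → ℝ) : ℝ := sInf (B '' annulus ρ₁ ρ₂)

/-- `φ` is the (unique, classical) solution of the Dirichlet problem
`Δ φ = B` in `Ω`, `φ = 0` on `∂Ω`. -/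
structure IsScalarPotential (ρ₁ ρ₂ : ℝ) (B φ : Plane → ℝ) : Prop where
  continuousOn : ContinuousOn φ (closedAnnulus ρ₁ ρ₂)
  contDiffOn : ContDiffOn ℝ 2 φ (annulus ρ₁ ρ₂)
  laplacian_eq : ∀ x ∈ annulus ρ₁ ρ₂, Laplacian.laplacian φ x = B x
  boundary_eq : ∀ x : Plane, ‖x‖ = ρ₁ ∨ ‖x‖ = ρ₂ → φ x = 0

/-- The function `r ↦ φ(r, 0)`, that is, `φ` as a function of the radial variable. -/
def radialProfile (φ : Plane → ℝ) (r : ℝ) : ℝ := φ !₂[r, 0]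

/-- Outward normal derivative of `φ` on the inner circle: `-∂ᵣφ(ρ₁)` (one-sided derivative). -/
def innerNormalDeriv (ρ₁ ρ₂ : ℝ) (φ : Plane → ℝ) : ℝ :=
  -derivWithin (radialProfile φ) (Icc ρ₁ ρ₂) ρ₁

/-- Outward normal derivative of `φ` on the outer circle: `∂ᵣφ(ρ₂)` (one-sided derivative). -/
def outerNormalDeriv (ρ₁ ρ₂ : ℝ) (φ : Plane → ℝ) : ℝ :=
  derivWithin (radialProfile φ) (Icc ρ₁ ρ₂) ρ₂

/-- Lebesgue measure on the interval `(a, b)`. -/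
abbrev intervalMeasure (a b : ℝ) : Measure ℝ := volume.restrict (Ioo a b)

/-- `u ∈ H¹(a, b)` (continuous representative): `u` is absolutely continuous on `[a, b]` with
square-integrable derivative. -/
def MemH1 (a b : ℝ) (u : ℝ → ℂ) : Prop :=
  AbsolutelyContinuousOnInterval u a b ∧ MemLp (deriv u) 2 (intervalMeasure a b)

/-- `u ∈ H²(a, b)`: both `u` and `u'` belong to `H¹(a, b)`. The derivative is taken within
`[a, b]`, so that its values at the end points are the one-sided ones. -/
def MemH2 (a b : ℝ) (u : ℝ → ℂ) : Prop :=
  MemH1 a b u ∧ MemH1 a b (derivWithin u (Icc a b))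

/-- `u ∈ H¹₀ ∩ H²(a, b)`. -/
def MemDirichletDomain (a b : ℝ) (u : ℝ → ℂ) : Prop :=
  MemH2 a b u ∧ u a = 0 ∧ u b = 0

/-- The Dirac operator with angular momentum `m`,
`d_{h,m} = -ih (∂ᵣ + (m + 1/2)/r - ∂ᵣφ/h)`. -/
def diracOp (φ : Plane → ℝ) (h m : ℝ) (u : ℝ → ℂ) (r : ℝ) : ℂ :=
  -(Complex.I * (h : ℂ)) *
    (deriv u r + (((m + 1 / 2) / r - deriv (radialProfile φ) r / h : ℝ) : ℂ) * u r)

/-- The formal adjoint of the Dirac operator,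
`d_{h,m}^× = -ih (∂ᵣ - (m + 1/2)/r + ∂ᵣφ/h)`. -/
def diracOpAdj (φ : Plane → ℝ) (h m : ℝ) (u : ℝ → ℂ) (r : ℝ) : ℂ :=
  -(Complex.I * (h : ℂ)) *
    (deriv u r - (((m + 1 / 2) / r - deriv (radialProfile φ) r / h : ℝ) : ℂ) * u r)

/-- `f ∈ L²(ρ₁, ρ₂)` is an eigenvector, for the eigenvalue `ν`, of the operator
`d_{h,m} d_{h,m}^×` with domain `H¹₀ ∩ H²(ρ₁, ρ₂)`. -/
def IsPauliEigenvector (ρ₁ ρ₂ : ℝ) (φ : Plane → ℝ) (h m ν : ℝ)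
    (f : Lp ℂ 2 (intervalMeasure ρ₁ ρ₂)) : Prop :=
  f ≠ 0 ∧ ∃ u : ℝ → ℂ, MemDirichletDomain ρ₁ ρ₂ u ∧ f =ᵐ[intervalMeasure ρ₁ ρ₂] u ∧
    ∀ᵐ r ∂intervalMeasure ρ₁ ρ₂, diracOp φ h m (diracOpAdj φ h m u) r = (ν : ℂ) * u r

/-- `λ_{k,m}(h)` for `k ≥ 1`: the `k`-th eigenvalue, counted with multiplicity, of
`d_{h,m} d_{h,m}^×` on `H¹₀ ∩ H²(ρ₁, ρ₂)`. It is the smallest `Λ` such that there are `k`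
linearly independent eigenvectors with eigenvalues at most `Λ`. -/
def pauliEigenvalue (ρ₁ ρ₂ : ℝ) (φ : Plane → ℝ) (k : ℕ) (h m : ℝ) : ℝ :=
  sInf {Λ : ℝ | ∃ v : Fin k → Lp ℂ 2 (intervalMeasure ρ₁ ρ₂), LinearIndependent ℂ v ∧
    ∀ i, ∃ ν ≤ Λ, IsPauliEigenvector ρ₁ ρ₂ φ h m ν (v i)}

/-- The renormalized eigenvalue `f_{j,h}(m) = λ_{j,m}(h) e^{-2 φ_min / h} / √h`. -/
def renormalizedEigenvalue (ρ₁ ρ₂ : ℝ) (φ : Plane → ℝ) (φmin : ℝ) (j : ℕ) (h m : ℝ) : ℝ :=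
  pauliEigenvalue ρ₁ ρ₂ φ j h m / √h * Real.exp (-2 * φmin / h)

/-- The limit function
`f(m) = 2 √(φ''(r_min)/π) (∂ₙφ(ρ₁) (ρ₁/r_min)^{2m+1} + ∂ₙφ(ρ₂) (ρ₂/r_min)^{2m+1})`. -/
def limitFunction (ρ₁ ρ₂ : ℝ) (φ : Plane → ℝ) (rmin m : ℝ) : ℝ :=
  2 * √(deriv (deriv (radialProfile φ)) rmin / Real.pi) *
    (innerNormalDeriv ρ₁ ρ₂ φ * (ρ₁ / rmin) ^ (2 * m + 1) +
      outerNormalDeriv ρ₁ ρ₂ φ * (ρ₂ / rmin) ^ (2 * m + 1))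

end

/-!
Each operator `d d^×` is analysed through its explicit Green function. Write `ψ` for the radial
potential, `E(r) = r^{m + 1/2} e^{-ψ(r)/h}` (`weight`), and `α(r)`, `β(r)` for the integrals of
`E⁻²` from `ρ₁` to `r` and from `r` to `ρ₂`, with `T = α + β` (`invWeightIntegral`). Since
`d^× = -ih E ∂ E⁻¹`, the operator `h² (d d^×)⁻¹` has the kernel
`E(r) E(s) α(min r s) β(max r s) / T`. It is compact, symmetric and of infinite rank, which gives
eigenvectors in every number (`exists_linearIndependent_pauliEigenvectors`).

The first eigenvalue is trapped between two explicit quantities. It is at least `h²` divided by the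
trace `∫ E² α β / T` of the kernel (`inv_greenTrace_le_pauliEigenvalue`), and testing the kernel
against `E` on an interval `[r, s]` shows that it is at most `h² T / (α(r) β(s) ∫_r^s E²)`
(`pauliEigenvalue_one_le`). The potential vanishes on the boundary, with nonzero slopes, and has a
single nondegenerate minimum at `c`. Hence Laplace's method applies: `α` is governed by a boundary
layer of width `h` at `ρ₁`, `β` by one at `ρ₂`, and `∫ E²` by a Gaussian of width `√h` at `c`
(`tendsto_scaled_integral`). Both bounds then have the same limit, jointly in `h → 0⁺` and
`m → m₀`, and joint convergence to a continuous limit is locally uniform convergence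
(`tendsto_renormalizedEigenvalue`).

For large `|m|` the factor `(r/s)^{2m + 1}` in `E(r)² E(s)⁻²` decays exponentially in `|m| |r - s|`
on one side of the diagonal, so the trace, after normalization, tends to `0` uniformly in `h`
(`greenTrace_le_of_angular`). This bounds the first eigenvalue from below by a coercive function
without any restriction on the energy or on `h`.

For the second eigenvalue (`two_mul_le_of_linearIndependent`), `d^×` maps two independent
eigenvectors to functions which, together with the zero mode `1/E` of `d`, span a space of dimension
three. Some nonzero combination vanishes at both end points, and on such functions integration by
parts trades `d` at angular momentum `m` for `d^×` at `m + 1`, at the price of the magnetic field: the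
energy is at least `2 h B₀` times the squared norm (`field_mul_integral_le`).

Finally, an explicit radial solution of `Δ u = B` is constructed by quadrature, and the weak maximum
principle identifies it with the given potential (`eq_comp_norm`).
-/

noncomputable section

/-! ### Calculus on a compact interval -/

namespace RadialPauli

lemma intervalIntegrable_of_continuousOn_Icc {F : Type*} [NormedAddCommGroup F]
    {a b c d : ℝ} {g : ℝ → F}
    (hg : ContinuousOn g (Icc a b)) (hc : c ∈ Icc a b) (hd : d ∈ Icc a b) :
    IntervalIntegrable g volume c d :=
  (hg.mono (by rw [uIcc]; exact Icc_subset_Icc (le_min hc.1 hd.1) (max_le hc.2 hd.2)))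
    |>.intervalIntegrable

section Calculus

variable {F : Type*} [NormedAddCommGroup F] [NormedSpace ℝ F]

lemma hasDerivWithinAt_integral [CompleteSpace F] {a b : ℝ} (hab : a ≤ b) {g : ℝ → F}
    (hg : ContinuousOn g (Icc a b)) {r : ℝ} (hr : r ∈ Icc a b) :
    HasDerivWithinAt (fun x ↦ ∫ t in a..x, g t) (g r) (Icc a b) r := by
  have hc : Continuous (IccExtend hab ((Icc a b).domRestrict g)) :=
    (continuousOn_iff_continuous_domRestrict.1 hg).Icc_extend'
  have h1 := (hc.integral_hasStrictDerivAt a r).hasDerivAt.hasDerivWithinAt (s := Icc a b)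
  have hval : ∀ x ∈ Icc a b, IccExtend hab ((Icc a b).domRestrict g) x = g x := fun x hx ↦ by
    rw [IccExtend_of_mem _ _ hx]; rfl
  rw [hval r hr] at h1
  have hEq : ∀ x ∈ Icc a b,
      (∫ t in a..x, g t) = ∫ t in a..x, IccExtend hab ((Icc a b).domRestrict g) t := by
    intro x hx
    refine intervalIntegral.integral_congr fun t ht ↦ (hval t ?_).symm
    rw [uIcc_of_le hx.1] at ht
    exact ⟨ht.1, ht.2.trans hx.2⟩
  exact h1.congr hEq (hEq r hr)

lemma integral_eq_sub_of_hasDerivWithinAt_Icc [CompleteSpace F] {a b c d : ℝ} {G g : ℝ → F}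
    (hG : ∀ x ∈ Icc a b, HasDerivWithinAt G (g x) (Icc a b) x)
    (hg : ContinuousOn g (Icc a b)) (hc : c ∈ Icc a b) (hd : d ∈ Icc a b) (hcd : c ≤ d) :
    ∫ t in c..d, g t = G d - G c := by
  refine intervalIntegral.integral_eq_sub_of_hasDerivAt_of_le hcd ?_ ?_
    (intervalIntegrable_of_continuousOn_Icc hg hc hd)
  · exact ContinuousOn.mono (fun x hx ↦ (hG x hx).continuousWithinAt)
      (Icc_subset_Icc hc.1 hd.2)
  · intro x hx
    have hx' : x ∈ Ioo a b := ⟨hc.1.trans_lt hx.1, hx.2.trans_le hd.2⟩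
    exact (hG x (Ioo_subset_Icc_self hx')).hasDerivAt (Icc_mem_nhds hx'.1 hx'.2)

/-- An absolutely continuous function whose almost everywhere derivative agrees with a continuous
function is continuously differentiable up to the end points. -/
lemma hasDerivWithinAt_of_absolutelyContinuous [CompleteSpace F] {a b : ℝ}
    (hab : a ≤ b) {u g : ℝ → F}
    (hu : AbsolutelyContinuousOnInterval u a b)
    (hd : ∀ᵐ r, r ∈ Ioo a b → HasDerivAt u (g r) r) (hg : ContinuousOn g (Icc a b))
    {r : ℝ} (hr : r ∈ Icc a b) : HasDerivWithinAt u (g r) (Icc a b) r := by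
  have hI : ∀ x ∈ Icc a b, HasDerivWithinAt (fun x ↦ ∫ t in a..x, g t) (g x) (Icc a b) x :=
    fun x hx ↦ hasDerivWithinAt_integral hab hg hx
  obtain ⟨C, hC⟩ := isCompact_Icc.exists_bound_of_continuousOn hg
  have hLip : LipschitzOnWith (Real.toNNReal C) (fun x ↦ ∫ t in a..x, g t) (uIcc a b) := by
    rw [uIcc_of_le hab]
    refine (convex_Icc a b).lipschitzOnWith_of_nnnorm_hasDerivWithin_le hI fun x hx ↦ ?_
    rw [← NNReal.coe_le_coe, coe_nnnorm]
    exact (hC x hx).trans (Real.le_coe_toNNReal C)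
  have hAC := hu.fun_sub hLip.absolutelyContinuousOnInterval
  have hz : ∀ᵐ x, x ∈ uIcc a b →
      HasDerivAt (fun x ↦ u x - ∫ t in a..x, g t) 0 x := by
    have hne : ∀ᵐ x : ℝ, x ≠ a ∧ x ≠ b := by
      filter_upwards [volume.ae_ne a, volume.ae_ne b] with x h1 h2 using ⟨h1, h2⟩
    filter_upwards [hd, hne] with x hx hx' hxm
    rw [uIcc_of_le hab] at hxm
    have hxo : x ∈ Ioo a b := ⟨lt_of_le_of_ne hxm.1 hx'.1.symm, lt_of_le_of_ne hxm.2 hx'.2⟩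
    simpa using (hx hxo).fun_sub ((hI x hxm).hasDerivAt (Icc_mem_nhds hxo.1 hxo.2))
  obtain ⟨C, hC⟩ := hAC.const_of_ae_hasDerivAt_zero hz
  rw [uIcc_of_le hab] at hC
  have hEq : ∀ x ∈ Icc a b, u x = (∫ t in a..x, g t) + C := fun x hx ↦ by
    rw [← hC x hx]; abel
  exact ((hI r hr).add_const C).congr hEq (hEq r hr)

end Calculus

lemma memH1_of_hasDerivWithinAt {a b : ℝ} (hab : a ≤ b) {u g : ℝ → ℂ}
    (hu : ∀ r ∈ Icc a b, HasDerivWithinAt u (g r) (Icc a b) r)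
    (hg : ContinuousOn g (Icc a b)) : MemH1 a b u := by
  obtain ⟨C, hC⟩ := isCompact_Icc.exists_bound_of_continuousOn hg
  refine ⟨?_, ?_⟩
  · have hLip : LipschitzOnWith (Real.toNNReal C) u (uIcc a b) := by
      rw [uIcc_of_le hab]
      refine (convex_Icc a b).lipschitzOnWith_of_nnnorm_hasDerivWithin_le hu fun x hx ↦ ?_
      rw [← NNReal.coe_le_coe, coe_nnnorm]
      exact (hC x hx).trans (Real.le_coe_toNNReal C)
    exact hLip.absolutelyContinuousOnInterval
  · have hd : ∀ r ∈ Ioo a b, deriv u r = g r := fun r hr ↦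
      ((hu r (Ioo_subset_Icc_self hr)).hasDerivAt (Icc_mem_nhds hr.1 hr.2)).deriv
    have hm : MemLp g 2 (intervalMeasure a b) := by
      refine MemLp.of_bound ?_ C ?_
      · exact (hg.mono Ioo_subset_Icc_self).aestronglyMeasurable measurableSet_Ioo
      · filter_upwards [ae_restrict_mem measurableSet_Ioo] with r hr
          using hC r (Ioo_subset_Icc_self hr)
    refine hm.ae_eq ?_
    filter_upwards [ae_restrict_mem measurableSet_Ioo] with r hr using (hd r hr).symm

/-- Cauchy–Schwarz inequality for a product of continuous functions on an interval. -/
lemma norm_integral_mul_sq_le {c d : ℝ} (hcd : c ≤ d) {f : ℝ → ℝ} {g : ℝ → ℂ}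
    (hf : ContinuousOn f (Icc c d)) (hg : ContinuousOn g (Icc c d)) :
    ‖∫ t in c..d, (f t : ℂ) * g t‖ ^ 2 ≤ (∫ t in c..d, f t ^ 2) * ∫ t in c..d, ‖g t‖ ^ 2 := by
  have hc : c ∈ Icc c d := ⟨le_rfl, hcd⟩
  have hd : d ∈ Icc c d := ⟨hcd, le_rfl⟩
  have hii : ∀ {k : ℝ → ℝ}, ContinuousOn k (Icc c d) → IntervalIntegrable k volume c d :=
    fun hk ↦ intervalIntegrable_of_continuousOn_Icc hk hc hd
  set S := ∫ t in c..d, |f t| * ‖g t‖ with hS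
  set A := ∫ t in c..d, f t ^ 2 with hA
  set Q := ∫ t in c..d, ‖g t‖ ^ 2 with hQ
  have h1 : ‖∫ t in c..d, (f t : ℂ) * g t‖ ≤ S := by
    refine (intervalIntegral.norm_integral_le_integral_norm hcd).trans (le_of_eq ?_)
    rw [hS]
    refine intervalIntegral.integral_congr fun x _ ↦ ?_
    simp only [norm_mul, Complex.norm_real, Real.norm_eq_abs]
  have h2 : ∀ t : ℝ, 0 ≤ A * (t * t) + (-2 * S) * t + Q := by
    intro t
    have h3 : 0 ≤ ∫ x in c..d, (t * |f x| - ‖g x‖) ^ 2 :=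
      intervalIntegral.integral_nonneg hcd fun x _ ↦ sq_nonneg _
    have h4 : ∫ x in c..d, (t * |f x| - ‖g x‖) ^ 2 =
        ∫ x in c..d, ((t * t) * f x ^ 2 + (-2 * t) * (|f x| * ‖g x‖) + ‖g x‖ ^ 2) := by
      refine intervalIntegral.integral_congr fun x _ ↦ ?_
      have : |f x| ^ 2 = f x ^ 2 := sq_abs _
      linear_combination (t * t) * this
    rw [h4, intervalIntegral.integral_add, intervalIntegral.integral_add,
      intervalIntegral.integral_const_mul, intervalIntegral.integral_const_mul] at h3
    · linarith
    all_goals exact hii (by fun_prop)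
  have h5 := discrim_le_zero h2
  rw [discrim] at h5
  have h6 : ‖∫ t in c..d, (f t : ℂ) * g t‖ ^ 2 ≤ S ^ 2 := by gcongr
  linarith

end RadialPauli

/-! ### The first-order Dirichlet system -/

namespace RadialPauli
open scoped ComplexConjugate

/-- First-order form of the Dirichlet problem `-(∂ + a)(∂ - a) u = f` on `[ρ₁, ρ₂]`: the second
unknown is `v = u' - a u`. Derivatives are one-sided at the end points. -/
structure IsDirichletSystem (ρ₁ ρ₂ : ℝ) (a : ℝ → ℝ) (f u v : ℝ → ℂ) : Prop where
  deriv_left : ∀ r ∈ Icc ρ₁ ρ₂, HasDerivWithinAt u (a r * u r + v r) (Icc ρ₁ ρ₂) r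
  deriv_right : ∀ r ∈ Icc ρ₁ ρ₂, HasDerivWithinAt v (-(a r * v r) - f r) (Icc ρ₁ ρ₂) r
  left : u ρ₁ = 0
  right : u ρ₂ = 0

namespace IsDirichletSystem

variable {ρ₁ ρ₂ : ℝ} {a : ℝ → ℝ} {f u v : ℝ → ℂ}

lemma continuousOn_fst (S : IsDirichletSystem ρ₁ ρ₂ a f u v) : ContinuousOn u (Icc ρ₁ ρ₂) :=
  fun r hr ↦ (S.deriv_left r hr).continuousWithinAt

lemma continuousOn_snd (S : IsDirichletSystem ρ₁ ρ₂ a f u v) : ContinuousOn v (Icc ρ₁ ρ₂) :=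
  fun r hr ↦ (S.deriv_right r hr).continuousWithinAt

end IsDirichletSystem

/-- Integration by parts: `∂ - a` and `-(∂ + a)` are formally adjoint, and no boundary condition is
needed on the second function. -/
lemma integral_conj_mul_eq {ρ₁ ρ₂ : ℝ} (hρ : ρ₁ ≤ ρ₂) {a : ℝ → ℝ} {w z x y : ℝ → ℂ}
    (hw : ∀ r ∈ Icc ρ₁ ρ₂, HasDerivWithinAt w (a r * w r + z r) (Icc ρ₁ ρ₂) r)
    (hx : ∀ r ∈ Icc ρ₁ ρ₂, HasDerivWithinAt x (-(a r * x r) - y r) (Icc ρ₁ ρ₂) r)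
    (hz : ContinuousOn z (Icc ρ₁ ρ₂)) (hy : ContinuousOn y (Icc ρ₁ ρ₂))
    (h₁ : w ρ₁ = 0) (h₂ : w ρ₂ = 0) :
    ∫ r in ρ₁..ρ₂, conj (w r) * y r = ∫ r in ρ₁..ρ₂, conj (z r) * x r := by
  have hwc : ContinuousOn w (Icc ρ₁ ρ₂) := fun r hr ↦ (hw r hr).continuousWithinAt
  have hxc : ContinuousOn x (Icc ρ₁ ρ₂) := fun r hr ↦ (hx r hr).continuousWithinAt
  have hl : ρ₁ ∈ Icc ρ₁ ρ₂ := ⟨le_rfl, hρ⟩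
  have hr : ρ₂ ∈ Icc ρ₁ ρ₂ := ⟨hρ, le_rfl⟩
  have hcj : ∀ {k : ℝ → ℂ}, ContinuousOn k (Icc ρ₁ ρ₂) →
      ContinuousOn (fun r ↦ conj (k r)) (Icc ρ₁ ρ₂) :=
    fun hk ↦ Complex.continuous_conj.comp_continuousOn hk
  have hD : ∀ r ∈ Icc ρ₁ ρ₂, HasDerivWithinAt (fun r ↦ conj (w r) * x r)
      (conj (z r) * x r - conj (w r) * y r) (Icc ρ₁ ρ₂) r := by
    intro r hr
    have h1 := (hw r hr).star.mul (hx r hr)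
    refine h1.congr_deriv ?_
    simp only [Complex.star_def, map_add, map_mul, Complex.conj_ofReal]
    ring
  have h := integral_eq_sub_of_hasDerivWithinAt_Icc hD
    (((hcj hz).mul hxc).sub ((hcj hwc).mul hy)) hl hr hρ
  rw [intervalIntegral.integral_sub
    (intervalIntegrable_of_continuousOn_Icc ((hcj hz).fun_mul hxc) hl hr)
    (intervalIntegrable_of_continuousOn_Icc ((hcj hwc).fun_mul hy) hl hr)] at h
  simp only [h₁, h₂, map_zero, zero_mul, sub_zero] at h
  exact (sub_eq_zero.1 h).symm

lemma integral_conj_mul_self {ρ₁ ρ₂ : ℝ} (u : ℝ → ℂ) :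
    ∫ r in ρ₁..ρ₂, conj (u r) * u r = ((∫ r in ρ₁..ρ₂, ‖u r‖ ^ 2 : ℝ) : ℂ) := by
  rw [← intervalIntegral.integral_ofReal]
  refine intervalIntegral.integral_congr fun r _ ↦ ?_
  simp only [Complex.conj_mul', Complex.ofReal_pow]

lemma re_intervalIntegral {ρ₁ ρ₂ : ℝ} {g : ℝ → ℂ} (hg : IntervalIntegrable g volume ρ₁ ρ₂) :
    (∫ r in ρ₁..ρ₂, g r).re = ∫ r in ρ₁..ρ₂, (g r).re :=
  (Complex.reCLM.intervalIntegral_comp_comm hg).symm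

/-- Energy identity `ν ∫ |u|² = ∫ |u' - a u|²` for a Dirichlet eigenfunction. -/
lemma IsDirichletSystem.energy {ρ₁ ρ₂ : ℝ} (hρ : ρ₁ ≤ ρ₂) {a : ℝ → ℝ} {u v : ℝ → ℂ} {ν : ℝ}
    (S : IsDirichletSystem ρ₁ ρ₂ a (fun r ↦ ν * u r) u v) :
    ν * ∫ r in ρ₁..ρ₂, ‖u r‖ ^ 2 = ∫ r in ρ₁..ρ₂, ‖v r‖ ^ 2 := by
  have h := integral_conj_mul_eq hρ S.deriv_left S.deriv_right S.continuousOn_snd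
    (continuousOn_const.mul S.continuousOn_fst) S.left S.right
  rw [integral_conj_mul_self] at h
  have h2 : ∫ r in ρ₁..ρ₂, conj (u r) * ((ν : ℂ) * u r) =
      ν * ∫ r in ρ₁..ρ₂, conj (u r) * u r := by
    rw [← intervalIntegral.integral_const_mul]
    exact intervalIntegral.integral_congr fun r _ ↦ by ring
  rw [h2, integral_conj_mul_self] at h
  exact_mod_cast h

/-- Pointwise bound of `u` by the diagonal of the Green kernel: Cauchy–Schwarz applied to
`(u / E)' = v / E`, integrated from either end point. -/
lemma IsDirichletSystem.norm_sq_mul_le {ρ₁ ρ₂ : ℝ} {a E : ℝ → ℝ}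
    {f u v : ℝ → ℂ} (S : IsDirichletSystem ρ₁ ρ₂ a f u v)
    (hE : ∀ r ∈ Icc ρ₁ ρ₂, HasDerivWithinAt E (a r * E r) (Icc ρ₁ ρ₂) r)
    (hE0 : ∀ r ∈ Icc ρ₁ ρ₂, 0 < E r) {r : ℝ} (hr : r ∈ Icc ρ₁ ρ₂) :
    ‖u r‖ ^ 2 * (∫ s in ρ₁..ρ₂, (E s)⁻¹ ^ 2) ≤
      E r ^ 2 * (∫ s in ρ₁..r, (E s)⁻¹ ^ 2) * (∫ s in r..ρ₂, (E s)⁻¹ ^ 2) *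
        ∫ s in ρ₁..ρ₂, ‖v s‖ ^ 2 := by
  have hρ : ρ₁ ≤ ρ₂ := hr.1.trans hr.2
  have hl : ρ₁ ∈ Icc ρ₁ ρ₂ := ⟨le_rfl, hρ⟩
  have hrr : ρ₂ ∈ Icc ρ₁ ρ₂ := ⟨hρ, le_rfl⟩
  have hEc : ContinuousOn E (Icc ρ₁ ρ₂) := fun r hr ↦ (hE r hr).continuousWithinAt
  have hEi : ContinuousOn (fun s ↦ (E s)⁻¹) (Icc ρ₁ ρ₂) := hEc.inv₀ fun s hs ↦ (hE0 s hs).ne'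
  have hD : ∀ s ∈ Icc ρ₁ ρ₂, HasDerivWithinAt (fun s ↦ ((E s)⁻¹ : ℝ) * u s)
      (((E s)⁻¹ : ℝ) * v s) (Icc ρ₁ ρ₂) s := by
    intro s hs
    have h1 := (((hE s hs).inv (hE0 s hs).ne').ofReal_comp).mul (S.deriv_left s hs)
    refine h1.congr_deriv ?_
    have : (E s : ℂ) ≠ 0 := by exact_mod_cast (hE0 s hs).ne'
    push_cast [Pi.inv_apply]
    field_simp
    ring
  have hgc : ContinuousOn (fun s ↦ (((E s)⁻¹ : ℝ) : ℂ) * v s) (Icc ρ₁ ρ₂) :=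
    (Complex.continuous_ofReal.comp_continuousOn hEi).mul S.continuousOn_snd
  have i1 := integral_eq_sub_of_hasDerivWithinAt_Icc hD hgc hl hr hr.1
  have i2 := integral_eq_sub_of_hasDerivWithinAt_Icc hD hgc hr hrr hr.2
  rw [S.left, mul_zero, sub_zero] at i1
  rw [S.right, mul_zero, zero_sub] at i2
  have m1 : Icc ρ₁ r ⊆ Icc ρ₁ ρ₂ := Icc_subset_Icc_right hr.2
  have m2 : Icc r ρ₂ ⊆ Icc ρ₁ ρ₂ := Icc_subset_Icc_left hr.1
  have c1 := norm_integral_mul_sq_le hr.1 (hEi.mono m1) (S.continuousOn_snd.mono m1)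
  have c2 := norm_integral_mul_sq_le hr.2 (hEi.mono m2) (S.continuousOn_snd.mono m2)
  have hEr := hE0 r hr
  have hn : ‖(((E r)⁻¹ : ℝ) : ℂ) * u r‖ ^ 2 = ‖u r‖ ^ 2 / E r ^ 2 := by
    rw [norm_mul, Complex.norm_real, Real.norm_of_nonneg (inv_pos.2 hEr).le]
    field_simp
  rw [i1, hn] at c1
  rw [i2, norm_neg, hn] at c2
  have hsplit : ∀ {g : ℝ → ℝ}, ContinuousOn g (Icc ρ₁ ρ₂) →
      ∫ s in ρ₁..ρ₂, g s = (∫ s in ρ₁..r, g s) + ∫ s in r..ρ₂, g s := fun hg ↦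
    (intervalIntegral.integral_add_adjacent_intervals
      (intervalIntegrable_of_continuousOn_Icc hg hl hr)
      (intervalIntegrable_of_continuousOn_Icc hg hr hrr)).symm
  rw [hsplit (g := fun s ↦ (E s)⁻¹ ^ 2) (hEi.pow 2),
    hsplit (g := fun s ↦ ‖v s‖ ^ 2) (S.continuousOn_snd.norm.pow 2)]
  have a1 : 0 ≤ ∫ s in ρ₁..r, (E s)⁻¹ ^ 2 :=
    intervalIntegral.integral_nonneg hr.1 fun _ _ ↦ sq_nonneg _
  have a2 : 0 ≤ ∫ s in r..ρ₂, (E s)⁻¹ ^ 2 :=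
    intervalIntegral.integral_nonneg hr.2 fun _ _ ↦ sq_nonneg _
  rw [div_le_iff₀ (by positivity)] at c1 c2
  nlinarith [mul_le_mul_of_nonneg_left c1 a2, mul_le_mul_of_nonneg_left c2 a1]

/-- Lower bound for every Dirichlet eigenvalue by the inverse of the trace of the Green operator.
-/
lemma IsDirichletSystem.one_le_mul_trace {ρ₁ ρ₂ : ℝ} (hρ : ρ₁ < ρ₂) {a E : ℝ → ℝ}
    {u v : ℝ → ℂ} {ν : ℝ} (S : IsDirichletSystem ρ₁ ρ₂ a (fun r ↦ ν * u r) u v)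
    (hE : ∀ r ∈ Icc ρ₁ ρ₂, HasDerivWithinAt E (a r * E r) (Icc ρ₁ ρ₂) r)
    (hE0 : ∀ r ∈ Icc ρ₁ ρ₂, 0 < E r) (hu : ∃ r ∈ Icc ρ₁ ρ₂, u r ≠ 0) :
    (∫ s in ρ₁..ρ₂, (E s)⁻¹ ^ 2) ≤ ν * ∫ r in ρ₁..ρ₂,
      E r ^ 2 * (∫ s in ρ₁..r, (E s)⁻¹ ^ 2) * (∫ s in r..ρ₂, (E s)⁻¹ ^ 2) := by
  have hl : ρ₁ ∈ Icc ρ₁ ρ₂ := ⟨le_rfl, hρ.le⟩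
  have hrr : ρ₂ ∈ Icc ρ₁ ρ₂ := ⟨hρ.le, le_rfl⟩
  have hEc : ContinuousOn E (Icc ρ₁ ρ₂) := fun r hr ↦ (hE r hr).continuousWithinAt
  have hEi : ContinuousOn (fun s ↦ (E s)⁻¹ ^ 2) (Icc ρ₁ ρ₂) :=
    (hEc.inv₀ fun s hs ↦ (hE0 s hs).ne').pow 2
  have hα : ContinuousOn (fun r ↦ ∫ s in ρ₁..r, (E s)⁻¹ ^ 2) (Icc ρ₁ ρ₂) := fun r hr ↦
    (hasDerivWithinAt_integral hρ.le hEi hr).continuousWithinAt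
  have hβ : ContinuousOn (fun r ↦ ∫ s in r..ρ₂, (E s)⁻¹ ^ 2) (Icc ρ₁ ρ₂) := by
    refine (continuousOn_const.sub hα).congr (f := fun r ↦
      (∫ s in ρ₁..ρ₂, (E s)⁻¹ ^ 2) - ∫ s in ρ₁..r, (E s)⁻¹ ^ 2) fun r hr ↦ ?_
    simp only
    rw [← intervalIntegral.integral_add_adjacent_intervals
      (intervalIntegrable_of_continuousOn_Icc hEi hl hr)
      (intervalIntegrable_of_continuousOn_Icc hEi hr hrr)]
    ring
  have hkc := ((hEc.pow 2).mul hα).mul hβ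
  have huc : ContinuousOn (fun r ↦ ‖u r‖ ^ 2) (Icc ρ₁ ρ₂) := S.continuousOn_fst.norm.pow 2
  have hpos : 0 < ∫ r in ρ₁..ρ₂, ‖u r‖ ^ 2 := by
    refine intervalIntegral.integral_pos hρ huc (fun _ _ ↦ sq_nonneg _) ?_
    obtain ⟨r, hr, hr0⟩ := hu
    exact ⟨r, hr, by positivity⟩
  have key : (∫ r in ρ₁..ρ₂, ‖u r‖ ^ 2) * (∫ s in ρ₁..ρ₂, (E s)⁻¹ ^ 2) ≤
      (∫ r in ρ₁..ρ₂,
        E r ^ 2 * (∫ s in ρ₁..r, (E s)⁻¹ ^ 2) * (∫ s in r..ρ₂, (E s)⁻¹ ^ 2)) *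
        ∫ s in ρ₁..ρ₂, ‖v s‖ ^ 2 := by
    rw [← intervalIntegral.integral_mul_const, ← intervalIntegral.integral_mul_const]
    refine intervalIntegral.integral_mono_on hρ.le
      (intervalIntegrable_of_continuousOn_Icc (huc.mul continuousOn_const) hl hrr)
      (intervalIntegrable_of_continuousOn_Icc (hkc.mul continuousOn_const) hl hrr)
      fun r hr ↦ S.norm_sq_mul_le hE hE0 hr
  rw [← S.energy hρ.le] at key
  refine le_of_mul_le_mul_left ?_ hpos
  linarith

end RadialPauli

/-! ### Radial potentials and the second eigenvalue -/

namespace RadialPauli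
open scoped ComplexConjugate

/-- The radial form of the Dirichlet problem for the potential: `ψ'' + ψ' / r = b` on the half-line
`r > 0`, with `q = ψ'` and `ψ = 0` at `ρ₁` and `ρ₂`. The field `b` is positive and continuous on the
whole line, so that `ψ` and `q` are differentiable in a neighbourhood of `[ρ₁, ρ₂]`. -/
structure IsRadialPotential (ρ₁ ρ₂ : ℝ) (b ψ q : ℝ → ℝ) : Prop where
  pos : 0 < ρ₁
  lt : ρ₁ < ρ₂
  continuous_field : Continuous b
  field_pos : ∀ r, 0 < b r
  hasDerivAt : ∀ r, 0 < r → HasDerivAt ψ (q r) r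
  hasDerivAt_deriv : ∀ r, 0 < r → HasDerivAt q (b r - q r / r) r
  left : ψ ρ₁ = 0
  right : ψ ρ₂ = 0

/-- The zeroth-order coefficient `(m + 1/2)/r - ψ'(r)/h` of the Dirac operators. -/
def drift (q : ℝ → ℝ) (h m r : ℝ) : ℝ := (m + 1 / 2) / r - q r / h

/-- The derivative of `drift`, computed from `ψ'' + ψ' / r = b`. -/
def driftDeriv (b q : ℝ → ℝ) (h m r : ℝ) : ℝ := -(m + 1 / 2) / r ^ 2 - (b r - q r / r) / h

/-- The positive solution `r^{m + 1/2} e^{-ψ/h}` of `E' = a E`, where `a` is the drift. -/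
def weight (ψ : ℝ → ℝ) (h m r : ℝ) : ℝ := r ^ (m + 1 / 2) * Real.exp (-ψ r / h)

namespace IsRadialPotential

variable {ρ₁ ρ₂ : ℝ} {b ψ q : ℝ → ℝ}

lemma pos_of_mem (P : IsRadialPotential ρ₁ ρ₂ b ψ q) {r : ℝ} (hr : r ∈ Icc ρ₁ ρ₂) : 0 < r :=
  P.pos.trans_le hr.1

lemma hasDerivAt_drift (P : IsRadialPotential ρ₁ ρ₂ b ψ q) (h m : ℝ) {r : ℝ} (hr : 0 < r) :
    HasDerivAt (drift q h m) (driftDeriv b q h m r) r := by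
  have h1 := ((hasDerivAt_inv hr.ne').const_mul (m + 1 / 2)).sub
    ((P.hasDerivAt_deriv r hr).div_const h)
  refine (h1.congr_deriv ?_).congr_of_eventuallyEq (Eventually.of_forall fun s ↦ ?_)
  · rw [driftDeriv]; ring
  · simp only [drift, Pi.sub_apply, div_eq_mul_inv]

lemma continuousOn_deriv (P : IsRadialPotential ρ₁ ρ₂ b ψ q) : ContinuousOn q (Ioi 0) :=
  fun r hr ↦ (P.hasDerivAt_deriv r hr).continuousAt.continuousWithinAt

lemma continuousOn_drift (P : IsRadialPotential ρ₁ ρ₂ b ψ q) (h m : ℝ) :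
    ContinuousOn (drift q h m) (Icc ρ₁ ρ₂) :=
  fun _ hr ↦ (P.hasDerivAt_drift h m (P.pos_of_mem hr)).continuousAt.continuousWithinAt

lemma continuousOn_driftDeriv (P : IsRadialPotential ρ₁ ρ₂ b ψ q) (h m : ℝ) :
    ContinuousOn (driftDeriv b q h m) (Icc ρ₁ ρ₂) := by
  have hq : ContinuousOn q (Icc ρ₁ ρ₂) := P.continuousOn_deriv.mono fun r hr ↦ P.pos_of_mem hr
  unfold driftDeriv
  refine ContinuousOn.sub (continuousOn_const.div (by fun_prop) fun r hr ↦ ?_)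
    (ContinuousOn.div_const (P.continuous_field.continuousOn.sub
      (hq.div continuousOn_id fun r hr ↦ (P.pos_of_mem hr).ne')) h)
  have := P.pos_of_mem hr
  positivity

lemma weight_pos (ψ : ℝ → ℝ) (h m : ℝ) {r : ℝ} (hr : 0 < r) : 0 < weight ψ h m r :=
  mul_pos (Real.rpow_pos_of_pos hr _) (Real.exp_pos _)

lemma hasDerivAt_weight (P : IsRadialPotential ρ₁ ρ₂ b ψ q) (h m : ℝ) {r : ℝ} (hr : 0 < r) :
    HasDerivAt (weight ψ h m) (drift q h m r * weight ψ h m r) r := by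
  have h1 := (Real.hasDerivAt_rpow_const (p := m + 1 / 2) (Or.inl hr.ne')).mul
    (((P.hasDerivAt r hr).neg.div_const h).exp)
  refine h1.congr_deriv ?_
  rw [drift, weight, Real.rpow_sub_one hr.ne']
  simp only [Pi.neg_apply]
  ring

lemma hasDerivWithinAt_weight (P : IsRadialPotential ρ₁ ρ₂ b ψ q) (h m : ℝ) :
    ∀ r ∈ Icc ρ₁ ρ₂, HasDerivWithinAt (weight ψ h m) (drift q h m r * weight ψ h m r)
      (Icc ρ₁ ρ₂) r :=
  fun _ hr ↦ (P.hasDerivAt_weight h m (P.pos_of_mem hr)).hasDerivWithinAt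

/-- Lower bound by the magnetic field. Writing `a_m` for the drift, this is the commutation identity
`∫ |x' + a_m x|² = ∫ |x' - a_{m+1} x|² + (2/h) ∫ b |x|²` for `x` vanishing at both end points; here
`y = -(x' + a_m x)`. -/
lemma field_mul_integral_le (P : IsRadialPotential ρ₁ ρ₂ b ψ q) {h m B₀ : ℝ} (hh : 0 < h)
    (hb : ∀ r ∈ Icc ρ₁ ρ₂, B₀ ≤ b r) {x y : ℝ → ℂ}
    (hx : ∀ r ∈ Icc ρ₁ ρ₂, HasDerivWithinAt x (-(drift q h m r * x r) - y r) (Icc ρ₁ ρ₂) r)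
    (hy : ContinuousOn y (Icc ρ₁ ρ₂)) (h₁ : x ρ₁ = 0) (h₂ : x ρ₂ = 0) :
    2 * B₀ / h * ∫ r in ρ₁..ρ₂, ‖x r‖ ^ 2 ≤ ∫ r in ρ₁..ρ₂, ‖y r‖ ^ 2 := by
  have hρ := P.lt.le
  have hl : ρ₁ ∈ Icc ρ₁ ρ₂ := ⟨le_rfl, hρ⟩
  have hrr : ρ₂ ∈ Icc ρ₁ ρ₂ := ⟨hρ, le_rfl⟩
  have hxc : ContinuousOn x (Icc ρ₁ ρ₂) := fun r hr ↦ (hx r hr).continuousWithinAt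
  have ha := P.continuousOn_drift h m
  have ha' := P.continuousOn_drift h (m + 1)
  have hd := P.continuousOn_driftDeriv h m
  have hd' := P.continuousOn_driftDeriv h (m + 1)
  have haC : ContinuousOn (fun r ↦ (drift q h m r : ℂ)) (Icc ρ₁ ρ₂) :=
    Complex.continuous_ofReal.comp_continuousOn ha
  -- `F' = ‖x' + a_m x‖² - ‖x' - a_{m+1} x‖² - (2 b / h) ‖x‖²` for `F = (a_m + a_{m+1}) ‖x‖²`.
  let F : ℝ → ℝ := fun r ↦ (drift q h m r + drift q h (m + 1) r) * ‖x r‖ ^ 2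
  let F' : ℝ → ℝ := fun r ↦ (driftDeriv b q h m r + driftDeriv b q h (m + 1) r) * ‖x r‖ ^ 2 +
    (drift q h m r + drift q h (m + 1) r) *
      (2 * inner ℝ (x r) (-(drift q h m r * x r) - y r))
  have hF : ∀ r ∈ Icc ρ₁ ρ₂, HasDerivWithinAt F (F' r) (Icc ρ₁ ρ₂) r := fun r hr ↦
    ((P.hasDerivAt_drift h m (P.pos_of_mem hr)).add
      (P.hasDerivAt_drift h (m + 1) (P.pos_of_mem hr))).hasDerivWithinAt.mul (hx r hr).norm_sq
  have hF'c : ContinuousOn F' (Icc ρ₁ ρ₂) := by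
    refine ContinuousOn.add ((hd.add hd').mul (hxc.norm.pow 2)) ((ha.add ha').mul ?_)
    exact continuousOn_const.mul (hxc.inner (((haC.mul hxc).neg).sub hy))
  have h0 := integral_eq_sub_of_hasDerivWithinAt_Icc hF hF'c hl hrr hρ
  have hF0 : F ρ₂ - F ρ₁ = 0 := by simp [F, h₁, h₂]
  rw [hF0] at h0
  have hmono : ∫ r in ρ₁..ρ₂, (2 * B₀ / h * ‖x r‖ ^ 2 + F' r) ≤ ∫ r in ρ₁..ρ₂, ‖y r‖ ^ 2 := by
    refine intervalIntegral.integral_mono_on hρ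
      (intervalIntegrable_of_continuousOn_Icc
        ((continuousOn_const.mul (hxc.norm.pow 2)).add hF'c) hl hrr)
      (intervalIntegrable_of_continuousOn_Icc (hy.norm.pow 2) hl hrr) fun r hr ↦ ?_
    have hr0 := P.pos_of_mem hr
    have hstep : F' r = ‖y r‖ ^ 2 -
        ‖-(drift q h m r * x r) - y r - drift q h (m + 1) r * x r‖ ^ 2 -
        2 * b r / h * ‖x r‖ ^ 2 := by
      simp only [F', Complex.inner, Complex.sq_norm, Complex.normSq_apply, Complex.sub_re,
        Complex.sub_im, Complex.neg_re, Complex.neg_im, Complex.mul_re, Complex.mul_im,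
        Complex.ofReal_re, Complex.ofReal_im, Complex.conj_re, Complex.conj_im, driftDeriv, drift]
      field_simp
      ring
    have hbr : 2 * B₀ / h * ‖x r‖ ^ 2 ≤ 2 * b r / h * ‖x r‖ ^ 2 := by
      have := hb r hr
      gcongr
    rw [hstep]
    nlinarith [sq_nonneg ‖-(drift q h m r * x r) - y r - drift q h (m + 1) r * x r‖]
  rw [intervalIntegral.integral_add
    (intervalIntegrable_of_continuousOn_Icc (continuousOn_const.fun_mul (hxc.norm.fun_pow 2)) hl hrr)
    (intervalIntegrable_of_continuousOn_Icc hF'c hl hrr), h0, add_zero,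
    intervalIntegral.integral_const_mul] at hmono
  exact hmono

/-- If two Dirichlet eigenfunctions are linearly independent, the larger eigenvalue is at least
`2 B₀ / h`. The combination `c₀ / E + c₁ v₁ + c₂ v₂` of `1 / E` and of the images `v₁, v₂` of the
eigenfunctions under `∂ - a` can be made to vanish at both end points, which makes it a test function
for `field_mul_integral_le`; there `1 / E` is orthogonal to `v₁, v₂` and is annihilated by `∂ + a`. -/
lemma two_mul_field_div_le (P : IsRadialPotential ρ₁ ρ₂ b ψ q) {h m B₀ : ℝ} (hh : 0 < h)
    (hb : ∀ r ∈ Icc ρ₁ ρ₂, B₀ ≤ b r) {u₁ v₁ u₂ v₂ : ℝ → ℂ} {ν₁ ν₂ Λ : ℝ}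
    (S₁ : IsDirichletSystem ρ₁ ρ₂ (drift q h m) (fun r ↦ ν₁ * u₁ r) u₁ v₁)
    (S₂ : IsDirichletSystem ρ₁ ρ₂ (drift q h m) (fun r ↦ ν₂ * u₂ r) u₂ v₂)
    (hν₁ : 0 < ν₁) (hν₂ : 0 < ν₂) (hΛ₁ : ν₁ ≤ Λ) (hΛ₂ : ν₂ ≤ Λ)
    (hind : ∀ c₁ c₂ : ℂ, (∀ r ∈ Icc ρ₁ ρ₂, c₁ * u₁ r + c₂ * u₂ r = 0) → c₁ = 0 ∧ c₂ = 0) :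
    2 * B₀ / h ≤ Λ := by
  have hρ := P.lt.le
  have hl : ρ₁ ∈ Icc ρ₁ ρ₂ := ⟨le_rfl, hρ⟩
  have hrr : ρ₂ ∈ Icc ρ₁ ρ₂ := ⟨hρ, le_rfl⟩
  have hii : ∀ {k : ℝ → ℂ}, ContinuousOn k (Icc ρ₁ ρ₂) → IntervalIntegrable k volume ρ₁ ρ₂ :=
    fun hk ↦ intervalIntegrable_of_continuousOn_Icc hk hl hrr
  have hiiR : ∀ {k : ℝ → ℝ}, ContinuousOn k (Icc ρ₁ ρ₂) → IntervalIntegrable k volume ρ₁ ρ₂ :=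
    fun hk ↦ intervalIntegrable_of_continuousOn_Icc hk hl hrr
  have hcj : ∀ {k : ℝ → ℂ}, ContinuousOn k (Icc ρ₁ ρ₂) →
      ContinuousOn (fun r ↦ conj (k r)) (Icc ρ₁ ρ₂) :=
    fun hk ↦ Complex.continuous_conj.comp_continuousOn hk
  set a := drift q h m with ha
  let v₀ : ℝ → ℂ := fun r ↦ ((weight ψ h m r)⁻¹ : ℝ)
  have hE0 : ∀ r ∈ Icc ρ₁ ρ₂, 0 < weight ψ h m r := fun r hr ↦ weight_pos ψ h m (P.pos_of_mem hr)
  have hv₀ : ∀ r ∈ Icc ρ₁ ρ₂, HasDerivWithinAt v₀ (-(a r * v₀ r)) (Icc ρ₁ ρ₂) r := by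
    intro r hr
    have h1 := ((P.hasDerivWithinAt_weight h m r hr).inv (hE0 r hr).ne').ofReal_comp
    refine h1.congr_deriv ?_
    have : (weight ψ h m r : ℂ) ≠ 0 := by exact_mod_cast (hE0 r hr).ne'
    simp only [v₀, ← ha]
    push_cast
    field_simp
  have hv₀c : ContinuousOn v₀ (Icc ρ₁ ρ₂) := fun r hr ↦ (hv₀ r hr).continuousWithinAt
  have hu₁ := S₁.continuousOn_fst
  have hu₂ := S₂.continuousOn_fst
  have hv₁ := S₁.continuousOn_snd
  have hv₂ := S₂.continuousOn_snd
  -- Two boundary conditions on three coefficients.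
  obtain ⟨c, hc0, hcM⟩ : ∃ c : Fin 3 → ℂ, c ≠ 0 ∧
      (!![v₀ ρ₁, v₁ ρ₁, v₂ ρ₁; v₀ ρ₂, v₁ ρ₂, v₂ ρ₂] : Matrix (Fin 2) (Fin 3) ℂ).mulVec c = 0 := by
    have hker := LinearMap.ker_ne_bot_of_finrank_lt
      (f := (!![v₀ ρ₁, v₁ ρ₁, v₂ ρ₁; v₀ ρ₂, v₁ ρ₂, v₂ ρ₂] : Matrix (Fin 2) (Fin 3) ℂ).mulVecLin)
      (by simp)
    obtain ⟨c, hc, hc0⟩ := Submodule.exists_mem_ne_zero_of_ne_bot hker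
    exact ⟨c, hc0, by simpa using hc⟩
  have e1 : c 0 * v₀ ρ₁ + c 1 * v₁ ρ₁ + c 2 * v₂ ρ₁ = 0 := by
    have := congrFun hcM 0
    simp [Matrix.mulVec, dotProduct, Fin.sum_univ_three] at this
    linear_combination this
  have e2 : c 0 * v₀ ρ₂ + c 1 * v₁ ρ₂ + c 2 * v₂ ρ₂ = 0 := by
    have := congrFun hcM 1
    simp [Matrix.mulVec, dotProduct, Fin.sum_univ_three] at this
    linear_combination this
  let x : ℝ → ℂ := fun r ↦ c 0 * v₀ r + (c 1 * v₁ r + c 2 * v₂ r)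
  let w : ℝ → ℂ := fun r ↦ c 1 * u₁ r + c 2 * u₂ r
  let s : ℝ → ℂ := fun r ↦ c 1 * v₁ r + c 2 * v₂ r
  let y : ℝ → ℂ := fun r ↦ c 1 * (ν₁ * u₁ r) + c 2 * (ν₂ * u₂ r)
  have hwc : ContinuousOn w (Icc ρ₁ ρ₂) := by fun_prop
  have hsc : ContinuousOn s (Icc ρ₁ ρ₂) := by fun_prop
  have hyc : ContinuousOn y (Icc ρ₁ ρ₂) := by fun_prop
  have hxc : ContinuousOn x (Icc ρ₁ ρ₂) := by fun_prop
  have hw : ∀ r ∈ Icc ρ₁ ρ₂, HasDerivWithinAt w (a r * w r + s r) (Icc ρ₁ ρ₂) r := fun r hr ↦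
    (((S₁.deriv_left r hr).const_mul (c 1)).add ((S₂.deriv_left r hr).const_mul (c 2))).congr_deriv
      (by simp only [w, s]; ring)
  have hs : ∀ r ∈ Icc ρ₁ ρ₂, HasDerivWithinAt s (-(a r * s r) - y r) (Icc ρ₁ ρ₂) r := fun r hr ↦
    (((S₁.deriv_right r hr).const_mul (c 1)).add
      ((S₂.deriv_right r hr).const_mul (c 2))).congr_deriv (by simp only [y, s]; ring)
  have hx : ∀ r ∈ Icc ρ₁ ρ₂, HasDerivWithinAt x (-(a r * x r) - y r) (Icc ρ₁ ρ₂) r := fun r hr ↦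
    (((hv₀ r hr).const_mul (c 0)).add (hs r hr)).congr_deriv (by simp only [x, s]; ring)
  have hw1 : w ρ₁ = 0 := by simp [w, S₁.left, S₂.left]
  have hw2 : w ρ₂ = 0 := by simp [w, S₁.right, S₂.right]
  have hx1 : x ρ₁ = 0 := by simp only [x]; linear_combination e1
  have hx2 : x ρ₂ = 0 := by simp only [x]; linear_combination e2
  have hB := P.field_mul_integral_le hh hb hx hyc hx1 hx2
  -- `x` does not vanish identically
  have hx0 : ∃ r ∈ Icc ρ₁ ρ₂, x r ≠ 0 := by
    by_contra! hx0
    have hy0 : ∀ r ∈ Icc ρ₁ ρ₂, y r = 0 := by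
      intro r hr
      have h1 : HasDerivWithinAt x 0 (Icc ρ₁ ρ₂) r :=
        (hasDerivWithinAt_const r (Icc ρ₁ ρ₂) (0 : ℂ)).congr hx0 (hx0 r hr)
      have h2 := ((uniqueDiffOn_Icc P.lt) r hr).eq_deriv _ (hx r hr) h1
      rw [hx0 r hr] at h2
      linear_combination -h2
    obtain ⟨h1, h2⟩ := hind (c 1 * ν₁) (c 2 * ν₂) fun r hr ↦ by
      have := hy0 r hr
      simp only [y] at this
      linear_combination this
    have h1' : c 1 = 0 := by simpa [hν₁.ne'] using h1
    have h2' : c 2 = 0 := by simpa [hν₂.ne'] using h2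
    have h0 := hx0 ρ₁ hl
    have hv00 : v₀ ρ₁ ≠ 0 := by
      simp only [v₀]
      exact_mod_cast (inv_pos.2 (hE0 ρ₁ hl)).ne'
    simp only [x, h1', h2', zero_mul, add_zero, mul_eq_zero, hv00, or_false] at h0
    exact hc0 (by ext i; fin_cases i <;> simp [h0, h1', h2'])
  have hxpos : 0 < ∫ r in ρ₁..ρ₂, ‖x r‖ ^ 2 := by
    refine intervalIntegral.integral_pos P.lt (hxc.norm.pow 2) (fun _ _ ↦ sq_nonneg _) ?_
    obtain ⟨r, hr, hr0⟩ := hx0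
    exact ⟨r, hr, by positivity⟩
  have hS0 : ∫ r in ρ₁..ρ₂, conj (s r) * v₀ r = 0 := by
    have := integral_conj_mul_eq hρ hw (x := v₀) (y := fun _ ↦ 0)
      (fun r hr ↦ by simpa using hv₀ r hr) hsc continuousOn_const hw1 hw2
    simpa using this.symm
  have hSS : ∫ r in ρ₁..ρ₂, conj (w r) * y r = ∫ r in ρ₁..ρ₂, conj (s r) * s r :=
    integral_conj_mul_eq hρ hw hs hsc hyc hw1 hw2
  have hcross : (ν₁ - ν₂ : ℂ) * ∫ r in ρ₁..ρ₂, conj (u₁ r) * u₂ r = 0 := by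
    have h1 := integral_conj_mul_eq hρ S₁.deriv_left S₂.deriv_right hv₁
      (continuousOn_const.mul hu₂) S₁.left S₁.right
    have h2 := integral_conj_mul_eq hρ S₂.deriv_left S₁.deriv_right hv₂
      (continuousOn_const.mul hu₁) S₂.left S₂.right
    have h3 := congrArg conj h2
    rw [← intervalIntegral.intervalIntegral_conj, ← intervalIntegral.intervalIntegral_conj] at h3
    have h4 : ∫ r in ρ₁..ρ₂, conj (u₁ r) * ((ν₂ : ℂ) * u₂ r) =
        ν₂ * ∫ r in ρ₁..ρ₂, conj (u₁ r) * u₂ r := by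
      rw [← intervalIntegral.integral_const_mul]
      exact intervalIntegral.integral_congr fun r _ ↦ by ring
    have h5 : ∫ r in ρ₁..ρ₂, conj (conj (u₂ r) * ((ν₁ : ℂ) * u₁ r)) =
        ν₁ * ∫ r in ρ₁..ρ₂, conj (u₁ r) * u₂ r := by
      rw [← intervalIntegral.integral_const_mul]
      refine intervalIntegral.integral_congr fun r _ ↦ ?_
      simp only [map_mul, Complex.conj_conj, Complex.conj_ofReal]
      ring
    have h6 : ∫ r in ρ₁..ρ₂, conj (conj (v₂ r) * v₁ r) = ∫ r in ρ₁..ρ₂, conj (v₁ r) * v₂ r := by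
      refine intervalIntegral.integral_congr fun r _ ↦ ?_
      simp only [map_mul, Complex.conj_conj]
      ring
    rw [h4] at h1
    rw [h5, h6] at h3
    linear_combination h3 - h1
  have hxs : ∫ r in ρ₁..ρ₂, ‖s r‖ ^ 2 ≤ ∫ r in ρ₁..ρ₂, ‖x r‖ ^ 2 := by
    have h1 : ∫ r in ρ₁..ρ₂, (‖s r‖ ^ 2 + 2 * (c 0 * (conj (s r) * v₀ r)).re) ≤
        ∫ r in ρ₁..ρ₂, ‖x r‖ ^ 2 := by
      refine intervalIntegral.integral_mono_on hρ (hiiR ?_) (hiiR (hxc.norm.pow 2)) fun r hr ↦ ?_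
      · exact (hsc.norm.pow 2).add (continuousOn_const.mul (Complex.continuous_re.comp_continuousOn
          (continuousOn_const.mul ((hcj hsc).mul hv₀c))))
      · have : x r = c 0 * v₀ r + s r := rfl
        rw [this]
        have h2 : ‖c 0 * v₀ r + s r‖ ^ 2 =
            ‖c 0 * v₀ r‖ ^ 2 + (‖s r‖ ^ 2 + 2 * (c 0 * (conj (s r) * v₀ r)).re) := by
          simp only [Complex.sq_norm, Complex.normSq_apply, Complex.add_re, Complex.add_im,
            Complex.mul_re, Complex.mul_im, Complex.conj_re, Complex.conj_im]
          ring
        rw [h2]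
        linarith [sq_nonneg ‖c 0 * v₀ r‖]
    rw [intervalIntegral.integral_add (hiiR (hsc.norm.fun_pow 2)) (hiiR
      (continuousOn_const.fun_mul (Complex.continuous_re.comp_continuousOn'
          (continuousOn_const.fun_mul ((hcj hsc).fun_mul hv₀c))))),
      intervalIntegral.integral_const_mul,
      ← re_intervalIntegral (hii (continuousOn_const.fun_mul ((hcj hsc).fun_mul hv₀c))),
      intervalIntegral.integral_const_mul, hS0] at h1
    simpa using h1
  have hys : ∫ r in ρ₁..ρ₂, ‖y r‖ ^ 2 ≤ Λ * ∫ r in ρ₁..ρ₂, ‖s r‖ ^ 2 := by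
    have h1 : ∫ r in ρ₁..ρ₂, ‖s r‖ ^ 2 = ∫ r in ρ₁..ρ₂, (conj (w r) * y r).re := by
      rw [← re_intervalIntegral (hii ((hcj hwc).fun_mul hyc)), hSS, integral_conj_mul_self,
        Complex.ofReal_re]
    let k : ℝ := (Λ - ν₁) * ν₂ + (Λ - ν₂) * ν₁
    let kc : ℂ := (k : ℂ) * (conj (c 1) * c 2)
    have h2 : 0 ≤ ∫ r in ρ₁..ρ₂, (Λ * (conj (w r) * y r).re - ‖y r‖ ^ 2) := by
      by_cases hνν : ν₁ = ν₂
      · refine intervalIntegral.integral_nonneg hρ fun r hr ↦ ?_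
        have hyw : y r = ν₁ * w r := by simp only [y, w, hνν]; ring
        have h3 : Λ * (conj (w r) * y r).re - ‖y r‖ ^ 2 = (Λ - ν₁) * ν₁ * ‖w r‖ ^ 2 := by
          rw [hyw]
          simp only [Complex.sq_norm, Complex.normSq_apply, Complex.mul_re, Complex.mul_im,
            Complex.conj_re, Complex.conj_im, Complex.ofReal_re, Complex.ofReal_im]
          ring
        rw [h3]
        have := sub_nonneg.2 hΛ₁
        positivity
      · have h3 : ∫ r in ρ₁..ρ₂, (conj (u₁ r) * u₂ r) = 0 := by
          refine (mul_eq_zero.1 hcross).resolve_left ?_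
          exact sub_ne_zero.2 (by exact_mod_cast hνν)
        have h4 : ∫ r in ρ₁..ρ₂, (kc * (conj (u₁ r) * u₂ r)).re = 0 := by
          rw [← re_intervalIntegral (hii (continuousOn_const.fun_mul ((hcj hu₁).fun_mul hu₂))),
            intervalIntegral.integral_const_mul, h3, mul_zero, Complex.zero_re]
        rw [← h4]
        refine intervalIntegral.integral_mono_on hρ (hiiR ?_) (hiiR ?_) fun r hr ↦ ?_
        · exact Complex.continuous_re.comp_continuousOn
            (continuousOn_const.mul ((hcj hu₁).mul hu₂))
        · exact (continuousOn_const.mul (Complex.continuous_re.comp_continuousOn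
            ((hcj hwc).mul hyc))).sub (hyc.norm.pow 2)
        · have h5 : Λ * (conj (w r) * y r).re - ‖y r‖ ^ 2 =
              (Λ - ν₁) * ν₁ * ‖c 1 * u₁ r‖ ^ 2 + (Λ - ν₂) * ν₂ * ‖c 2 * u₂ r‖ ^ 2 +
                (kc * (conj (u₁ r) * u₂ r)).re := by
            simp only [kc, k, w, y, Complex.sq_norm, Complex.normSq_apply, Complex.add_re,
              Complex.add_im, Complex.mul_re, Complex.mul_im, Complex.conj_re, Complex.conj_im,
              Complex.ofReal_re, Complex.ofReal_im]
            ring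
          rw [h5]
          have := sub_nonneg.2 hΛ₁
          have := sub_nonneg.2 hΛ₂
          have : 0 ≤ (Λ - ν₁) * ν₁ * ‖c 1 * u₁ r‖ ^ 2 + (Λ - ν₂) * ν₂ * ‖c 2 * u₂ r‖ ^ 2 := by
            positivity
          linarith
    rw [intervalIntegral.integral_sub (hiiR (continuousOn_const.fun_mul
      (Complex.continuous_re.comp_continuousOn' ((hcj hwc).fun_mul hyc))))
      (hiiR (hyc.norm.fun_pow 2)),
      intervalIntegral.integral_const_mul, ← h1] at h2
    linarith
  have hΛ0 : 0 ≤ Λ := hν₁.le.trans hΛ₁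
  have hfin := hB.trans (hys.trans (mul_le_mul_of_nonneg_left hxs hΛ0))
  exact le_of_mul_le_mul_right hfin hxpos

end IsRadialPotential

end RadialPauli

/-! ### Eigenvectors are classical solutions -/

namespace RadialPauli
open scoped ComplexConjugate

namespace IsRadialPotential

variable {ρ₁ ρ₂ : ℝ} {b ψ q : ℝ → ℝ} {φ : Plane → ℝ}

lemma deriv_radialProfile (P : IsRadialPotential ρ₁ ρ₂ b ψ q)
    (hφ : EqOn (radialProfile φ) ψ (Icc ρ₁ ρ₂)) {r : ℝ} (hr : r ∈ Ioo ρ₁ ρ₂) :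
    deriv (radialProfile φ) r = q r := by
  have h1 : radialProfile φ =ᶠ[𝓝 r] ψ := by
    filter_upwards [Icc_mem_nhds hr.1 hr.2] with s hs using hφ hs
  rw [h1.deriv_eq]
  exact (P.hasDerivAt r (P.pos_of_mem (Ioo_subset_Icc_self hr))).deriv

/-- The composite `d d^×` at a point where `u` is differentiable near `r` and `u'` has a derivative
`y'` at `r`. -/
lemma diracOp_diracOpAdj (P : IsRadialPotential ρ₁ ρ₂ b ψ q)
    (hφ : EqOn (radialProfile φ) ψ (Icc ρ₁ ρ₂)) (h m : ℝ) {u y : ℝ → ℂ} {y' : ℂ} {r : ℝ}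
    (hr : r ∈ Ioo ρ₁ ρ₂) (hu : ∀ s ∈ Ioo ρ₁ ρ₂, deriv u s = y s)
    (hur : HasDerivAt u (y r) r) (hy : HasDerivAt y y' r) :
    diracOp φ h m (diracOpAdj φ h m u) r =
      -(h : ℂ) ^ 2 * (y' - driftDeriv b q h m r * u r - drift q h m r * y r +
        drift q h m r * (y r - drift q h m r * u r)) := by
  have hr0 := P.pos_of_mem (Ioo_subset_Icc_self hr)
  have hadj : ∀ s ∈ Ioo ρ₁ ρ₂, diracOpAdj φ h m u s =
      -(Complex.I * h) * (y s - drift q h m s * u s) := fun s hs ↦ by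
    rw [diracOpAdj, hu s hs, P.deriv_radialProfile hφ hs, drift]
  have hev : diracOpAdj φ h m u =ᶠ[𝓝 r]
      fun s ↦ -(Complex.I * h) * (y s - drift q h m s * u s) := by
    filter_upwards [Ioo_mem_nhds hr.1 hr.2] with s hs using hadj s hs
  have hd := ((hy.sub ((P.hasDerivAt_drift h m hr0).ofReal_comp.mul hur)).const_mul
    (-(Complex.I * h))).congr_of_eventuallyEq hev
  rw [diracOp, hd.deriv, hadj r hr, P.deriv_radialProfile hφ hr]
  rw [show (m + 1 / 2) / r - q r / h = drift q h m r from rfl]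
  linear_combination (h : ℂ) ^ 2 * (y' - driftDeriv b q h m r * u r - drift q h m r * y r +
        drift q h m r * (y r - drift q h m r * u r)) * Complex.I_sq

/-- Eigenvectors are classical: an eigenvector of `d d^×` agrees almost everywhere with a solution
of the first-order Dirichlet system. -/
lemma exists_isDirichletSystem (P : IsRadialPotential ρ₁ ρ₂ b ψ q)
    (hφ : EqOn (radialProfile φ) ψ (Icc ρ₁ ρ₂)) {h m ν : ℝ} (hh : 0 < h)
    {f : Lp ℂ 2 (intervalMeasure ρ₁ ρ₂)} (hf : IsPauliEigenvector ρ₁ ρ₂ φ h m ν f) :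
    ∃ u v : ℝ → ℂ, f =ᵐ[intervalMeasure ρ₁ ρ₂] u ∧
      IsDirichletSystem ρ₁ ρ₂ (drift q h m) (fun r ↦ (ν / h ^ 2 : ℝ) * u r) u v := by
  obtain ⟨-, u, ⟨⟨⟨huAC, -⟩, ⟨hyAC, -⟩⟩, hu1, hu2⟩, hfu, heq⟩ := hf
  have hρ := P.lt.le
  set y := derivWithin u (Icc ρ₁ ρ₂) with hy
  have huc : ContinuousOn u (Icc ρ₁ ρ₂) := by simpa [uIcc_of_le hρ] using huAC.continuousOn
  have hyc : ContinuousOn y (Icc ρ₁ ρ₂) := by simpa [uIcc_of_le hρ] using hyAC.continuousOn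
  have hderiv : ∀ s ∈ Ioo ρ₁ ρ₂, deriv u s = y s := fun s hs ↦
    (derivWithin_of_mem_nhds (Icc_mem_nhds hs.1 hs.2)).symm
  have hu : ∀ r ∈ Icc ρ₁ ρ₂, HasDerivWithinAt u (y r) (Icc ρ₁ ρ₂) r := by
    intro r hr
    refine hasDerivWithinAt_of_absolutelyContinuous hρ huAC ?_ hyc hr
    filter_upwards [huAC.boundedVariationOn.ae_differentiableAt_of_mem_uIcc] with s hs hsI
    rw [← hderiv s hsI]
    exact (hs (by rw [uIcc_of_le hρ]; exact Ioo_subset_Icc_self hsI)).hasDerivAt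
  have haC : ContinuousOn (fun r ↦ (drift q h m r : ℂ)) (Icc ρ₁ ρ₂) :=
    Complex.continuous_ofReal.comp_continuousOn (P.continuousOn_drift h m)
  have hdC : ContinuousOn (fun r ↦ (driftDeriv b q h m r : ℂ)) (Icc ρ₁ ρ₂) :=
    Complex.continuous_ofReal.comp_continuousOn (P.continuousOn_driftDeriv h m)
  let g : ℝ → ℂ := fun r ↦ driftDeriv b q h m r * u r + drift q h m r * y r -
    drift q h m r * (y r - drift q h m r * u r) - (ν / h ^ 2 : ℝ) * u r
  have hgc : ContinuousOn g (Icc ρ₁ ρ₂) := by fun_prop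
  have hyd : ∀ r ∈ Icc ρ₁ ρ₂, HasDerivWithinAt y (g r) (Icc ρ₁ ρ₂) r := by
    intro r hr
    refine hasDerivWithinAt_of_absolutelyContinuous hρ hyAC ?_ hgc hr
    filter_upwards [hyAC.boundedVariationOn.ae_differentiableAt_of_mem_uIcc,
      (ae_restrict_iff' measurableSet_Ioo).1 heq] with s hs hs2 hsI
    have hsc := Ioo_subset_Icc_self hsI
    have hys := (hs (by rw [uIcc_of_le hρ]; exact hsc)).hasDerivAt
    have hus := (hu s hsc).hasDerivAt (Icc_mem_nhds hsI.1 hsI.2)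
    have h1 := P.diracOp_diracOpAdj hφ h m hsI hderiv hus hys
    rw [hs2 hsI] at h1
    have hhC : (h : ℂ) ≠ 0 := by exact_mod_cast hh.ne'
    refine hys.congr_deriv ?_
    simp only [g]
    push_cast
    field_simp
    linear_combination h1
  refine ⟨u, fun r ↦ y r - drift q h m r * u r, hfu, ⟨fun r hr ↦ ?_, fun r hr ↦ ?_, hu1, hu2⟩⟩
  · exact (hu r hr).congr_deriv (by ring)
  · refine ((hyd r hr).sub ((P.hasDerivAt_drift h m
      (P.pos_of_mem hr)).ofReal_comp.hasDerivWithinAt.mul (hu r hr))).congr_deriv ?_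
    simp only [g]
    ring

/-- Conversely, a nonzero classical solution of the Dirichlet system is an eigenvector. -/
lemma isPauliEigenvector (P : IsRadialPotential ρ₁ ρ₂ b ψ q)
    (hφ : EqOn (radialProfile φ) ψ (Icc ρ₁ ρ₂)) {h m ν : ℝ} (hh : 0 < h)
    {f : Lp ℂ 2 (intervalMeasure ρ₁ ρ₂)} (hf : f ≠ 0) {u v : ℝ → ℂ}
    (hfu : f =ᵐ[intervalMeasure ρ₁ ρ₂] u)
    (S : IsDirichletSystem ρ₁ ρ₂ (drift q h m) (fun r ↦ (ν / h ^ 2 : ℝ) * u r) u v) :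
    IsPauliEigenvector ρ₁ ρ₂ φ h m ν f := by
  have hρ := P.lt.le
  have huc := S.continuousOn_fst
  have hvc := S.continuousOn_snd
  have haC : ContinuousOn (fun r ↦ (drift q h m r : ℂ)) (Icc ρ₁ ρ₂) :=
    Complex.continuous_ofReal.comp_continuousOn (P.continuousOn_drift h m)
  have hdC : ContinuousOn (fun r ↦ (driftDeriv b q h m r : ℂ)) (Icc ρ₁ ρ₂) :=
    Complex.continuous_ofReal.comp_continuousOn (P.continuousOn_driftDeriv h m)
  let y : ℝ → ℂ := fun r ↦ drift q h m r * u r + v r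
  let g : ℝ → ℂ := fun r ↦ (driftDeriv b q h m r * u r +
    drift q h m r * (drift q h m r * u r + v r)) + (-(drift q h m r * v r) - (ν / h ^ 2 : ℝ) * u r)
  have hgc : ContinuousOn g (Icc ρ₁ ρ₂) := by fun_prop
  have hyd : ∀ r ∈ Icc ρ₁ ρ₂, HasDerivWithinAt y (g r) (Icc ρ₁ ρ₂) r := fun r hr ↦
    ((P.hasDerivAt_drift h m (P.pos_of_mem hr)).ofReal_comp.hasDerivWithinAt.mul
      (S.deriv_left r hr)).add (S.deriv_right r hr)
  have hdw : ∀ r ∈ Icc ρ₁ ρ₂, derivWithin u (Icc ρ₁ ρ₂) r = y r := fun r hr ↦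
    (S.deriv_left r hr).derivWithin (uniqueDiffOn_Icc P.lt r hr)
  have hderiv : ∀ r ∈ Ioo ρ₁ ρ₂, HasDerivAt u (y r) r := fun r hr ↦
    (S.deriv_left r (Ioo_subset_Icc_self hr)).hasDerivAt (Icc_mem_nhds hr.1 hr.2)
  refine ⟨hf, u, ⟨⟨memH1_of_hasDerivWithinAt hρ S.deriv_left ((haC.mul huc).add hvc),
    memH1_of_hasDerivWithinAt hρ (fun r hr ↦ (hyd r hr).congr hdw (hdw r hr)) hgc⟩,
    S.left, S.right⟩, hfu, ?_⟩
  filter_upwards [ae_restrict_mem measurableSet_Ioo] with r hr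
  rw [P.diracOp_diracOpAdj hφ h m hr (fun s hs ↦ (hderiv s hs).deriv) (hderiv r hr)
    ((hyd r (Ioo_subset_Icc_self hr)).hasDerivAt (Icc_mem_nhds hr.1 hr.2))]
  have hhC : (h : ℂ) ≠ 0 := by exact_mod_cast hh.ne'
  simp only [g, y]
  push_cast
  field_simp
  ring

end IsRadialPotential

lemma exists_ne_zero_of_ae_eq {ρ₁ ρ₂ : ℝ} {f : Lp ℂ 2 (intervalMeasure ρ₁ ρ₂)} {u : ℝ → ℂ}
    (hf : f ≠ 0) (hfu : f =ᵐ[intervalMeasure ρ₁ ρ₂] u) : ∃ r ∈ Icc ρ₁ ρ₂, u r ≠ 0 := by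
  by_contra! hu
  refine hf ((Lp.eq_zero_iff_ae_eq_zero).2 (hfu.trans ?_))
  filter_upwards [ae_restrict_mem measurableSet_Ioo] with r hr using hu r (Ioo_subset_Icc_self hr)

namespace IsRadialPotential

variable {ρ₁ ρ₂ : ℝ} {b ψ q : ℝ → ℝ} {φ : Plane → ℝ}

/-- The trace of the Green operator `(d d^×)⁻¹`, up to the factor `h⁻²`: the integral of the diagonal
`E² α β / (α + β)` of the Green kernel, where `α` and `β` are the integrals of `E⁻²` from the left
and from the right end point. -/
def _root_.RadialPauli.greenTrace (ρ₁ ρ₂ : ℝ) (ψ : ℝ → ℝ) (h m : ℝ) : ℝ :=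
  (∫ r in ρ₁..ρ₂, weight ψ h m r ^ 2 * (∫ s in ρ₁..r, (weight ψ h m s)⁻¹ ^ 2) *
    (∫ s in r..ρ₂, (weight ψ h m s)⁻¹ ^ 2)) / ∫ s in ρ₁..ρ₂, (weight ψ h m s)⁻¹ ^ 2

lemma continuousOn_weight (P : IsRadialPotential ρ₁ ρ₂ b ψ q) (h m : ℝ) :
    ContinuousOn (weight ψ h m) (Icc ρ₁ ρ₂) :=
  fun r hr ↦ (P.hasDerivWithinAt_weight h m r hr).continuousWithinAt

lemma continuousOn_weight_inv (P : IsRadialPotential ρ₁ ρ₂ b ψ q) (h m : ℝ) :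
    ContinuousOn (fun r ↦ (weight ψ h m r)⁻¹) (Icc ρ₁ ρ₂) :=
  (P.continuousOn_weight h m).inv₀ fun _ hr ↦ (weight_pos ψ h m (P.pos_of_mem hr)).ne'

lemma integral_weight_inv_pos (P : IsRadialPotential ρ₁ ρ₂ b ψ q) (h m : ℝ) {r s : ℝ}
    (hr : r ∈ Icc ρ₁ ρ₂) (hs : s ∈ Icc ρ₁ ρ₂) (hrs : r < s) :
    0 < ∫ t in r..s, (weight ψ h m t)⁻¹ ^ 2 := by
  refine intervalIntegral.integral_pos hrs
    (((P.continuousOn_weight_inv h m).mono (Icc_subset_Icc hr.1 hs.2)).pow 2)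
    (fun _ _ ↦ sq_nonneg _) ⟨r, ⟨le_rfl, hrs.le⟩, ?_⟩
  have := weight_pos ψ h m (P.pos_of_mem hr)
  positivity

/-- Every eigenvalue is positive and at least the inverse of the trace of the Green operator. -/
lemma one_le_eigenvalue_mul_greenTrace (P : IsRadialPotential ρ₁ ρ₂ b ψ q)
    (hφ : EqOn (radialProfile φ) ψ (Icc ρ₁ ρ₂)) {h m ν : ℝ} (hh : 0 < h)
    {f : Lp ℂ 2 (intervalMeasure ρ₁ ρ₂)} (hf : IsPauliEigenvector ρ₁ ρ₂ φ h m ν f) :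
    1 ≤ ν / h ^ 2 * greenTrace ρ₁ ρ₂ ψ h m := by
  obtain ⟨u, v, hfu, S⟩ := P.exists_isDirichletSystem hφ hh hf
  have h1 := S.one_le_mul_trace P.lt (P.hasDerivWithinAt_weight h m)
    (fun r hr ↦ weight_pos ψ h m (P.pos_of_mem hr)) (exists_ne_zero_of_ae_eq hf.1 hfu)
  have h2 := P.integral_weight_inv_pos h m (r := ρ₁) (s := ρ₂) ⟨le_rfl, P.lt.le⟩
    ⟨P.lt.le, le_rfl⟩ P.lt
  rw [greenTrace, ← mul_div_assoc, le_div_iff₀ h2, one_mul]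
  exact h1

lemma greenTrace_nonneg (P : IsRadialPotential ρ₁ ρ₂ b ψ q) (h m : ℝ) :
    0 ≤ greenTrace ρ₁ ρ₂ ψ h m := by
  refine div_nonneg (intervalIntegral.integral_nonneg P.lt.le fun r hr ↦ ?_)
    (intervalIntegral.integral_nonneg P.lt.le fun _ _ ↦ sq_nonneg _)
  exact mul_nonneg (mul_nonneg (sq_nonneg _)
    (intervalIntegral.integral_nonneg hr.1 fun _ _ ↦ sq_nonneg _))
    (intervalIntegral.integral_nonneg hr.2 fun _ _ ↦ sq_nonneg _)

lemma greenTrace_pos_of_eigenvector (P : IsRadialPotential ρ₁ ρ₂ b ψ q)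
    (hφ : EqOn (radialProfile φ) ψ (Icc ρ₁ ρ₂)) {h m ν : ℝ} (hh : 0 < h)
    {f : Lp ℂ 2 (intervalMeasure ρ₁ ρ₂)} (hf : IsPauliEigenvector ρ₁ ρ₂ φ h m ν f) :
    0 < greenTrace ρ₁ ρ₂ ψ h m ∧ 0 < ν := by
  have h1 := P.one_le_eigenvalue_mul_greenTrace hφ hh hf
  have h2 := P.greenTrace_nonneg h m
  have h3 : 0 < greenTrace ρ₁ ρ₂ ψ h m := by
    refine lt_of_le_of_ne h2 fun h0 ↦ ?_
    rw [← h0, mul_zero] at h1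
    linarith
  refine ⟨h3, ?_⟩
  by_contra! hν
  have : ν / h ^ 2 * greenTrace ρ₁ ρ₂ ψ h m ≤ 0 :=
    mul_nonpos_of_nonpos_of_nonneg (div_nonpos_of_nonpos_of_nonneg hν (by positivity)) h2
  linarith

/-- Two linearly independent eigenvectors cannot both have eigenvalues below `2 h B₀`. -/
lemma two_mul_le_of_linearIndependent (P : IsRadialPotential ρ₁ ρ₂ b ψ q)
    (hφ : EqOn (radialProfile φ) ψ (Icc ρ₁ ρ₂)) {h m ν₁ ν₂ Λ B₀ : ℝ} (hh : 0 < h)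
    (hb : ∀ r ∈ Icc ρ₁ ρ₂, B₀ ≤ b r)
    {f₁ f₂ : Lp ℂ 2 (intervalMeasure ρ₁ ρ₂)} (hf₁ : IsPauliEigenvector ρ₁ ρ₂ φ h m ν₁ f₁)
    (hf₂ : IsPauliEigenvector ρ₁ ρ₂ φ h m ν₂ f₂) (h₁ : ν₁ ≤ Λ) (h₂ : ν₂ ≤ Λ)
    (hind : ∀ c₁ c₂ : ℂ, c₁ • f₁ + c₂ • f₂ = 0 → c₁ = 0 ∧ c₂ = 0) :
    2 * h * B₀ ≤ Λ := by
  obtain ⟨u₁, v₁, hfu₁, S₁⟩ := P.exists_isDirichletSystem hφ hh hf₁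
  obtain ⟨u₂, v₂, hfu₂, S₂⟩ := P.exists_isDirichletSystem hφ hh hf₂
  have hν₁ := (P.greenTrace_pos_of_eigenvector hφ hh hf₁).2
  have hν₂ := (P.greenTrace_pos_of_eigenvector hφ hh hf₂).2
  have key := P.two_mul_field_div_le hh hb S₁ S₂ (Λ := Λ / h ^ 2) (by positivity) (by positivity)
    (by gcongr) (by gcongr) fun c₁ c₂ hc ↦ hind c₁ c₂ ?_
  · rw [div_le_div_iff₀ hh (by positivity)] at key
    have : h * (2 * h * B₀) ≤ h * Λ := by linarith
    exact le_of_mul_le_mul_left this hh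
  · refine (Lp.eq_zero_iff_ae_eq_zero).2 ?_
    filter_upwards [ae_restrict_mem measurableSet_Ioo, hfu₁, hfu₂, Lp.coeFn_add (c₁ • f₁) (c₂ • f₂),
      Lp.coeFn_smul c₁ f₁, Lp.coeFn_smul c₂ f₂] with r hr e1 e2 e3 e4 e5
    rw [e3, Pi.add_apply, e4, e5, Pi.smul_apply, Pi.smul_apply, e1, e2]
    exact hc r (Ioo_subset_Icc_self hr)

end IsRadialPotential

end RadialPauli

/-! ### Compact symmetric operators and integral operators -/

namespace RadialPauli
open scoped ComplexConjugate InnerProductSpace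

section Spectral

variable {H : Type*} [NormedAddCommGroup H] [InnerProductSpace ℂ H] [CompleteSpace H]

/-- A compact symmetric operator of infinite rank has arbitrarily many linearly independent
eigenvectors with nonzero eigenvalues: if these eigenvectors spanned a finite-dimensional space, then
that space would contain the range, because it is orthogonal to the kernel. -/
lemma exists_linearIndependent_eigenvectors {T : H →L[ℂ] H} (hT : IsCompactOperator T)
    (hsymm : T.IsSymmetric) (hrank : ¬ FiniteDimensional ℂ (LinearMap.range T.toLinearMap)) (n : ℕ) :
    ∃ v : Fin n → H, LinearIndependent ℂ v ∧
      ∀ i, ∃ μ : ℂ, μ ≠ 0 ∧ Module.End.HasEigenvector (T : Module.End ℂ H) μ (v i) := by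
  set S : Set H := {x | ∃ μ : ℂ, μ ≠ 0 ∧ Module.End.HasEigenvector (T : Module.End ℂ H) μ x} with hS
  obtain ⟨B, hBS, hBspan, hBind⟩ := exists_linearIndependent ℂ S
  have hinf : B.Infinite := by
    intro hfin
    have hV : FiniteDimensional ℂ (Submodule.span ℂ S) := by
      rw [← hBspan]; exact FiniteDimensional.span_of_finite ℂ hfin
    refine hrank (Submodule.finiteDimensional_of_le (S₂ := Submodule.span ℂ S) ?_)
    rintro _ ⟨x, rfl⟩
    set V := Submodule.span ℂ S
    have hker : ∀ e : H, T e = 0 → e ∈ Vᗮ := by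
      intro e he
      rw [Submodule.mem_orthogonal']
      intro s hs
      induction hs using Submodule.span_induction with
      | mem s hs =>
        obtain ⟨μ, hμ, hs⟩ := hs
        have h1 : ⟪T e, s⟫_ℂ = ⟪e, T s⟫_ℂ := hsymm e s
        have h2 : T s = μ • s := hs.apply_eq_smul
        rw [he, inner_zero_left, h2, inner_smul_right] at h1
        exact (mul_eq_zero.1 h1.symm).resolve_left hμ
      | zero => simp
      | add x y _ _ hx hy => rw [inner_add_right, hx, hy, add_zero]
      | smul c x _ hx => rw [inner_smul_right, hx, mul_zero]
    have hz : T x - V.starProjection (T x) ∈ (⨆ μ, Module.End.eigenspace (T : Module.End ℂ H) μ)ᗮ := by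
      rw [← Submodule.iInf_orthogonal, Submodule.mem_iInf]
      intro μ
      rw [Submodule.mem_orthogonal]
      intro e he
      have hmem : T e = μ • e := Module.End.mem_eigenspace_iff.1 he
      by_cases hμ : μ = 0
      · rw [hμ, zero_smul] at hmem
        have h1 : ⟪T e, x⟫_ℂ = ⟪e, T x⟫_ℂ := hsymm e x
        rw [hmem, inner_zero_left] at h1
        rw [inner_sub_right, ← h1, (Submodule.mem_orthogonal' _ _).1 (hker e hmem) _
          (Submodule.starProjection_apply_mem V (T x)), sub_zero]
      · by_cases he0 : e = 0
        · simp [he0]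
        · have heV : e ∈ V := Submodule.subset_span ⟨μ, hμ, he, he0⟩
          exact (Submodule.mem_orthogonal _ _).1
            (Submodule.sub_starProjection_mem_orthogonal (T x)) e heV
    rw [ContinuousLinearMap.orthogonalComplement_iSup_eigenspaces_eq_bot hT hsymm,
      Submodule.mem_bot, sub_eq_zero] at hz
    change T x ∈ V
    rw [hz]
    exact Submodule.starProjection_apply_mem V (T x)
  refine ⟨fun i ↦ (hinf.natEmbedding B i : H), ?_, fun i ↦ hBS (hinf.natEmbedding B i).2⟩
  exact hBind.comp (fun i : Fin n ↦ hinf.natEmbedding B i)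
    ((hinf.natEmbedding B).injective.comp Fin.val_injective)

/-- A nonzero compact symmetric operator has an eigenvalue of modulus `‖T‖`. -/
lemma exists_eigenvector_norm_eq {T : H →L[ℂ] H} (hT : IsCompactOperator T)
    (hsymm : T.IsSymmetric) (h0 : 0 < ‖T‖) :
    ∃ (κ : ℝ) (f : H), |κ| = ‖T‖ ∧ f ≠ 0 ∧ T f = (κ : ℂ) • f := by
  have : Nontrivial H := by
    by_contra hH
    rw [not_nontrivial_iff_subsingleton] at hH
    rw [Subsingleton.elim T 0, norm_zero] at h0
    exact lt_irrefl _ h0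
  have hsa : IsSelfAdjoint T := hsymm.isSelfAdjoint
  obtain ⟨μ, hμ, hμn⟩ := spectrum.exists_nnnorm_eq_spectralRadius T
  rw [T.spectralRadius_eq_nnnorm hsa] at hμn
  have hμn' : ‖μ‖ = ‖T‖ := by
    have : ‖μ‖₊ = ‖T‖₊ := by exact_mod_cast hμn
    exact congrArg NNReal.toReal this
  have hμ0 : μ ≠ 0 := by
    rintro rfl
    rw [← hμn', norm_zero] at h0
    exact lt_irrefl _ h0
  have hev := (hT.hasEigenvalue_iff_mem_spectrum hμ0).2 hμ
  obtain ⟨f, hf⟩ := hev.exists_hasEigenvector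
  have hreal : conj μ = μ := hsymm.conj_eigenvalue_eq_self hev
  have hμre : ((μ.re : ℝ) : ℂ) = μ := Complex.conj_eq_iff_re.1 hreal
  refine ⟨μ.re, f, ?_, hf.2, ?_⟩
  · rw [← hμn', ← hμre, Complex.norm_real, Complex.ofReal_re, Real.norm_eq_abs]
  · rw [hμre]; exact hf.apply_eq_smul

end Spectral

section IntegralOperator

open scoped BoundedContinuousFunction

variable {a b : ℝ}

instance : IsFiniteMeasure (intervalMeasure a b) := ⟨by simp⟩

/-- A continuous function on `[a, b]`, extended to the line by constants, as an element of
`L²(a, b)`. -/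
def iccToLp (hab : a ≤ b) : (Icc a b →ᵇ ℂ) →L[ℂ] Lp ℂ 2 (intervalMeasure a b) :=
  (BoundedContinuousFunction.toLp 2 (intervalMeasure a b) ℂ).comp
    (LinearMap.mkContinuous
      ({ toFun := fun g ↦ g.compContinuous ⟨projIcc a b hab, continuous_projIcc⟩
         map_add' := fun _ _ ↦ rfl
         map_smul' := fun _ _ ↦ rfl } : (Icc a b →ᵇ ℂ) →ₗ[ℂ] (ℝ →ᵇ ℂ)) 1 fun g ↦ by
      rw [one_mul]
      exact (BoundedContinuousFunction.norm_le (norm_nonneg g)).2 fun r ↦ g.norm_coe_le_norm _)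

lemma coeFn_iccToLp (hab : a ≤ b) (g : Icc a b →ᵇ ℂ) :
    iccToLp hab g =ᵐ[intervalMeasure a b] fun r ↦ g (projIcc a b hab r) :=
  BoundedContinuousFunction.coeFn_toLp 2 (intervalMeasure a b) ℂ
    (g.compContinuous ⟨projIcc a b hab, continuous_projIcc⟩)

/-- The section `s ↦ k(x, s)` of a continuous kernel, as a continuous map into `L²(a, b)`. -/
def kernelSection (hab : a ≤ b) (k : C(Icc a b × Icc a b, ℝ)) :
    C(Icc a b, Lp ℂ 2 (intervalMeasure a b)) where
  toFun x := iccToLp hab (BoundedContinuousFunction.mkOfCompact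
    ((ContinuousMap.comp ⟨_, Complex.continuous_ofReal⟩ k).curry x))
  continuous_toFun := by
    refine (iccToLp hab).continuous.comp ?_
    exact (ContinuousMap.linearIsometryBoundedOfCompact (Icc a b) ℂ ℂ).continuous.comp
      (ContinuousMap.curry _).continuous

lemma coeFn_kernelSection (hab : a ≤ b) (k : C(Icc a b × Icc a b, ℝ)) (x : Icc a b) :
    kernelSection hab k x =ᵐ[intervalMeasure a b] fun s ↦ (k (x, projIcc a b hab s) : ℂ) :=
  coeFn_iccToLp hab _

/-- The integral operator with a continuous real kernel, from `L²(a, b)` to the continuous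
functions on `[a, b]`. -/
def integralOpCont (hab : a ≤ b) (k : C(Icc a b × Icc a b, ℝ)) :
    Lp ℂ 2 (intervalMeasure a b) →L[ℂ] (Icc a b →ᵇ ℂ) :=
  LinearMap.mkContinuous
    { toFun := fun f ↦ BoundedContinuousFunction.mkOfCompact
        ⟨fun x ↦ ⟪kernelSection hab k x, f⟫_ℂ,
          (kernelSection hab k).continuous.inner continuous_const⟩
      map_add' := fun f g ↦ by ext x; simp [inner_add_right]
      map_smul' := fun c f ↦ by ext x; simp [inner_smul_right] } ‖kernelSection hab k‖ fun f ↦ by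
    refine (BoundedContinuousFunction.norm_le (by positivity)).2 fun x ↦ ?_
    exact (norm_inner_le_norm _ _).trans
      (mul_le_mul_of_nonneg_right ((kernelSection hab k).norm_coe_le_norm x) (norm_nonneg f))

lemma integralOpCont_apply (hab : a ≤ b) (k : C(Icc a b × Icc a b, ℝ))
    (f : Lp ℂ 2 (intervalMeasure a b)) (x : Icc a b) :
    integralOpCont hab k f x =
      ∫ s, (k (x, projIcc a b hab s) : ℂ) * f s ∂intervalMeasure a b := by
  change ⟪kernelSection hab k x, f⟫_ℂ = _
  rw [L2.inner_def]
  refine integral_congr_ae ?_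
  filter_upwards [coeFn_kernelSection hab k x] with s hs
  rw [hs]
  simp [mul_comm]

/-- The integral operator with a continuous real kernel on `L²(a, b)`. -/
def integralOp (hab : a ≤ b) (k : C(Icc a b × Icc a b, ℝ)) :
    Lp ℂ 2 (intervalMeasure a b) →L[ℂ] Lp ℂ 2 (intervalMeasure a b) :=
  (iccToLp hab).comp (integralOpCont hab k)

/-- Compactness follows from the theorem of Arzelà and Ascoli. -/
lemma isCompactOperator_integralOp (hab : a ≤ b) (k : C(Icc a b × Icc a b, ℝ)) :
    IsCompactOperator (integralOp hab k) := by
  have h1 : IsCompactOperator (integralOpCont hab k).toLinearMap := by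
    rw [isCompactOperator_iff_isCompact_closure_image_ball (integralOpCont hab k).toLinearMap
      zero_lt_one]
    refine BoundedContinuousFunction.arzela_ascoli
      (Metric.closedBall (0 : ℂ) ‖integralOpCont hab k‖) (isCompact_closedBall _ _) _ ?_ ?_
    · rintro _ x ⟨f, hf, rfl⟩
      rw [mem_closedBall_zero_iff]
      rw [mem_ball_zero_iff] at hf
      refine (BoundedContinuousFunction.norm_coe_le_norm _ x).trans ?_
      refine ((integralOpCont hab k).le_opNorm f).trans ?_
      exact mul_le_of_le_one_right (norm_nonneg _) hf.le
    · intro x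
      rw [Metric.equicontinuousAt_iff]
      intro ε hε
      obtain ⟨δ, hδ, hδ2⟩ := Metric.continuous_iff.1 (kernelSection hab k).continuous x ε hε
      refine ⟨δ, hδ, ?_⟩
      rintro y hy ⟨_, f, hf, rfl⟩
      have h2 := hδ2 y hy
      rw [mem_ball_zero_iff] at hf
      rw [dist_eq_norm] at h2
      rw [dist_comm, dist_eq_norm]
      change ‖⟪kernelSection hab k y, f⟫_ℂ - ⟪kernelSection hab k x, f⟫_ℂ‖ < ε
      rw [← inner_sub_left]
      refine (norm_inner_le_norm _ _).trans_lt ?_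
      refine lt_of_le_of_lt (mul_le_of_le_one_right (norm_nonneg _) hf.le) h2
  exact h1.clm_comp (iccToLp hab)

lemma coeFn_integralOp (hab : a ≤ b) (k : C(Icc a b × Icc a b, ℝ))
    (f : Lp ℂ 2 (intervalMeasure a b)) :
    integralOp hab k f =ᵐ[intervalMeasure a b] fun r ↦
      ∫ s, (k (projIcc a b hab r, projIcc a b hab s) : ℂ) * f s ∂intervalMeasure a b := by
  filter_upwards [coeFn_iccToLp hab (integralOpCont hab k f)] with r hr
  rw [← integralOpCont_apply]
  exact hr

lemma isSymmetric_integralOp (hab : a ≤ b) (k : C(Icc a b × Icc a b, ℝ))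
    (hk : ∀ x y, k (x, y) = k (y, x)) : (integralOp hab k).IsSymmetric := by
  intro f g
  change ⟪integralOp hab k f, g⟫_ℂ = ⟪f, integralOp hab k g⟫_ℂ
  let μ := intervalMeasure a b
  have hf : Integrable f μ := (Lp.memLp f).integrable one_le_two
  have hg : Integrable g μ := (Lp.memLp g).integrable one_le_two
  let κ : ℝ → ℝ → ℂ := fun r s ↦ (k (projIcc a b hab r, projIcc a b hab s) : ℂ)
  have hκ : Continuous (Function.uncurry κ) := by
    refine Complex.continuous_ofReal.comp (k.continuous.comp ?_)
    exact (continuous_projIcc.comp continuous_fst).prodMk (continuous_projIcc.comp continuous_snd)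
  have hint : Integrable (Function.uncurry fun r s ↦ κ r s * (conj (f s) * g r)) (μ.prod μ) := by
    have h1 : Integrable (fun p : ℝ × ℝ ↦ g p.1 * conj (f p.2)) (μ.prod μ) :=
      hg.mul_prod (Complex.conjCLE.toContinuousLinearMap.integrable_comp hf)
    have h2 := h1.bdd_mul (c := ‖k‖) hκ.aestronglyMeasurable (Eventually.of_forall fun p ↦ by
      simp only [Function.uncurry, κ, Complex.norm_real]
      exact k.norm_coe_le_norm _)
    refine h2.congr (Eventually.of_forall fun p ↦ ?_)
    simp only [Function.uncurry]
    ring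
  rw [L2.inner_def, L2.inner_def]
  calc ∫ r, ⟪(integralOp hab k f) r, g r⟫_ℂ ∂μ
      = ∫ r, ∫ s, κ r s * (conj (f s) * g r) ∂μ ∂μ := by
        refine integral_congr_ae ?_
        filter_upwards [coeFn_integralOp hab k f] with r hr
        rw [hr, RCLike.inner_apply, ← integral_conj, ← integral_const_mul]
        refine integral_congr_ae (Eventually.of_forall fun s ↦ ?_)
        simp only [map_mul, Complex.conj_ofReal, κ]
        ring
    _ = ∫ s, ∫ r, κ r s * (conj (f s) * g r) ∂μ ∂μ := integral_integral_swap hint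
    _ = ∫ s, ⟪f s, (integralOp hab k g) s⟫_ℂ ∂μ := by
        refine integral_congr_ae ?_
        filter_upwards [coeFn_integralOp hab k g] with s hs
        rw [hs, RCLike.inner_apply, ← integral_mul_const]
        refine integral_congr_ae (Eventually.of_forall fun r ↦ ?_)
        simp only [κ]
        rw [hk]
        ring

end IntegralOperator

end RadialPauli

/-! ### The Green operator -/

namespace RadialPauli
open scoped ComplexConjugate InnerProductSpace

/-- `∫ E⁻²` from `r` to `s`, where `E` is the weight. -/
def invWeightIntegral (ψ : ℝ → ℝ) (h m r s : ℝ) : ℝ := ∫ t in r..s, (weight ψ h m t)⁻¹ ^ 2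

/-- The Green kernel `E(r) E(s) α(min r s) β(max r s) / (α + β)` of `-(∂ + a)(∂ - a)` with Dirichlet
conditions, where `α` and `β` are the integrals of `E⁻²` from the left and from the right end point.
-/
def greenFun (ρ₁ ρ₂ : ℝ) (ψ : ℝ → ℝ) (h m r s : ℝ) : ℝ :=
  weight ψ h m r * weight ψ h m s * invWeightIntegral ψ h m ρ₁ (min r s) *
    invWeightIntegral ψ h m (max r s) ρ₂ / invWeightIntegral ψ h m ρ₁ ρ₂

namespace IsRadialPotential

variable {ρ₁ ρ₂ : ℝ} {b ψ q : ℝ → ℝ}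

lemma left_mem (P : IsRadialPotential ρ₁ ρ₂ b ψ q) : ρ₁ ∈ Icc ρ₁ ρ₂ := ⟨le_rfl, P.lt.le⟩

lemma right_mem (P : IsRadialPotential ρ₁ ρ₂ b ψ q) : ρ₂ ∈ Icc ρ₁ ρ₂ := ⟨P.lt.le, le_rfl⟩

lemma hasDerivWithinAt_invWeight_left (P : IsRadialPotential ρ₁ ρ₂ b ψ q) (h m : ℝ) {r : ℝ}
    (hr : r ∈ Icc ρ₁ ρ₂) : HasDerivWithinAt (invWeightIntegral ψ h m ρ₁)
      ((weight ψ h m r)⁻¹ ^ 2) (Icc ρ₁ ρ₂) r :=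
  hasDerivWithinAt_integral P.lt.le ((P.continuousOn_weight_inv h m).pow 2) hr

lemma invWeightIntegral_add (P : IsRadialPotential ρ₁ ρ₂ b ψ q) (h m : ℝ) {r s t : ℝ}
    (hr : r ∈ Icc ρ₁ ρ₂) (hs : s ∈ Icc ρ₁ ρ₂) (ht : t ∈ Icc ρ₁ ρ₂) :
    invWeightIntegral ψ h m r s + invWeightIntegral ψ h m s t = invWeightIntegral ψ h m r t :=
  intervalIntegral.integral_add_adjacent_intervals
    (intervalIntegrable_of_continuousOn_Icc ((P.continuousOn_weight_inv h m).pow 2) hr hs)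
    (intervalIntegrable_of_continuousOn_Icc ((P.continuousOn_weight_inv h m).pow 2) hs ht)

lemma invWeightIntegral_nonneg {ψ : ℝ → ℝ} {h m r s : ℝ} (hrs : r ≤ s) :
    0 ≤ invWeightIntegral ψ h m r s :=
  intervalIntegral.integral_nonneg hrs fun _ _ ↦ sq_nonneg _

lemma hasDerivWithinAt_invWeight_right (P : IsRadialPotential ρ₁ ρ₂ b ψ q) (h m : ℝ) {r : ℝ}
    (hr : r ∈ Icc ρ₁ ρ₂) : HasDerivWithinAt (fun r ↦ invWeightIntegral ψ h m r ρ₂)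
      (-(weight ψ h m r)⁻¹ ^ 2) (Icc ρ₁ ρ₂) r := by
  have h1 := (P.hasDerivWithinAt_invWeight_left h m hr).const_sub (invWeightIntegral ψ h m ρ₁ ρ₂)
  refine h1.congr (fun s hs ↦ ?_) ?_
  · rw [← P.invWeightIntegral_add h m P.left_mem hs P.right_mem]; ring
  · rw [← P.invWeightIntegral_add h m P.left_mem hr P.right_mem]; ring

lemma continuousOn_greenFun (P : IsRadialPotential ρ₁ ρ₂ b ψ q) (h m : ℝ) {r : ℝ}
    (hr : r ∈ Icc ρ₁ ρ₂) : ContinuousOn (greenFun ρ₁ ρ₂ ψ h m r) (Icc ρ₁ ρ₂) := by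
  have hα : ContinuousOn (invWeightIntegral ψ h m ρ₁) (Icc ρ₁ ρ₂) := fun s hs ↦
    (P.hasDerivWithinAt_invWeight_left h m hs).continuousWithinAt
  have hβ : ContinuousOn (fun s ↦ invWeightIntegral ψ h m s ρ₂) (Icc ρ₁ ρ₂) := fun s hs ↦
    (P.hasDerivWithinAt_invWeight_right h m hs).continuousWithinAt
  have hmin : ContinuousOn (fun s ↦ invWeightIntegral ψ h m ρ₁ (min r s)) (Icc ρ₁ ρ₂) :=
    hα.comp (continuous_const.min continuous_id).continuousOn fun s hs ↦
      ⟨le_min hr.1 hs.1, (min_le_left _ _).trans hr.2⟩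
  have hmax : ContinuousOn (fun s ↦ invWeightIntegral ψ h m (max r s) ρ₂) (Icc ρ₁ ρ₂) :=
    hβ.comp (continuous_const.max continuous_id).continuousOn fun s hs ↦
      ⟨hr.1.trans (le_max_left _ _), max_le hr.2 hs.2⟩
  exact (((continuousOn_const.mul (P.continuousOn_weight h m)).mul hmin).mul hmax).div_const _

/-- The Green kernel solves the Dirichlet problem `-(∂ + a)(∂ - a) u = f`. -/
lemma exists_greenFun_solution (P : IsRadialPotential ρ₁ ρ₂ b ψ q) (h m : ℝ) {f : ℝ → ℂ}
    (hf : ContinuousOn f (Icc ρ₁ ρ₂)) :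
    ∃ u v : ℝ → ℂ, IsDirichletSystem ρ₁ ρ₂ (drift q h m) f u v ∧
      ∀ r ∈ Icc ρ₁ ρ₂, u r = ∫ s in ρ₁..ρ₂, (greenFun ρ₁ ρ₂ ψ h m r s : ℂ) * f s := by
  set E := weight ψ h m with hEdef
  set α := invWeightIntegral ψ h m ρ₁ with hα
  set β := fun r ↦ invWeightIntegral ψ h m r ρ₂ with hβ
  set T := invWeightIntegral ψ h m ρ₁ ρ₂ with hT
  have hTpos : 0 < T := P.integral_weight_inv_pos h m P.left_mem P.right_mem P.lt
  have hTC : (T : ℂ) ≠ 0 := by exact_mod_cast hTpos.ne'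
  have hE0 : ∀ r ∈ Icc ρ₁ ρ₂, (E r : ℂ) ≠ 0 := fun r hr ↦ by
    exact_mod_cast (weight_pos ψ h m (P.pos_of_mem hr)).ne'
  have hαd : ∀ r ∈ Icc ρ₁ ρ₂, HasDerivWithinAt (fun r ↦ (α r : ℂ)) (((E r)⁻¹ ^ 2 : ℝ) : ℂ)
      (Icc ρ₁ ρ₂) r := fun r hr ↦ (P.hasDerivWithinAt_invWeight_left h m hr).ofReal_comp
  have hβd : ∀ r ∈ Icc ρ₁ ρ₂, HasDerivWithinAt (fun r ↦ (β r : ℂ)) ((-(E r)⁻¹ ^ 2 : ℝ) : ℂ)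
      (Icc ρ₁ ρ₂) r := fun r hr ↦ (P.hasDerivWithinAt_invWeight_right h m hr).ofReal_comp
  have hEd : ∀ r ∈ Icc ρ₁ ρ₂, HasDerivWithinAt (fun r ↦ (E r : ℂ))
      ((drift q h m r * E r : ℝ) : ℂ) (Icc ρ₁ ρ₂) r := fun r hr ↦
    (P.hasDerivWithinAt_weight h m r hr).ofReal_comp
  have hαc : ContinuousOn (fun r ↦ (α r : ℂ)) (Icc ρ₁ ρ₂) :=
    fun r hr ↦ (hαd r hr).continuousWithinAt
  have hβc : ContinuousOn (fun r ↦ (β r : ℂ)) (Icc ρ₁ ρ₂) :=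
    fun r hr ↦ (hβd r hr).continuousWithinAt
  have hEc : ContinuousOn (fun r ↦ (E r : ℂ)) (Icc ρ₁ ρ₂) :=
    fun r hr ↦ (hEd r hr).continuousWithinAt
  have hsum : ∀ r ∈ Icc ρ₁ ρ₂, (α r : ℂ) + β r = T := fun r hr ↦ by
    exact_mod_cast P.invWeightIntegral_add h m P.left_mem hr P.right_mem
  have hgα : ContinuousOn (fun s ↦ (E s : ℂ) * α s * f s) (Icc ρ₁ ρ₂) := by fun_prop
  have hgβ : ContinuousOn (fun s ↦ (E s : ℂ) * β s * f s) (Icc ρ₁ ρ₂) := by fun_prop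
  let A : ℝ → ℂ := fun r ↦ ∫ s in ρ₁..r, (E s : ℂ) * α s * f s
  let C : ℝ → ℂ := fun r ↦ (∫ s in ρ₁..ρ₂, (E s : ℂ) * β s * f s) -
    ∫ s in ρ₁..r, (E s : ℂ) * β s * f s
  have hA : ∀ r ∈ Icc ρ₁ ρ₂, HasDerivWithinAt A ((E r : ℂ) * α r * f r) (Icc ρ₁ ρ₂) r :=
    fun r hr ↦ hasDerivWithinAt_integral P.lt.le hgα hr
  have hC : ∀ r ∈ Icc ρ₁ ρ₂, HasDerivWithinAt C (-((E r : ℂ) * β r * f r)) (Icc ρ₁ ρ₂) r :=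
    fun r hr ↦ (hasDerivWithinAt_integral P.lt.le hgβ hr).const_sub _
  have hC' : ∀ r ∈ Icc ρ₁ ρ₂, C r = ∫ s in r..ρ₂, (E s : ℂ) * β s * f s := fun r hr ↦ by
    simp only [C]
    rw [← intervalIntegral.integral_add_adjacent_intervals
      (intervalIntegrable_of_continuousOn_Icc hgβ P.left_mem hr)
      (intervalIntegrable_of_continuousOn_Icc hgβ hr P.right_mem)]
    ring
  refine ⟨fun r ↦ E r / T * (β r * A r + α r * C r),
    fun r ↦ (E r : ℂ)⁻¹ / T * (C r - A r), ⟨fun r hr ↦ ?_, fun r hr ↦ ?_, ?_, ?_⟩, fun r hr ↦ ?_⟩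
  · have h1 := ((hEd r hr).div_const (T : ℂ)).mul
      (((hβd r hr).mul (hA r hr)).add ((hαd r hr).mul (hC r hr)))
    refine h1.congr_deriv ?_
    have := hE0 r hr
    simp only [Pi.add_apply, Pi.mul_apply]
    push_cast
    field_simp
    ring
  · have h1 := (((hEd r hr).inv (hE0 r hr)).div_const (T : ℂ)).mul ((hC r hr).sub (hA r hr))
    refine h1.congr_deriv ?_
    have := hE0 r hr
    have h2 := hsum r hr
    simp only [Pi.sub_apply, Pi.inv_apply]
    push_cast
    field_simp
    rw [← h2]
    ring
  · have h1 : α ρ₁ = 0 := intervalIntegral.integral_same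
    simp [A, h1]
  · have h1 : β ρ₂ = 0 := intervalIntegral.integral_same
    simp [C, h1]
  · have hgc : ContinuousOn (fun s ↦ (greenFun ρ₁ ρ₂ ψ h m r s : ℂ) * f s) (Icc ρ₁ ρ₂) :=
      (Complex.continuous_ofReal.comp_continuousOn' (P.continuousOn_greenFun h m hr)).fun_mul hf
    simp only
    rw [← intervalIntegral.integral_add_adjacent_intervals
      (intervalIntegrable_of_continuousOn_Icc hgc P.left_mem hr)
      (intervalIntegrable_of_continuousOn_Icc hgc hr P.right_mem), hC' r hr, mul_add,
      ← mul_assoc, ← mul_assoc, ← intervalIntegral.integral_const_mul,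
      ← intervalIntegral.integral_const_mul]
    congr 1
    · refine intervalIntegral.integral_congr fun s hs ↦ ?_
      rw [uIcc_of_le hr.1] at hs
      simp only [greenFun, min_eq_right hs.2, max_eq_left hs.2]
      push_cast
      simp only [← hEdef, ← hα, ← hT, hβ]
      field_simp
    · refine intervalIntegral.integral_congr fun s hs ↦ ?_
      rw [uIcc_of_le hr.2] at hs
      simp only [greenFun, min_eq_left hs.1, max_eq_right hs.1]
      push_cast
      simp only [← hEdef, ← hα, ← hT, hβ]
      field_simp

/-- The Green kernel as a continuous function on the square. -/
def greenKernel (P : IsRadialPotential ρ₁ ρ₂ b ψ q) (h m : ℝ) :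
    C(Icc ρ₁ ρ₂ × Icc ρ₁ ρ₂, ℝ) where
  toFun p := greenFun ρ₁ ρ₂ ψ h m p.1 p.2
  continuous_toFun := by
    have hE : Continuous fun x : Icc ρ₁ ρ₂ ↦ weight ψ h m x :=
      continuousOn_iff_continuous_domRestrict.1 (P.continuousOn_weight h m)
    have hα : Continuous fun x : Icc ρ₁ ρ₂ ↦ invWeightIntegral ψ h m ρ₁ x :=
      continuousOn_iff_continuous_domRestrict.1 fun r hr ↦
        (P.hasDerivWithinAt_invWeight_left h m hr).continuousWithinAt
    have hβ : Continuous fun x : Icc ρ₁ ρ₂ ↦ invWeightIntegral ψ h m x ρ₂ :=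
      continuousOn_iff_continuous_domRestrict.1 fun r hr ↦
        (P.hasDerivWithinAt_invWeight_right h m hr).continuousWithinAt
    have h1 := (hE.comp continuous_fst).mul (hE.comp continuous_snd) |>.mul
      (hα.comp (continuous_fst.min continuous_snd)) |>.mul
      (hβ.comp (continuous_fst.max continuous_snd)) |>.div_const (invWeightIntegral ψ h m ρ₁ ρ₂)
    refine h1.congr fun p ↦ ?_
    simp only [Function.comp, Pi.mul_apply, greenFun]
    rcases le_total p.1 p.2 with hp | hp
    · rw [min_eq_left hp, max_eq_right hp, min_eq_left (Subtype.coe_le_coe.2 hp),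
        max_eq_right (Subtype.coe_le_coe.2 hp)]
    · rw [min_eq_right hp, max_eq_left hp, min_eq_right (Subtype.coe_le_coe.2 hp),
        max_eq_left (Subtype.coe_le_coe.2 hp)]

/-- The Green operator on `L²(ρ₁, ρ₂)`. -/
def greenOp (P : IsRadialPotential ρ₁ ρ₂ b ψ q) (h m : ℝ) :
    Lp ℂ 2 (intervalMeasure ρ₁ ρ₂) →L[ℂ] Lp ℂ 2 (intervalMeasure ρ₁ ρ₂) :=
  integralOp P.lt.le (P.greenKernel h m)

lemma isCompactOperator_greenOp (P : IsRadialPotential ρ₁ ρ₂ b ψ q) (h m : ℝ) :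
    IsCompactOperator (P.greenOp h m) :=
  isCompactOperator_integralOp _ _

lemma isSymmetric_greenOp (P : IsRadialPotential ρ₁ ρ₂ b ψ q) (h m : ℝ) :
    (P.greenOp h m).IsSymmetric := by
  refine isSymmetric_integralOp _ _ fun x y ↦ ?_
  change greenFun ρ₁ ρ₂ ψ h m x y = greenFun ρ₁ ρ₂ ψ h m y x
  rw [greenFun, greenFun, min_comm, max_comm]
  ring

lemma integralOpCont_greenKernel (P : IsRadialPotential ρ₁ ρ₂ b ψ q) (h m : ℝ)
    (f : Lp ℂ 2 (intervalMeasure ρ₁ ρ₂)) (x : Icc ρ₁ ρ₂) :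
    integralOpCont P.lt.le (P.greenKernel h m) f x =
      ∫ s, (greenFun ρ₁ ρ₂ ψ h m x s : ℂ) * f s ∂intervalMeasure ρ₁ ρ₂ := by
  rw [integralOpCont_apply]
  refine integral_congr_ae ?_
  filter_upwards [ae_restrict_mem measurableSet_Ioo] with s hs
  change (greenFun ρ₁ ρ₂ ψ h m x (projIcc ρ₁ ρ₂ P.lt.le s) : ℂ) * f s = _
  rw [projIcc_of_mem P.lt.le (Ioo_subset_Icc_self hs)]

/-- The image of a continuous function under the Green operator solves the Dirichlet problem. -/
lemma exists_greenOp_solution (P : IsRadialPotential ρ₁ ρ₂ b ψ q) (h m : ℝ) {g : ℝ → ℂ}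
    (hg : ContinuousOn g (Icc ρ₁ ρ₂)) {f : Lp ℂ 2 (intervalMeasure ρ₁ ρ₂)}
    (hf : f =ᵐ[intervalMeasure ρ₁ ρ₂] g) :
    ∃ u v : ℝ → ℂ, IsDirichletSystem ρ₁ ρ₂ (drift q h m) g u v ∧
      (∀ x : Icc ρ₁ ρ₂, integralOpCont P.lt.le (P.greenKernel h m) f x = u x) ∧
      P.greenOp h m f =ᵐ[intervalMeasure ρ₁ ρ₂] u := by
  obtain ⟨u, v, S, hu⟩ := P.exists_greenFun_solution h m hg
  have h1 : ∀ x : Icc ρ₁ ρ₂, integralOpCont P.lt.le (P.greenKernel h m) f x = u x := by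
    intro x
    rw [P.integralOpCont_greenKernel, hu x x.2, intervalIntegral.integral_of_le P.lt.le,
      integral_Ioc_eq_integral_Ioo]
    refine integral_congr_ae ?_
    filter_upwards [hf] with s hs
    rw [hs]
  refine ⟨u, v, S, h1, ?_⟩
  filter_upwards [coeFn_iccToLp P.lt.le (integralOpCont P.lt.le (P.greenKernel h m) f),
    ae_restrict_mem measurableSet_Ioo] with r hr hrI
  rw [show P.greenOp h m f = iccToLp P.lt.le (integralOpCont P.lt.le (P.greenKernel h m) f) from rfl,
    hr, h1, projIcc_of_mem P.lt.le (Ioo_subset_Icc_self hrI)]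

/-- Eigenvectors of the Green operator are eigenvectors of `d d^×`. -/
lemma isPauliEigenvector_of_greenOp (P : IsRadialPotential ρ₁ ρ₂ b ψ q) {φ : Plane → ℝ}
    (hφ : EqOn (radialProfile φ) ψ (Icc ρ₁ ρ₂)) {h m κ : ℝ} (hh : 0 < h) (hκ : κ ≠ 0)
    {f : Lp ℂ 2 (intervalMeasure ρ₁ ρ₂)} (hf : f ≠ 0) (hfκ : P.greenOp h m f = (κ : ℂ) • f) :
    IsPauliEigenvector ρ₁ ρ₂ φ h m (h ^ 2 / κ) f := by
  have hκC : (κ : ℂ) ≠ 0 := by exact_mod_cast hκ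
  let F := integralOpCont P.lt.le (P.greenKernel h m) f
  let g : ℝ → ℂ := fun r ↦ (κ : ℂ)⁻¹ * F (projIcc ρ₁ ρ₂ P.lt.le r)
  have hgc : Continuous g := continuous_const.mul (F.continuous.comp continuous_projIcc)
  have hfg : f =ᵐ[intervalMeasure ρ₁ ρ₂] g := by
    filter_upwards [coeFn_iccToLp P.lt.le F, Lp.coeFn_smul (κ : ℂ) f] with r h1 h2
    have h3 : (P.greenOp h m f) r = F (projIcc ρ₁ ρ₂ P.lt.le r) := h1
    rw [hfκ, h2, Pi.smul_apply, smul_eq_mul] at h3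
    simp only [g]
    rw [← h3]
    field_simp
  obtain ⟨u, v, S, hu, -⟩ := P.exists_greenOp_solution h m hgc.continuousOn hfg
  have hgu : ∀ r ∈ Icc ρ₁ ρ₂, u r = κ * g r := by
    intro r hr
    have h1 := hu ⟨r, hr⟩
    simp only [g, projIcc_of_mem P.lt.le hr]
    rw [← h1]
    field_simp
    rfl
  have S' : IsDirichletSystem ρ₁ ρ₂ (drift q h m) (fun r ↦ (h ^ 2 / κ / h ^ 2 : ℝ) * g r) g
      (fun r ↦ (κ : ℂ)⁻¹ * v r) := by
    have hgu' : ∀ r ∈ Icc ρ₁ ρ₂, g r = (κ : ℂ)⁻¹ * u r := fun r hr ↦ by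
      rw [hgu r hr]; field_simp
    refine ⟨fun r hr ↦ ?_, fun r hr ↦ ?_, ?_, ?_⟩
    · refine (((S.deriv_left r hr).const_mul (κ : ℂ)⁻¹).congr hgu' (hgu' r hr)).congr_deriv ?_
      rw [hgu' r hr]; ring
    · refine ((S.deriv_right r hr).const_mul (κ : ℂ)⁻¹).congr_deriv ?_
      have hhC : (h : ℂ) ≠ 0 := by exact_mod_cast hh.ne'
      push_cast
      field_simp
    · rw [hgu' _ P.left_mem, S.left, mul_zero]
    · rw [hgu' _ P.right_mem, S.right, mul_zero]
  exact P.isPauliEigenvector hφ hh hf hfg S'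

/-- The Green operator is injective on polynomials, hence of infinite rank. -/
lemma not_finiteDimensional_range_greenOp (P : IsRadialPotential ρ₁ ρ₂ b ψ q) (h m : ℝ) :
    ¬ FiniteDimensional ℂ (LinearMap.range (P.greenOp h m).toLinearMap) := by
  intro hfin
  let J : Polynomial ℂ →ₗ[ℂ] Lp ℂ 2 (intervalMeasure ρ₁ ρ₂) :=
    { toFun := fun p ↦ iccToLp P.lt.le (BoundedContinuousFunction.mkOfCompact
        ⟨fun x : Icc ρ₁ ρ₂ ↦ p.eval ((x : ℝ) : ℂ), by fun_prop⟩)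
      map_add' := fun p p' ↦ by
        rw [← map_add]
        congr 1
        ext x
        simp
      map_smul' := fun c p ↦ by
        rw [RingHom.id_apply, ← map_smul]
        congr 1
        ext x
        simp }
  have hinj : Function.Injective ((P.greenOp h m).toLinearMap.rangeRestrict ∘ₗ J) := by
    rw [← LinearMap.ker_eq_bot, LinearMap.ker_eq_bot']
    intro p hp
    have hp0 : P.greenOp h m (J p) = 0 := congrArg Subtype.val hp
    let g : ℝ → ℂ := fun r ↦ p.eval (r : ℂ)
    have hgc : Continuous g := by fun_prop
    have hJ : J p =ᵐ[intervalMeasure ρ₁ ρ₂] g := by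
      filter_upwards [coeFn_iccToLp P.lt.le (BoundedContinuousFunction.mkOfCompact
        ⟨fun x : Icc ρ₁ ρ₂ ↦ p.eval ((x : ℝ) : ℂ), by fun_prop⟩),
        ae_restrict_mem measurableSet_Ioo] with r hr hrI
      refine hr.trans ?_
      simp [projIcc_of_mem P.lt.le (Ioo_subset_Icc_self hrI), g]
    obtain ⟨u, v, S, -, hu⟩ := P.exists_greenOp_solution h m hgc.continuousOn hJ
    rw [hp0] at hu
    have hu0 : ∀ r ∈ Ioo ρ₁ ρ₂, u r = 0 := by
      have h1 : u =ᵐ[volume.restrict (Ioo ρ₁ ρ₂)] fun _ ↦ (0 : ℂ) :=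
        hu.symm.trans (Lp.coeFn_zero ℂ 2 _)
      exact Measure.eqOn_Ioo_of_ae_eq _ h1 (S.continuousOn_fst.mono Ioo_subset_Icc_self)
        continuousOn_const
    have hv0 : ∀ r ∈ Ioo ρ₁ ρ₂, v r = 0 := by
      intro r hr
      have h1 := (S.deriv_left r (Ioo_subset_Icc_self hr)).hasDerivAt (Icc_mem_nhds hr.1 hr.2)
      have h2 : HasDerivAt u 0 r := (hasDerivAt_const r (0 : ℂ)).congr_of_eventuallyEq (by
        filter_upwards [Ioo_mem_nhds hr.1 hr.2] with s hs using hu0 s hs)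
      have h3 := h1.unique h2
      rwa [hu0 r hr, mul_zero, zero_add] at h3
    have hg0 : ∀ r ∈ Ioo ρ₁ ρ₂, p.eval (r : ℂ) = 0 := by
      intro r hr
      have h1 := (S.deriv_right r (Ioo_subset_Icc_self hr)).hasDerivAt (Icc_mem_nhds hr.1 hr.2)
      have h2 : HasDerivAt v 0 r := (hasDerivAt_const r (0 : ℂ)).congr_of_eventuallyEq (by
        filter_upwards [Ioo_mem_nhds hr.1 hr.2] with s hs using hv0 s hs)
      have h3 := h1.unique h2
      rw [hv0 r hr, mul_zero, neg_zero, zero_sub, neg_eq_zero] at h3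
      exact h3
    refine Polynomial.eq_zero_of_infinite_isRoot p ?_
    refine ((Ioo_infinite P.lt).image (f := fun r : ℝ ↦ (r : ℂ))
      Complex.ofReal_injective.injOn).mono ?_
    rintro _ ⟨r, hr, rfl⟩
    exact hg0 r hr
  have := Module.Finite.of_injective _ hinj
  exact Polynomial.not_finite this

/-- For every `n` there are `n` linearly independent eigenvectors of `d d^×`. -/
lemma exists_linearIndependent_pauliEigenvectors (P : IsRadialPotential ρ₁ ρ₂ b ψ q)
    {φ : Plane → ℝ} (hφ : EqOn (radialProfile φ) ψ (Icc ρ₁ ρ₂)) {h : ℝ} (m : ℝ) (hh : 0 < h)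
    (n : ℕ) : ∃ v : Fin n → Lp ℂ 2 (intervalMeasure ρ₁ ρ₂), LinearIndependent ℂ v ∧
      ∀ i, ∃ ν, IsPauliEigenvector ρ₁ ρ₂ φ h m ν (v i) := by
  obtain ⟨v, hv, hev⟩ := exists_linearIndependent_eigenvectors (P.isCompactOperator_greenOp h m)
    (P.isSymmetric_greenOp h m) (P.not_finiteDimensional_range_greenOp h m) n
  refine ⟨v, hv, fun i ↦ ?_⟩
  obtain ⟨μ, hμ, hμv⟩ := hev i
  have hreal : conj μ = μ := (P.isSymmetric_greenOp h m).conj_eigenvalue_eq_self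
    (Module.End.hasEigenvalue_of_hasEigenvector hμv)
  have hμre : ((μ.re : ℝ) : ℂ) = μ := Complex.conj_eq_iff_re.1 hreal
  refine ⟨h ^ 2 / μ.re, P.isPauliEigenvector_of_greenOp hφ hh ?_ hμv.2 ?_⟩
  · intro h0
    rw [h0, Complex.ofReal_zero] at hμre
    exact hμ hμre.symm
  · rw [hμre]
    exact hμv.apply_eq_smul

/-- Lower bound for the norm of the Green operator, from the test function `E` cut off to an interval
`[r, s]`. -/
lemma le_norm_greenOp (P : IsRadialPotential ρ₁ ρ₂ b ψ q) (h m : ℝ) {r s : ℝ}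
    (hr : r ∈ Icc ρ₁ ρ₂) (hs : s ∈ Icc ρ₁ ρ₂) (hrs : r < s) :
    (∫ t in r..s, weight ψ h m t ^ 2) * invWeightIntegral ψ h m ρ₁ r *
      invWeightIntegral ψ h m s ρ₂ / invWeightIntegral ψ h m ρ₁ ρ₂ ≤ ‖P.greenOp h m‖ := by
  set E := weight ψ h m with hE
  set c := (∫ t in r..s, E t ^ 2) * invWeightIntegral ψ h m ρ₁ r *
      invWeightIntegral ψ h m s ρ₂ / invWeightIntegral ψ h m ρ₁ ρ₂ with hc
  have hT : 0 < invWeightIntegral ψ h m ρ₁ ρ₂ :=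
    P.integral_weight_inv_pos h m P.left_mem P.right_mem P.lt
  have hsub : Icc r s ⊆ Icc ρ₁ ρ₂ := Icc_subset_Icc hr.1 hs.2
  have hsubo : Ioo r s ⊆ Ioo ρ₁ ρ₂ := Ioo_subset_Ioo hr.1 hs.2
  have hEc : ContinuousOn E (Icc ρ₁ ρ₂) := P.continuousOn_weight h m
  have hEpos : ∀ t ∈ Icc ρ₁ ρ₂, 0 < E t := fun t ht ↦ weight_pos ψ h m (P.pos_of_mem ht)
  have hc0 : 0 ≤ c := by
    refine div_nonneg (mul_nonneg (mul_nonneg ?_ (invWeightIntegral_nonneg hr.1))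
      (invWeightIntegral_nonneg hs.2)) hT.le
    exact intervalIntegral.integral_nonneg hrs.le fun _ _ ↦ sq_nonneg _
  let F : ℝ → ℂ := (Ioo r s).indicator fun t ↦ (E t : ℂ)
  have hF : MemLp F 2 (intervalMeasure ρ₁ ρ₂) := by
    obtain ⟨C, hC⟩ := isCompact_Icc.exists_bound_of_continuousOn hEc
    have h1 : MemLp (fun t ↦ (E t : ℂ)) 2 (intervalMeasure ρ₁ ρ₂) := by
      refine MemLp.of_bound ((Complex.continuous_ofReal.comp_continuousOn'
        (hEc.mono Ioo_subset_Icc_self)).aestronglyMeasurable measurableSet_Ioo) C ?_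
      filter_upwards [ae_restrict_mem measurableSet_Ioo] with t ht
      simpa using hC t (Ioo_subset_Icc_self ht)
    exact h1.indicator measurableSet_Ioo
  set f := hF.toLp F with hf
  have hfF : f =ᵐ[intervalMeasure ρ₁ ρ₂] F := hF.coeFn_toLp
  have hf0 : 0 < ‖f‖ := by
    rw [norm_pos_iff]
    intro h0
    have h1 : F =ᵐ[volume.restrict (Ioo r s)] fun _ ↦ (0 : ℂ) := by
      have h2 : F =ᵐ[intervalMeasure ρ₁ ρ₂] fun _ ↦ (0 : ℂ) :=
        hfF.symm.trans (by rw [h0]; exact Lp.coeFn_zero ℂ 2 _)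
      exact ae_restrict_of_ae_restrict_of_subset hsubo h2
    have h2 : ∀ᵐ t ∂volume.restrict (Ioo r s), False := by
      filter_upwards [h1, ae_restrict_mem measurableSet_Ioo] with t ht htI
      simp only [F, indicator_of_mem htI] at ht
      have := hEpos t (hsub (Ioo_subset_Icc_self htI))
      exact this.ne' (by exact_mod_cast ht)
    rw [ae_iff] at h2
    simp only [not_false_eq_true, Set.ofPred_true, Measure.restrict_apply_univ, Real.volume_Ioo] at h2
    rw [ENNReal.ofReal_eq_zero] at h2
    linarith
  have key : ∀ t ∈ Icc r s, c * E t ≤ ∫ x in r..s, greenFun ρ₁ ρ₂ ψ h m t x * E x := by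
    intro t ht
    have h1 : c * E t = ∫ x in r..s, (invWeightIntegral ψ h m ρ₁ r *
        invWeightIntegral ψ h m s ρ₂ / invWeightIntegral ψ h m ρ₁ ρ₂ * E t) * E x ^ 2 := by
      rw [intervalIntegral.integral_const_mul, hc]
      ring
    rw [h1]
    refine intervalIntegral.integral_mono_on hrs.le
      (intervalIntegrable_of_continuousOn_Icc (continuousOn_const.mul (hEc.pow 2)) hr hs)
      (intervalIntegrable_of_continuousOn_Icc
        ((P.continuousOn_greenFun h m (hsub ht)).mul hEc) hr hs) fun x hx ↦ ?_
    have htρ := hsub ht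
    have hxρ := hsub hx
    have hmin : min t x ∈ Icc ρ₁ ρ₂ :=
      ⟨le_min htρ.1 hxρ.1, (min_le_left _ _).trans htρ.2⟩
    have hmax : max t x ∈ Icc ρ₁ ρ₂ :=
      ⟨htρ.1.trans (le_max_left _ _), max_le htρ.2 hxρ.2⟩
    have hα : invWeightIntegral ψ h m ρ₁ r ≤ invWeightIntegral ψ h m ρ₁ (min t x) := by
      rw [← P.invWeightIntegral_add h m P.left_mem hr hmin]
      linarith [invWeightIntegral_nonneg (ψ := ψ) (h := h) (m := m) (le_min ht.1 hx.1)]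
    have hβ : invWeightIntegral ψ h m s ρ₂ ≤ invWeightIntegral ψ h m (max t x) ρ₂ := by
      rw [← P.invWeightIntegral_add h m hmax hs P.right_mem]
      linarith [invWeightIntegral_nonneg (ψ := ψ) (h := h) (m := m) (max_le ht.2 hx.2)]
    have h2 : invWeightIntegral ψ h m ρ₁ r * invWeightIntegral ψ h m s ρ₂ ≤
        invWeightIntegral ψ h m ρ₁ (min t x) * invWeightIntegral ψ h m (max t x) ρ₂ :=
      mul_le_mul hα hβ (invWeightIntegral_nonneg hs.2) (invWeightIntegral_nonneg hmin.1)
    have hEt := hEpos t htρ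
    have hEx := hEpos x hxρ
    have h3 := mul_le_mul_of_nonneg_left h2
      (show 0 ≤ E t * E x ^ 2 / invWeightIntegral ψ h m ρ₁ ρ₂ by positivity)
    rw [greenFun]
    calc _ = E t * E x ^ 2 / invWeightIntegral ψ h m ρ₁ ρ₂ *
          (invWeightIntegral ψ h m ρ₁ r * invWeightIntegral ψ h m s ρ₂) := by ring
      _ ≤ _ := h3
      _ = _ := by rw [← hE]; ring
  have hGf : ∀ᵐ t ∂intervalMeasure ρ₁ ρ₂, ‖((c : ℂ) • f : Lp ℂ 2 _) t‖ ≤ ‖P.greenOp h m f t‖ := by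
    filter_upwards [coeFn_iccToLp P.lt.le (integralOpCont P.lt.le (P.greenKernel h m) f),
      ae_restrict_mem measurableSet_Ioo, Lp.coeFn_smul (c : ℂ) f, hfF] with t h1 h2 h3 h4
    rw [h3, Pi.smul_apply, h4]
    by_cases ht : t ∈ Ioo r s
    · have h5 : P.greenOp h m f t =
          ((∫ x in r..s, greenFun ρ₁ ρ₂ ψ h m t x * E x : ℝ) : ℂ) := by
        refine h1.trans ?_
        rw [P.integralOpCont_greenKernel, projIcc_of_mem P.lt.le (Ioo_subset_Icc_self h2),
          ← intervalIntegral.integral_ofReal, intervalIntegral.integral_of_le hrs.le,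
          integral_Ioc_eq_integral_Ioo]
        have h6 : ∫ x in Ioo r s, ((greenFun ρ₁ ρ₂ ψ h m t x * E x : ℝ) : ℂ) =
            ∫ x in Ioo ρ₁ ρ₂, (Ioo r s).indicator
              (fun x ↦ ((greenFun ρ₁ ρ₂ ψ h m t x * E x : ℝ) : ℂ)) x := by
          rw [setIntegral_indicator measurableSet_Ioo, inter_eq_self_of_subset_right hsubo]
        rw [h6]
        refine integral_congr_ae ?_
        filter_upwards [hfF] with x hx
        rw [hx]
        by_cases hxI : x ∈ Ioo r s
        · simp [F, hxI]
        · simp [F, hxI]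
      have h6 := key t (Ioo_subset_Icc_self ht)
      have hEt := hEpos t (hsub (Ioo_subset_Icc_self ht))
      rw [h5, Complex.norm_real, smul_eq_mul, norm_mul, Complex.norm_real]
      simp only [F, indicator_of_mem ht, Complex.norm_real]
      rw [Real.norm_of_nonneg hc0, Real.norm_of_nonneg hEt.le]
      exact h6.trans (Real.le_norm_self _)
    · simp [F, ht]
  have h1 := Lp.norm_le_norm_of_ae_le hGf
  rw [norm_smul, Complex.norm_real, Real.norm_of_nonneg hc0] at h1
  exact le_of_mul_le_mul_right (h1.trans ((P.greenOp h m).le_opNorm f)) hf0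

/-- Upper bound for the lowest eigenvalue. -/
lemma exists_eigenvector_mul_le (P : IsRadialPotential ρ₁ ρ₂ b ψ q) {φ : Plane → ℝ}
    (hφ : EqOn (radialProfile φ) ψ (Icc ρ₁ ρ₂)) {h : ℝ} (m : ℝ) (hh : 0 < h) {r s : ℝ}
    (hr : r ∈ Ioo ρ₁ ρ₂) (hs : s ∈ Ioo ρ₁ ρ₂) (hrs : r < s) :
    ∃ (ν : ℝ) (f : Lp ℂ 2 (intervalMeasure ρ₁ ρ₂)), IsPauliEigenvector ρ₁ ρ₂ φ h m ν f ∧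
      ν ≤ h ^ 2 * (invWeightIntegral ψ h m ρ₁ ρ₂ / ((∫ t in r..s, weight ψ h m t ^ 2) *
        invWeightIntegral ψ h m ρ₁ r * invWeightIntegral ψ h m s ρ₂)) := by
  have hrI := Ioo_subset_Icc_self hr
  have hsI := Ioo_subset_Icc_self hs
  have h1 := P.le_norm_greenOp h m hrI hsI hrs
  have hT : 0 < invWeightIntegral ψ h m ρ₁ ρ₂ :=
    P.integral_weight_inv_pos h m P.left_mem P.right_mem P.lt
  have hα : 0 < invWeightIntegral ψ h m ρ₁ r := P.integral_weight_inv_pos h m P.left_mem hrI hr.1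
  have hβ : 0 < invWeightIntegral ψ h m s ρ₂ := P.integral_weight_inv_pos h m hsI P.right_mem hs.2
  have hM : 0 < ∫ t in r..s, weight ψ h m t ^ 2 := by
    refine intervalIntegral.integral_pos hrs
      (((P.continuousOn_weight h m).mono (Icc_subset_Icc hrI.1 hsI.2)).pow 2)
      (fun _ _ ↦ sq_nonneg _) ⟨r, ⟨le_rfl, hrs.le⟩, ?_⟩
    have := weight_pos ψ h m (P.pos_of_mem hrI)
    positivity
  have hpos : 0 < (∫ t in r..s, weight ψ h m t ^ 2) * invWeightIntegral ψ h m ρ₁ r *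
      invWeightIntegral ψ h m s ρ₂ / invWeightIntegral ψ h m ρ₁ ρ₂ := by positivity
  obtain ⟨κ, f, hκ, hf, hfκ⟩ := exists_eigenvector_norm_eq (P.isCompactOperator_greenOp h m)
    (P.isSymmetric_greenOp h m) (hpos.trans_le h1)
  have hκ0 : κ ≠ 0 := by
    rintro rfl
    rw [abs_zero] at hκ
    linarith
  have hev := P.isPauliEigenvector_of_greenOp hφ hh hκ0 hf hfκ
  have hκpos : 0 < κ := by
    have := (P.greenTrace_pos_of_eigenvector hφ hh hev).2
    exact (div_pos_iff_of_pos_left (by positivity)).1 this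
  refine ⟨_, f, hev, ?_⟩
  rw [abs_of_pos hκpos] at hκ
  rw [← hκ] at h1
  rw [div_eq_mul_inv]
  refine mul_le_mul_of_nonneg_left ?_ (by positivity)
  rw [← inv_div]
  exact inv_anti₀ hpos h1

end IsRadialPotential

end RadialPauli

/-! ### Bounds for the eigenvalues -/

namespace RadialPauli

namespace IsRadialPotential

variable {ρ₁ ρ₂ : ℝ} {b ψ q : ℝ → ℝ} {φ : Plane → ℝ}

/-- The set whose infimum defines `pauliEigenvalue` is nonempty. -/
lemma pauliEigenvalue_set_nonempty (P : IsRadialPotential ρ₁ ρ₂ b ψ q)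
    (hφ : EqOn (radialProfile φ) ψ (Icc ρ₁ ρ₂)) {h : ℝ} (m : ℝ) (hh : 0 < h) (k : ℕ) :
    {Λ : ℝ | ∃ v : Fin k → Lp ℂ 2 (intervalMeasure ρ₁ ρ₂), LinearIndependent ℂ v ∧
      ∀ i, ∃ ν ≤ Λ, IsPauliEigenvector ρ₁ ρ₂ φ h m ν (v i)}.Nonempty := by
  obtain ⟨v, hv, hev⟩ := P.exists_linearIndependent_pauliEigenvectors hφ m hh k
  choose ν hν using hev
  obtain ⟨Λ, hΛ⟩ := (Set.finite_range ν).bddAbove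
  exact ⟨Λ, v, hv, fun i ↦ ⟨ν i, hΛ (mem_range_self i), hν i⟩⟩

lemma inv_greenTrace_le_pauliEigenvalue (P : IsRadialPotential ρ₁ ρ₂ b ψ q)
    (hφ : EqOn (radialProfile φ) ψ (Icc ρ₁ ρ₂)) {h : ℝ} (m : ℝ) (hh : 0 < h) :
    h ^ 2 / greenTrace ρ₁ ρ₂ ψ h m ≤ pauliEigenvalue ρ₁ ρ₂ φ 1 h m := by
  refine le_csInf (P.pauliEigenvalue_set_nonempty hφ m hh 1) ?_
  rintro Λ ⟨v, -, hv⟩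
  obtain ⟨ν, hνΛ, hν⟩ := hv 0
  have h1 := P.one_le_eigenvalue_mul_greenTrace hφ hh hν
  have h2 := (P.greenTrace_pos_of_eigenvector hφ hh hν).1
  refine le_trans ?_ hνΛ
  rw [div_le_iff₀ h2]
  rw [div_mul_eq_mul_div, le_div_iff₀ (by positivity), one_mul] at h1
  exact h1

lemma greenTrace_pos (P : IsRadialPotential ρ₁ ρ₂ b ψ q)
    (hφ : EqOn (radialProfile φ) ψ (Icc ρ₁ ρ₂)) {h : ℝ} (m : ℝ) (hh : 0 < h) :
    0 < greenTrace ρ₁ ρ₂ ψ h m := by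
  obtain ⟨v, -, hev⟩ := P.exists_linearIndependent_pauliEigenvectors hφ m hh 1
  obtain ⟨ν, hν⟩ := hev 0
  exact (P.greenTrace_pos_of_eigenvector hφ hh hν).1

lemma pauliEigenvalue_one_le (P : IsRadialPotential ρ₁ ρ₂ b ψ q)
    (hφ : EqOn (radialProfile φ) ψ (Icc ρ₁ ρ₂)) {h : ℝ} (m : ℝ) (hh : 0 < h) {r s : ℝ}
    (hr : r ∈ Ioo ρ₁ ρ₂) (hs : s ∈ Ioo ρ₁ ρ₂) (hrs : r < s) :
    pauliEigenvalue ρ₁ ρ₂ φ 1 h m ≤ h ^ 2 * (invWeightIntegral ψ h m ρ₁ ρ₂ /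
      ((∫ t in r..s, weight ψ h m t ^ 2) *
        invWeightIntegral ψ h m ρ₁ r * invWeightIntegral ψ h m s ρ₂)) := by
  obtain ⟨ν, f, hf, hν⟩ := P.exists_eigenvector_mul_le hφ m hh hr hs hrs
  refine le_trans (csInf_le ⟨0, ?_⟩ ⟨fun _ ↦ f, ?_, fun _ ↦ ⟨ν, le_rfl, hf⟩⟩) hν
  · rintro Λ ⟨v, -, hv⟩
    obtain ⟨ν', hν'Λ, hν'⟩ := hv 0
    exact (P.greenTrace_pos_of_eigenvector hφ hh hν').2.le.trans hν'Λ
  · exact LinearIndependent.of_subsingleton 0 hf.1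

lemma two_mul_le_pauliEigenvalue (P : IsRadialPotential ρ₁ ρ₂ b ψ q)
    (hφ : EqOn (radialProfile φ) ψ (Icc ρ₁ ρ₂)) {h B₀ : ℝ} (m : ℝ) (hh : 0 < h)
    (hb : ∀ r ∈ Icc ρ₁ ρ₂, B₀ ≤ b r) {j : ℕ} (hj : 2 ≤ j) :
    2 * h * B₀ ≤ pauliEigenvalue ρ₁ ρ₂ φ j h m := by
  refine le_csInf (P.pauliEigenvalue_set_nonempty hφ m hh j) ?_
  rintro Λ ⟨v, hv, hev⟩
  obtain ⟨ν₁, h₁, hf₁⟩ := hev ⟨0, by omega⟩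
  obtain ⟨ν₂, h₂, hf₂⟩ := hev ⟨1, by omega⟩
  refine P.two_mul_le_of_linearIndependent hφ hh hb hf₁ hf₂ h₁ h₂ fun c₁ c₂ hc ↦ ?_
  have hpair := (hv.comp ![⟨0, by omega⟩, ⟨1, by omega⟩] (by
    intro x y; fin_cases x <;> fin_cases y <;> simp))
  have hcomp : v ∘ ![⟨0, by omega⟩, ⟨1, by omega⟩] = ![v ⟨0, by omega⟩, v ⟨1, by omega⟩] := by
    funext i
    fin_cases i <;> rfl
  rw [hcomp] at hpair
  exact LinearIndependent.pair_iff.1 hpair c₁ c₂ hc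

end IsRadialPotential

end RadialPauli

/-! ### Shape of the radial potential -/

namespace RadialPauli

namespace IsRadialPotential

variable {ρ₁ ρ₂ : ℝ} {b ψ q : ℝ → ℝ}

lemma continuousOn_potential (P : IsRadialPotential ρ₁ ρ₂ b ψ q) : ContinuousOn ψ (Ioi 0) :=
  fun r hr ↦ (P.hasDerivAt r hr).continuousAt.continuousWithinAt

lemma Icc_subset_Ioi (P : IsRadialPotential ρ₁ ρ₂ b ψ q) : Icc ρ₁ ρ₂ ⊆ Ioi 0 :=
  fun _ hr ↦ P.pos_of_mem hr

lemma hasDerivAt_mul_deriv (P : IsRadialPotential ρ₁ ρ₂ b ψ q) {r : ℝ} (hr : 0 < r) :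
    HasDerivAt (fun r ↦ r * q r) (r * b r) r := by
  refine ((hasDerivAt_id r).mul (P.hasDerivAt_deriv r hr)).congr_deriv ?_
  simp only [id]
  field_simp
  ring

/-- The flux `r ψ'(r)` is increasing, since its derivative is `r b(r) > 0`. -/
lemma strictMonoOn_mul_deriv (P : IsRadialPotential ρ₁ ρ₂ b ψ q) :
    StrictMonoOn (fun r ↦ r * q r) (Ioi 0) := by
  refine strictMonoOn_of_hasDerivWithinAt_pos (convex_Ioi 0) (f' := fun r ↦ r * b r)
    (fun r hr ↦ (P.hasDerivAt_mul_deriv hr).continuousAt.continuousWithinAt) ?_ ?_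
  · rw [interior_Ioi]
    exact fun r hr ↦ (P.hasDerivAt_mul_deriv hr).hasDerivWithinAt
  · rw [interior_Ioi]
    exact fun r hr ↦ mul_pos hr (P.field_pos r)

lemma exists_deriv_eq_zero (P : IsRadialPotential ρ₁ ρ₂ b ψ q) : ∃ c ∈ Ioo ρ₁ ρ₂, q c = 0 := by
  refine exists_hasDerivAt_eq_zero P.lt (P.continuousOn_potential.mono P.Icc_subset_Ioi)
    (by rw [P.left, P.right]) fun r hr ↦ P.hasDerivAt r (P.pos.trans hr.1)

variable {c : ℝ}

lemma deriv_neg (P : IsRadialPotential ρ₁ ρ₂ b ψ q) (hc : c ∈ Ioo ρ₁ ρ₂) (hqc : q c = 0) {r : ℝ}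
    (hr : 0 < r) (hrc : r < c) : q r < 0 := by
  have h1 : r * q r < c * q c := P.strictMonoOn_mul_deriv hr (P.pos.trans hc.1) hrc
  rw [hqc, mul_zero] at h1
  exact (pos_iff_neg_of_mul_neg h1).1 hr

lemma deriv_pos (P : IsRadialPotential ρ₁ ρ₂ b ψ q) (hc : c ∈ Ioo ρ₁ ρ₂) (hqc : q c = 0) {r : ℝ}
    (hrc : c < r) : 0 < q r := by
  have hc0 : 0 < c := P.pos.trans hc.1
  have h1 : c * q c < r * q r := P.strictMonoOn_mul_deriv hc0 (hc0.trans hrc) hrc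
  rw [hqc, mul_zero] at h1
  exact (pos_iff_pos_of_mul_pos h1).1 (hc0.trans hrc)

lemma strictAntiOn_left (P : IsRadialPotential ρ₁ ρ₂ b ψ q) (hc : c ∈ Ioo ρ₁ ρ₂) (hqc : q c = 0) :
    StrictAntiOn ψ (Icc ρ₁ c) := by
  refine strictAntiOn_of_hasDerivWithinAt_neg (convex_Icc _ _) (f' := q)
    (P.continuousOn_potential.mono ((Icc_subset_Icc_right hc.2.le).trans P.Icc_subset_Ioi)) ?_ ?_
  · rw [interior_Icc]
    exact fun r hr ↦ (P.hasDerivAt r (P.pos.trans hr.1)).hasDerivWithinAt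
  · rw [interior_Icc]
    exact fun r hr ↦ P.deriv_neg hc hqc (P.pos.trans hr.1) hr.2

lemma strictMonoOn_right (P : IsRadialPotential ρ₁ ρ₂ b ψ q) (hc : c ∈ Ioo ρ₁ ρ₂) (hqc : q c = 0) :
    StrictMonoOn ψ (Icc c ρ₂) := by
  refine strictMonoOn_of_hasDerivWithinAt_pos (convex_Icc _ _) (f' := q)
    (P.continuousOn_potential.mono ((Icc_subset_Icc_left hc.1.le).trans P.Icc_subset_Ioi)) ?_ ?_
  · rw [interior_Icc]
    exact fun r hr ↦ (P.hasDerivAt r (P.pos.trans (hc.1.trans hr.1))).hasDerivWithinAt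
  · rw [interior_Icc]
    exact fun r hr ↦ P.deriv_pos hc hqc hr.1

lemma potential_neg (P : IsRadialPotential ρ₁ ρ₂ b ψ q) (hc : c ∈ Ioo ρ₁ ρ₂) (hqc : q c = 0)
    {r : ℝ} (hr : r ∈ Ioo ρ₁ ρ₂) : ψ r < 0 := by
  rcases le_total r c with h | h
  · rw [← P.left]
    exact P.strictAntiOn_left hc hqc ⟨le_rfl, hc.1.le⟩ ⟨hr.1.le, h⟩ hr.1
  · rw [← P.right]
    exact P.strictMonoOn_right hc hqc ⟨h, hr.2.le⟩ ⟨hc.2.le, le_rfl⟩ hr.2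

lemma eq_of_isMinOn (P : IsRadialPotential ρ₁ ρ₂ b ψ q) (hc : c ∈ Ioo ρ₁ ρ₂) (hqc : q c = 0)
    {r : ℝ} (hr : r ∈ Icc ρ₁ ρ₂) (hmin : ψ r ≤ ψ c) : r = c := by
  rcases lt_trichotomy r c with h | h | h
  · exact absurd (P.strictAntiOn_left hc hqc ⟨hr.1, h.le⟩ ⟨hc.1.le, le_rfl⟩ h) (not_lt.2 hmin)
  · exact h
  · exact absurd (P.strictMonoOn_right hc hqc ⟨le_rfl, hc.2.le⟩ ⟨h.le, hr.2⟩ h) (not_lt.2 hmin)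

lemma exists_field_lower_bound (P : IsRadialPotential ρ₁ ρ₂ b ψ q) :
    ∃ β > 0, ∀ r ∈ Icc ρ₁ ρ₂, β ≤ b r := by
  obtain ⟨r, -, hmin⟩ := isCompact_Icc.exists_isMinOn (nonempty_Icc.2 P.lt.le)
    P.continuous_field.continuousOn
  exact ⟨b r, P.field_pos r, fun s hs ↦ hmin hs⟩

/-- The minimum of the potential is nondegenerate, uniformly on `[ρ₁, ρ₂]`. -/
lemma exists_quadratic_lower_bound (P : IsRadialPotential ρ₁ ρ₂ b ψ q) (hc : c ∈ Ioo ρ₁ ρ₂)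
    (hqc : q c = 0) : ∃ κ > 0, ∀ r ∈ Icc ρ₁ ρ₂, ψ c + κ * (r - c) ^ 2 ≤ ψ r := by
  obtain ⟨β, hβ, hb⟩ := P.exists_field_lower_bound
  have hρ₁ := P.pos
  have hρ₂ : 0 < ρ₂ := P.pos.trans P.lt
  have hcI := Ioo_subset_Icc_self hc
  have hR : MonotoneOn (fun r ↦ r * q r - ρ₁ * β * r) (Icc ρ₁ ρ₂) := by
    have hd : ∀ r ∈ Icc ρ₁ ρ₂, HasDerivAt (fun r ↦ r * q r - ρ₁ * β * r)
        (r * b r - ρ₁ * β * 1) r := fun r hr ↦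
      (P.hasDerivAt_mul_deriv (P.pos_of_mem hr)).sub ((hasDerivAt_id r).const_mul (ρ₁ * β))
    refine monotoneOn_of_hasDerivWithinAt_nonneg (convex_Icc _ _)
      (f' := fun r ↦ r * b r - ρ₁ * β * 1)
      (fun r hr ↦ (hd r hr).continuousAt.continuousWithinAt) ?_ ?_
    · exact fun r hr ↦ (hd r (interior_subset hr)).hasDerivWithinAt
    · intro r hr
      have hr' : r ∈ Icc ρ₁ ρ₂ := interior_subset hr
      have h1 := hb r hr'
      have : ρ₁ * β ≤ r * b r := mul_le_mul hr'.1 h1 hβ.le (P.pos_of_mem hr').le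
      linarith
  set κ := ρ₁ * β / (2 * ρ₂) with hκ
  have hκ0 : 0 < κ := by positivity
  have hκ2 : 2 * κ * ρ₂ = ρ₁ * β := by rw [hκ]; field_simp
  have hd : ∀ r ∈ Icc ρ₁ ρ₂, HasDerivAt (fun r ↦ ψ r - κ * (r - c) ^ 2)
      (q r - κ * (2 * (r - c))) r := by
    intro r hr
    refine ((P.hasDerivAt r (P.pos_of_mem hr)).sub
      ((((hasDerivAt_id r).sub_const c).pow 2).const_mul κ)).congr_deriv ?_
    simp
  refine ⟨κ, hκ0, fun r hr ↦ ?_⟩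
  rcases le_total r c with h | h
  · have hanti : AntitoneOn (fun r ↦ ψ r - κ * (r - c) ^ 2) (Icc ρ₁ c) := by
      have hsub : Icc ρ₁ c ⊆ Icc ρ₁ ρ₂ := Icc_subset_Icc_right hc.2.le
      refine antitoneOn_of_hasDerivWithinAt_nonpos (convex_Icc _ _)
        (f' := fun r ↦ q r - κ * (2 * (r - c)))
        (fun r hr ↦ (hd r (hsub hr)).continuousAt.continuousWithinAt) ?_ ?_
      · exact fun r hr ↦ (hd r (hsub (interior_subset hr))).hasDerivWithinAt
      · intro r hr
        have hr' : r ∈ Icc ρ₁ c := interior_subset hr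
        have hr0 := P.pos_of_mem (hsub hr')
        have h1 := hR (hsub hr') hcI hr'.2
        simp only [hqc, mul_zero] at h1
        have h2 : r * (q r - κ * (2 * (r - c))) ≤ 0 := by
          have h3 : 2 * κ * (ρ₂ - r) * (c - r) ≥ 0 := by
            have := sub_nonneg.2 hr'.2
            have := sub_nonneg.2 (hsub hr').2
            positivity
          have h4 : r * q r ≤ 2 * κ * ρ₂ * (r - c) := by rw [hκ2]; linarith
          nlinarith
        exact nonpos_of_mul_nonpos_right h2 hr0
    have := hanti ⟨hr.1, h⟩ ⟨hc.1.le, le_rfl⟩ h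
    simp only [sub_self] at this
    linarith
  · have hmono : MonotoneOn (fun r ↦ ψ r - κ * (r - c) ^ 2) (Icc c ρ₂) := by
      have hsub : Icc c ρ₂ ⊆ Icc ρ₁ ρ₂ := Icc_subset_Icc_left hc.1.le
      refine monotoneOn_of_hasDerivWithinAt_nonneg (convex_Icc _ _)
        (f' := fun r ↦ q r - κ * (2 * (r - c)))
        (fun r hr ↦ (hd r (hsub hr)).continuousAt.continuousWithinAt) ?_ ?_
      · exact fun r hr ↦ (hd r (hsub (interior_subset hr))).hasDerivWithinAt
      · intro r hr
        have hr' : r ∈ Icc c ρ₂ := interior_subset hr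
        have hr0 := P.pos_of_mem (hsub hr')
        have h1 := hR hcI (hsub hr') hr'.1
        simp only [hqc, mul_zero] at h1
        have h2 : 0 ≤ r * (q r - κ * (2 * (r - c))) := by
          have h3 : 2 * κ * (ρ₂ - r) * (r - c) ≥ 0 := by
            have := sub_nonneg.2 hr'.1
            have := sub_nonneg.2 (hsub hr').2
            positivity
          have h4 : 2 * κ * ρ₂ * (r - c) ≤ r * q r := by rw [hκ2]; linarith
          nlinarith
        exact nonneg_of_mul_nonneg_right h2 hr0
    have := hmono ⟨le_rfl, hc.2.le⟩ ⟨h, hr.2⟩ h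
    simp only [sub_self] at this
    linarith

/-- A linear upper bound for the potential near the inner circle, from the continuity of its
difference quotients. -/
lemma exists_linear_upper_bound_left (P : IsRadialPotential ρ₁ ρ₂ b ψ q) (hc : c ∈ Ioo ρ₁ ρ₂)
    (hqc : q c = 0) {x : ℝ} (hx : x ∈ Ioo ρ₁ ρ₂) :
    ∃ κ > 0, ∀ t ∈ Icc ρ₁ x, ψ t ≤ -κ * (t - ρ₁) := by
  have hcont : ContinuousOn (dslope ψ ρ₁) (Icc ρ₁ x) :=
    ((continuousOn_dslope (Ioi_mem_nhds P.pos)).2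
      ⟨P.continuousOn_potential, (P.hasDerivAt ρ₁ P.pos).differentiableAt⟩).mono
      fun r hr ↦ P.pos.trans_le hr.1
  obtain ⟨y, hy, hmax⟩ := isCompact_Icc.exists_isMaxOn (nonempty_Icc.2 hx.1.le) hcont
  have hneg : dslope ψ ρ₁ y < 0 := by
    rcases eq_or_lt_of_le hy.1 with h | h
    · rw [← h, dslope_same, (P.hasDerivAt ρ₁ P.pos).deriv]
      exact P.deriv_neg hc hqc P.pos hc.1
    · rw [dslope_of_ne _ h.ne', slope_def_field, P.left, sub_zero]
      exact div_neg_of_neg_of_pos (P.potential_neg hc hqc ⟨h, hy.2.trans_lt hx.2⟩) (sub_pos.2 h)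
  refine ⟨-dslope ψ ρ₁ y, neg_pos.2 hneg, fun t ht ↦ ?_⟩
  rw [neg_neg]
  have h1 : dslope ψ ρ₁ t ≤ dslope ψ ρ₁ y := hmax ht
  have h2 := sub_smul_dslope ψ ρ₁ t
  rw [P.left, sub_zero, smul_eq_mul] at h2
  rw [← h2, mul_comm]
  exact mul_le_mul_of_nonneg_right h1 (sub_nonneg.2 ht.1)

lemma exists_linear_upper_bound_right (P : IsRadialPotential ρ₁ ρ₂ b ψ q) (hc : c ∈ Ioo ρ₁ ρ₂)
    (hqc : q c = 0) {x : ℝ} (hx : x ∈ Ioo ρ₁ ρ₂) :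
    ∃ κ > 0, ∀ t ∈ Icc x ρ₂, ψ t ≤ -κ * (ρ₂ - t) := by
  have hρ₂ : 0 < ρ₂ := P.pos.trans P.lt
  have hcont : ContinuousOn (dslope ψ ρ₂) (Icc x ρ₂) :=
    ((continuousOn_dslope (Ioi_mem_nhds hρ₂)).2
      ⟨P.continuousOn_potential, (P.hasDerivAt ρ₂ hρ₂).differentiableAt⟩).mono
      fun r hr ↦ P.pos.trans (hx.1.trans_le hr.1)
  obtain ⟨y, hy, hmin⟩ := isCompact_Icc.exists_isMinOn (nonempty_Icc.2 hx.2.le) hcont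
  have hpos : 0 < dslope ψ ρ₂ y := by
    rcases eq_or_lt_of_le hy.2 with h | h
    · rw [h, dslope_same, (P.hasDerivAt ρ₂ hρ₂).deriv]
      exact P.deriv_pos hc hqc hc.2
    · rw [dslope_of_ne _ h.ne, slope_def_field, P.right, sub_zero]
      exact div_pos_of_neg_of_neg (P.potential_neg hc hqc ⟨hx.1.trans_le hy.1, h⟩) (sub_neg.2 h)
  refine ⟨dslope ψ ρ₂ y, hpos, fun t ht ↦ ?_⟩
  have h1 : dslope ψ ρ₂ y ≤ dslope ψ ρ₂ t := hmin ht
  have h2 := sub_smul_dslope ψ ρ₂ t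
  rw [P.right, sub_zero, smul_eq_mul] at h2
  nlinarith [mul_le_mul_of_nonneg_right h1 (sub_nonneg.2 ht.2)]

lemma tendsto_sq_quotient (P : IsRadialPotential ρ₁ ρ₂ b ψ q) (hc : c ∈ Ioo ρ₁ ρ₂)
    (hqc : q c = 0) :
    Tendsto (fun t ↦ (ψ (c + t) - ψ c) / t ^ 2) (𝓝[≠] 0) (𝓝 (b c / 2)) := by
  have hc0 : 0 < c := P.pos.trans hc.1
  have hev : ∀ᶠ t in 𝓝[≠] (0 : ℝ), 0 < c + t := by
    refine eventually_nhdsWithin_of_eventually_nhds ?_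
    filter_upwards [Ioi_mem_nhds (show -c < 0 by linarith)] with t ht
    have : -c < t := ht
    linarith
  refine HasDerivAt.lhopital_zero_nhdsNE (f' := fun t ↦ q (c + t)) (g' := fun t ↦ 2 * t)
    ?_ ?_ ?_ ?_ ?_ ?_
  · filter_upwards [hev] with t ht
    have h1 := (P.hasDerivAt (c + t) ht).comp_const_add c t
    exact h1.sub_const (ψ c)
  · exact Eventually.of_forall fun t ↦ by simpa using hasDerivAt_pow 2 t
  · filter_upwards [self_mem_nhdsWithin] with t ht
    exact mul_ne_zero two_ne_zero ht
  · have h1 : ContinuousAt (fun t ↦ ψ (c + t) - ψ c) 0 := by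
      have h2 : ContinuousAt ψ (c + 0) := by
        rw [add_zero]; exact (P.hasDerivAt c hc0).continuousAt
      exact (ContinuousAt.comp (g := ψ) h2 (by fun_prop)).sub continuousAt_const
    have h2 := h1.tendsto
    simp only [add_zero, sub_self] at h2
    exact h2.mono_left nhdsWithin_le_nhds
  · have h1 : Continuous fun t : ℝ ↦ t ^ 2 := by fun_prop
    have h2 := h1.tendsto 0
    simp only [ne_eq, OfNat.ofNat_ne_zero, not_false_eq_true, zero_pow] at h2
    exact h2.mono_left nhdsWithin_le_nhds
  · have h1 : HasDerivAt q (b c) c := by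
      have := P.hasDerivAt_deriv c hc0
      rwa [hqc, zero_div, sub_zero] at this
    have h2 := hasDerivAt_iff_tendsto_slope_zero.1 h1
    have h3 := h2.div_const 2
    refine h3.congr' ?_
    filter_upwards [self_mem_nhdsWithin] with t ht
    have ht' : t ≠ 0 := ht
    rw [hqc, sub_zero, smul_eq_mul]
    field_simp

end IsRadialPotential

end RadialPauli

/-! ### Laplace's method -/

namespace RadialPauli

/-- Laplace's method in scaled form. If the amplitude `A h` concentrates at `0` on the scale `ε h`,
with profile `g` on `S`, then the integral of `W m * A h` over `[a, b]`, divided by `ε h`, tends to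
`W m₀ 0 * ∫ g` as `h → 0⁺` and `m → m₀` jointly. -/
theorem tendsto_scaled_integral {ε : ℝ → ℝ} (hε : ∀ h, 0 < h → 0 < ε h)
    (hε0 : Tendsto ε (𝓝[>] 0) (𝓝 0)) {a b : ℝ} (ha : a ≤ 0) (hb : 0 ≤ b) {W : ℝ → ℝ → ℝ}
    (hW : ContinuousOn (fun p : ℝ × ℝ ↦ W p.1 p.2) (univ ×ˢ Icc a b)) {A : ℝ → ℝ → ℝ}
    (hA : ∀ h, 0 < h → ContinuousOn (A h) (Icc a b)) {bound g : ℝ → ℝ} (hint : Integrable bound)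
    (hbound : ∀ h, 0 < h → ∀ τ, ε h * τ ∈ Ioc a b → |A h (ε h * τ)| ≤ bound τ)
    {S : Set ℝ} (hS : MeasurableSet S)
    (hin : ∀ τ ∈ S, ∀ᶠ h in 𝓝[>] 0, ε h * τ ∈ Ioc a b)
    (hout : ∀ τ ∉ S, ∀ h, 0 < h → ε h * τ ∉ Ioc a b)
    (hlim : ∀ τ ∈ S, Tendsto (fun h ↦ A h (ε h * τ)) (𝓝[>] 0) (𝓝 (g τ))) (m₀ : ℝ) :
    Tendsto (fun p : ℝ × ℝ ↦ (ε p.1)⁻¹ * ∫ t in a..b, W p.2 t * A p.1 t) (𝓝[>] 0 ×ˢ 𝓝 m₀)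
      (𝓝 (W m₀ 0 * ∫ τ in S, g τ)) := by
  have hab := ha.trans hb
  obtain ⟨C, hC⟩ := ((isCompact_Icc (a := m₀ - 1) (b := m₀ + 1)).prod
    (isCompact_Icc (a := a) (b := b))).exists_bound_of_continuousOn
      (hW.mono (prod_mono_left (subset_univ _)))
  have hpos : ∀ᶠ p : ℝ × ℝ in 𝓝[>] 0 ×ˢ 𝓝 m₀, 0 < p.1 :=
    tendsto_fst.eventually self_mem_nhdsWithin
  have hnear : ∀ᶠ p : ℝ × ℝ in 𝓝[>] 0 ×ˢ 𝓝 m₀, p.2 ∈ Icc (m₀ - 1) (m₀ + 1) :=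
    tendsto_snd.eventually (Icc_mem_nhds (by linarith) (by linarith))
  set F : ℝ × ℝ → ℝ → ℝ := fun p ↦ (Ioc a b).indicator fun t ↦ W p.2 t * A p.1 t with hF
  have hWm : ∀ m, ContinuousOn (W m) (Icc a b) := fun m ↦
    hW.comp (f := fun t ↦ (m, t)) (by fun_prop) fun t ht ↦ ⟨mem_univ _, ht⟩
  have hscale : (fun p : ℝ × ℝ ↦ (ε p.1)⁻¹ * ∫ t in a..b, W p.2 t * A p.1 t)
      =ᶠ[𝓝[>] 0 ×ˢ 𝓝 m₀] fun p ↦ ∫ τ, F p (ε p.1 * τ) := by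
    filter_upwards [hpos] with p hp
    rw [Measure.integral_comp_mul_left, abs_of_pos (inv_pos.2 (hε _ hp)), smul_eq_mul,
      integral_indicator measurableSet_Ioc, intervalIntegral.integral_of_le hab]
  have hlimit : W m₀ 0 * ∫ τ in S, g τ = ∫ τ, S.indicator (fun τ ↦ W m₀ 0 * g τ) τ := by
    rw [integral_indicator hS, integral_const_mul]
  rw [hlimit]
  refine Tendsto.congr' hscale.symm ?_
  refine tendsto_integral_filter_of_dominated_convergence (fun τ ↦ C * |bound τ|) ?_ ?_
    (hint.abs.const_mul C) ?_
  · filter_upwards [hpos] with p hp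
    have h1 : ContinuousOn (fun t ↦ W p.2 t * A p.1 t) (Ioc a b) :=
      ((hWm p.2).mul (hA _ hp)).mono Ioc_subset_Icc_self
    classical
    have h2 : Measurable ((Ioc a b).piecewise (fun t ↦ W p.2 t * A p.1 t) 0) :=
      h1.measurable_piecewise continuousOn_const measurableSet_Ioc
    rw [Set.piecewise_eq_indicator] at h2
    exact (h2.comp (measurable_const_mul _)).aestronglyMeasurable
  · filter_upwards [hpos, hnear] with p hp hm
    refine Eventually.of_forall fun τ ↦ ?_
    have hC0 : ∀ t ∈ Icc a b, |W p.2 t| ≤ C := fun t ht ↦ hC (p.2, t) ⟨hm, ht⟩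
    by_cases hτ : ε p.1 * τ ∈ Ioc a b
    · have h0 := hC0 _ (Ioc_subset_Icc_self hτ)
      rw [hF]
      simp only [indicator_of_mem hτ, Real.norm_eq_abs, abs_mul]
      exact mul_le_mul h0 ((hbound _ hp τ hτ).trans (le_abs_self _)) (abs_nonneg _)
        ((abs_nonneg _).trans h0)
    · rw [hF]
      simp only [indicator_of_notMem hτ, norm_zero]
      exact mul_nonneg ((abs_nonneg _).trans (hC0 0 ⟨ha, hb⟩)) (abs_nonneg _)
  · refine Eventually.of_forall fun τ ↦ ?_
    by_cases hτ : τ ∈ S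
    · rw [indicator_of_mem hτ]
      have hin' : ∀ᶠ p : ℝ × ℝ in 𝓝[>] 0 ×ˢ 𝓝 m₀, ε p.1 * τ ∈ Ioc a b :=
        tendsto_fst.eventually (hin τ hτ)
      have hε' : Tendsto (fun p : ℝ × ℝ ↦ ε p.1 * τ) (𝓝[>] 0 ×ˢ 𝓝 m₀) (𝓝 0) := by
        simpa using (hε0.comp tendsto_fst).mul_const τ
      have hWlim : Tendsto (fun p : ℝ × ℝ ↦ W p.2 (ε p.1 * τ)) (𝓝[>] 0 ×ˢ 𝓝 m₀)
          (𝓝 (W m₀ 0)) := by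
        have h1 := hW (m₀, 0) ⟨mem_univ _, ha, hb⟩
        refine h1.tendsto.comp (tendsto_nhdsWithin_iff.2
          ⟨tendsto_snd.prodMk_nhds hε', ?_⟩)
        filter_upwards [hin'] with p hp using ⟨mem_univ _, Ioc_subset_Icc_self hp⟩
      refine (hWlim.mul ((hlim τ hτ).comp tendsto_fst)).congr' ?_
      filter_upwards [hin'] with p hp
      rw [hF]
      simp only [indicator_of_mem hp, Function.comp]
    · rw [indicator_of_notMem hτ]
      refine tendsto_const_nhds.congr' ?_
      filter_upwards [hpos] with p hp
      rw [hF]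
      simp only [indicator_of_notMem (hout τ hτ _ hp)]

/-- Laplace's method at an end point where the exponent vanishes and has slope `-p < 0`. -/
theorem tendsto_endpoint_integral {W : ℝ → ℝ → ℝ} {d p κ : ℝ} {χ : ℝ → ℝ} (hd : 0 < d)
    (hW : ContinuousOn (fun x : ℝ × ℝ ↦ W x.1 x.2) (univ ×ˢ Icc 0 d))
    (hχ : ContinuousOn χ (Icc 0 d)) (hχ0 : χ 0 = 0) (hχ' : HasDerivAt χ (-p) 0) (hp : 0 < p)
    (hκ : 0 < κ) (hle : ∀ t ∈ Icc 0 d, χ t ≤ -κ * t) (m₀ : ℝ) :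
    Tendsto (fun x : ℝ × ℝ ↦ x.1⁻¹ * ∫ t in 0..d, W x.2 t * Real.exp (2 * χ t / x.1))
      (𝓝[>] 0 ×ˢ 𝓝 m₀) (𝓝 (W m₀ 0 / (2 * p))) := by
  have hval : W m₀ 0 / (2 * p) = W m₀ 0 * ∫ τ in Ioi 0, Real.exp (-(2 * p) * τ) := by
    rw [integral_exp_mul_Ioi (by linarith)]
    simp only [mul_zero, Real.exp_zero]
    field_simp
  rw [hval]
  refine tendsto_scaled_integral (ε := fun h ↦ h) (A := fun h t ↦ Real.exp (2 * χ t / h))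
    (bound := (Ioi 0).indicator fun τ ↦ Real.exp (-(2 * κ) * τ)) (fun h hh ↦ hh)
    (tendsto_id.mono_left nhdsWithin_le_nhds) le_rfl hd.le hW ?_ ?_ ?_ measurableSet_Ioi ?_ ?_ ?_ m₀
  · intro h _
    fun_prop
  · rw [integrable_indicator_iff measurableSet_Ioi]
    exact exp_neg_integrableOn_Ioi 0 (by linarith)
  · intro h hh τ hτ
    have hτ0 : 0 < τ := (mul_pos_iff_of_pos_left hh).1 hτ.1
    rw [abs_of_pos (Real.exp_pos _), indicator_of_mem (mem_Ioi.2 hτ0), Real.exp_le_exp,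
      div_le_iff₀ hh]
    have := hle _ (Ioc_subset_Icc_self hτ)
    linarith
  · intro τ hτ
    have h1 : Tendsto (fun h : ℝ ↦ h * τ) (𝓝[>] 0) (𝓝 0) := by
      have : Tendsto (fun h : ℝ ↦ h * τ) (𝓝 0) (𝓝 (0 * τ)) := tendsto_id.mul_const τ
      rw [zero_mul] at this
      exact this.mono_left nhdsWithin_le_nhds
    filter_upwards [h1.eventually (Iio_mem_nhds hd), self_mem_nhdsWithin] with h h2 h3
    exact ⟨mul_pos h3 hτ, le_of_lt h2⟩
  · intro τ hτ h hh hm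
    exact hτ ((mul_pos_iff_of_pos_left hh).1 hm.1)
  · intro τ _
    refine (Real.continuous_exp.tendsto _).comp ?_
    have h1 : HasDerivAt (fun h ↦ χ (h * τ)) (-p * τ) 0 := by
      have h2 : HasDerivAt (fun h : ℝ ↦ h * τ) τ 0 := by
        simpa using (hasDerivAt_id (0 : ℝ)).mul_const τ
      exact HasDerivAt.comp (0 : ℝ) (h₂ := χ) (by simpa using hχ') h2
    have h3 := h1.tendsto_slope_zero_right.const_mul 2
    rw [show -(2 * p) * τ = 2 * (-p * τ) by ring]
    refine h3.congr fun h ↦ ?_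
    simp only [zero_add, zero_mul, hχ0, sub_zero, smul_eq_mul]
    ring

/-- Laplace's method at an interior nondegenerate minimum. -/
theorem tendsto_interior_integral {W : ℝ → ℝ → ℝ} {a b β κ : ℝ} {χ : ℝ → ℝ} (ha : a < 0)
    (hb : 0 < b) (hW : ContinuousOn (fun x : ℝ × ℝ ↦ W x.1 x.2) (univ ×ˢ Icc a b))
    (hχ : ContinuousOn χ (Icc a b)) (hχ0 : χ 0 = 0)
    (hχ' : Tendsto (fun t ↦ χ t / t ^ 2) (𝓝[≠] 0) (𝓝 (β / 2)))
    (hκ : 0 < κ) (hle : ∀ t ∈ Icc a b, κ * t ^ 2 ≤ χ t) (m₀ : ℝ) :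
    Tendsto (fun x : ℝ × ℝ ↦ (√x.1)⁻¹ * ∫ t in a..b, W x.2 t * Real.exp (-2 * χ t / x.1))
      (𝓝[>] 0 ×ˢ 𝓝 m₀) (𝓝 (W m₀ 0 * √(Real.pi / β))) := by
  rw [← integral_gaussian, ← setIntegral_univ]
  have hsq0 : Tendsto (fun h : ℝ ↦ √h) (𝓝[>] 0) (𝓝 0) := by
    have := Real.continuous_sqrt.tendsto 0
    rw [Real.sqrt_zero] at this
    exact this.mono_left nhdsWithin_le_nhds
  have hsqτ : ∀ τ, Tendsto (fun h : ℝ ↦ √h * τ) (𝓝[>] 0) (𝓝 0) := fun τ ↦ by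
    simpa using hsq0.mul_const τ
  refine tendsto_scaled_integral (ε := fun h ↦ √h) (A := fun h t ↦ Real.exp (-2 * χ t / h))
    (bound := fun τ ↦ Real.exp (-(2 * κ) * τ ^ 2)) (fun h hh ↦ Real.sqrt_pos.2 hh)
    hsq0 ha.le hb.le hW ?_ ?_ ?_ MeasurableSet.univ ?_ ?_ ?_ m₀
  · intro h _
    fun_prop
  · exact integrable_exp_neg_mul_sq (by linarith)
  · intro h hh τ hτ
    rw [abs_of_pos (Real.exp_pos _), Real.exp_le_exp, div_le_iff₀ hh]
    have := hle _ (Ioc_subset_Icc_self hτ)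
    rw [mul_pow, Real.sq_sqrt hh.le] at this
    linarith
  · intro τ _
    filter_upwards [(hsqτ τ).eventually (Ioc_mem_nhds ha hb)] with h h1 using h1
  · exact fun τ hτ ↦ absurd (mem_univ τ) hτ
  · intro τ _
    refine (Real.continuous_exp.tendsto _).comp ?_
    rcases eq_or_ne τ 0 with rfl | hτ
    · simp [hχ0]
    · have h1 : Tendsto (fun h : ℝ ↦ √h * τ) (𝓝[>] 0) (𝓝[≠] 0) := by
        refine tendsto_nhdsWithin_iff.2 ⟨hsqτ τ, ?_⟩
        filter_upwards [self_mem_nhdsWithin] with h hh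
        exact mul_ne_zero (Real.sqrt_pos.2 hh).ne' hτ
      have h2 := (hχ'.comp h1).const_mul (-2 * τ ^ 2)
      rw [show -β * τ ^ 2 = -2 * τ ^ 2 * (β / 2) by ring]
      refine h2.congr' ?_
      filter_upwards [self_mem_nhdsWithin] with h hh
      have hh' : h ≠ 0 := (mem_Ioi.1 hh).ne'
      simp only [Function.comp]
      rw [mul_pow, Real.sq_sqrt (mem_Ioi.1 hh).le]
      field_simp

lemma weight_sq (ψ : ℝ → ℝ) (h m : ℝ) {r : ℝ} (hr : 0 < r) :
    weight ψ h m r ^ 2 = r ^ (2 * m + 1) * Real.exp (-2 * ψ r / h) := by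
  rw [weight, mul_pow, ← Real.rpow_natCast, ← Real.rpow_mul hr.le, ← Real.exp_nat_mul]
  congr 2 <;> push_cast <;> ring

lemma weight_inv_sq (ψ : ℝ → ℝ) (h m : ℝ) {r : ℝ} (hr : 0 < r) :
    (weight ψ h m r)⁻¹ ^ 2 = r ^ (-(2 * m + 1)) * Real.exp (2 * ψ r / h) := by
  rw [inv_pow, weight_sq ψ h m hr, mul_inv, ← Real.rpow_neg hr.le, ← Real.exp_neg]
  congr 2
  ring

namespace IsRadialPotential

variable {ρ₁ ρ₂ c : ℝ} {b ψ q : ℝ → ℝ}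

lemma tendsto_invWeightIntegral_left (P : IsRadialPotential ρ₁ ρ₂ b ψ q) (hc : c ∈ Ioo ρ₁ ρ₂)
    (hqc : q c = 0) {r : ℝ} (hr : r ∈ Ioo ρ₁ ρ₂) (m₀ : ℝ) :
    Tendsto (fun x : ℝ × ℝ ↦ x.1⁻¹ * invWeightIntegral ψ x.1 x.2 ρ₁ r) (𝓝[>] 0 ×ˢ 𝓝 m₀)
      (𝓝 (ρ₁ ^ (-(2 * m₀ + 1)) / (2 * -q ρ₁))) := by
  obtain ⟨κ, hκ, hle⟩ := P.exists_linear_upper_bound_left hc hqc hr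
  have hpos : ∀ t ∈ Icc 0 (r - ρ₁), 0 < ρ₁ + t := fun t ht ↦ by linarith [P.pos, ht.1]
  have hmain := tendsto_endpoint_integral (W := fun m t ↦ (ρ₁ + t) ^ (-(2 * m + 1)))
    (χ := fun t ↦ ψ (ρ₁ + t)) (p := -q ρ₁) (κ := κ) (sub_pos.2 hr.1)
    (ContinuousOn.rpow (by fun_prop) (by fun_prop) fun x hx ↦ Or.inl (hpos _ hx.2).ne')
    (P.continuousOn_potential.comp (by fun_prop) fun t ht ↦ hpos t ht)
    (by simpa using P.left)
    (by
      rw [neg_neg]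
      exact HasDerivAt.comp_const_add (f := ψ) ρ₁ 0 (by simpa using P.hasDerivAt ρ₁ P.pos))
    (neg_pos.2 (P.deriv_neg hc hqc P.pos hc.1)) hκ
    (fun t ht ↦ by simpa using hle (ρ₁ + t) ⟨by linarith [ht.1], by linarith [ht.2]⟩) m₀
  simp only [add_zero] at hmain
  refine hmain.congr fun x ↦ ?_
  rw [invWeightIntegral, show ∫ t in ρ₁..r, (weight ψ x.1 x.2 t)⁻¹ ^ 2 =
    ∫ t in ρ₁ + 0..ρ₁ + (r - ρ₁), (weight ψ x.1 x.2 t)⁻¹ ^ 2 by simp,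
    ← intervalIntegral.integral_comp_add_left (fun t ↦ (weight ψ x.1 x.2 t)⁻¹ ^ 2)]
  congr 1
  refine intervalIntegral.integral_congr fun t ht ↦ ?_
  rw [uIcc_of_le (sub_nonneg.2 hr.1.le)] at ht
  exact (weight_inv_sq ψ _ _ (hpos t ht)).symm

lemma tendsto_invWeightIntegral_right (P : IsRadialPotential ρ₁ ρ₂ b ψ q) (hc : c ∈ Ioo ρ₁ ρ₂)
    (hqc : q c = 0) {r : ℝ} (hr : r ∈ Ioo ρ₁ ρ₂) (m₀ : ℝ) :
    Tendsto (fun x : ℝ × ℝ ↦ x.1⁻¹ * invWeightIntegral ψ x.1 x.2 r ρ₂) (𝓝[>] 0 ×ˢ 𝓝 m₀)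
      (𝓝 (ρ₂ ^ (-(2 * m₀ + 1)) / (2 * q ρ₂))) := by
  have hρ₂ : 0 < ρ₂ := P.pos.trans P.lt
  obtain ⟨κ, hκ, hle⟩ := P.exists_linear_upper_bound_right hc hqc hr
  have hpos : ∀ t ∈ Icc 0 (ρ₂ - r), 0 < ρ₂ - t := fun t ht ↦ by
    linarith [P.pos, ht.2, hr.1]
  have hmain := tendsto_endpoint_integral (W := fun m t ↦ (ρ₂ - t) ^ (-(2 * m + 1)))
    (χ := fun t ↦ ψ (ρ₂ - t)) (p := q ρ₂) (κ := κ) (sub_pos.2 hr.2)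
    (ContinuousOn.rpow (by fun_prop) (by fun_prop) fun x hx ↦ Or.inl (hpos _ hx.2).ne')
    (P.continuousOn_potential.comp (by fun_prop) fun t ht ↦ hpos t ht)
    (by simpa using P.right)
    (HasDerivAt.comp_const_sub (f := ψ) ρ₂ 0 (by simpa using P.hasDerivAt ρ₂ hρ₂))
    (P.deriv_pos hc hqc hc.2) hκ
    (fun t ht ↦ by simpa using hle (ρ₂ - t) ⟨by linarith [ht.2], by linarith [ht.1]⟩) m₀
  simp only [sub_zero] at hmain
  refine hmain.congr fun x ↦ ?_
  rw [invWeightIntegral, show ∫ t in r..ρ₂, (weight ψ x.1 x.2 t)⁻¹ ^ 2 =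
    ∫ t in ρ₂ - (ρ₂ - r)..ρ₂ - 0, (weight ψ x.1 x.2 t)⁻¹ ^ 2 by simp,
    ← intervalIntegral.integral_comp_sub_left (fun t ↦ (weight ψ x.1 x.2 t)⁻¹ ^ 2)]
  congr 1
  refine intervalIntegral.integral_congr fun t ht ↦ ?_
  rw [uIcc_of_le (sub_nonneg.2 hr.2.le)] at ht
  exact (weight_inv_sq ψ _ _ (hpos t ht)).symm

lemma tendsto_integral_weight_sq (P : IsRadialPotential ρ₁ ρ₂ b ψ q) (hc : c ∈ Ioo ρ₁ ρ₂)
    (hqc : q c = 0) {r s : ℝ} (hr : r ∈ Ico ρ₁ c) (hs : s ∈ Ioc c ρ₂) (m₀ : ℝ) :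
    Tendsto (fun x : ℝ × ℝ ↦ (√x.1)⁻¹ * Real.exp (2 * ψ c / x.1) *
      ∫ t in r..s, weight ψ x.1 x.2 t ^ 2) (𝓝[>] 0 ×ˢ 𝓝 m₀)
      (𝓝 (c ^ (2 * m₀ + 1) * √(Real.pi / b c))) := by
  obtain ⟨κ, hκ, hle⟩ := P.exists_quadratic_lower_bound hc hqc
  have hmem : ∀ t ∈ Icc (r - c) (s - c), c + t ∈ Icc ρ₁ ρ₂ := fun t ht ↦
    ⟨by linarith [ht.1, hr.1], by linarith [ht.2, hs.2]⟩
  have hpos : ∀ t ∈ Icc (r - c) (s - c), 0 < c + t := fun t ht ↦ P.pos_of_mem (hmem t ht)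
  have hψ : ContinuousOn (fun t ↦ ψ (c + t)) (Icc (r - c) (s - c)) :=
    P.continuousOn_potential.comp (by fun_prop) fun t ht ↦ hpos t ht
  have hmain := tendsto_interior_integral (W := fun m t ↦ (c + t) ^ (2 * m + 1))
    (χ := fun t ↦ ψ (c + t) - ψ c) (β := b c) (κ := κ) (sub_neg.2 hr.2) (sub_pos.2 hs.1)
    (ContinuousOn.rpow (by fun_prop) (by fun_prop) fun x hx ↦ Or.inl (hpos _ hx.2).ne')
    (hψ.sub continuousOn_const) (by simp) (P.tendsto_sq_quotient hc hqc) hκ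
    (fun t ht ↦ by
      have := hle _ (hmem t ht)
      rw [add_sub_cancel_left] at this
      linarith) m₀
  simp only [add_zero] at hmain
  refine hmain.congr fun x ↦ ?_
  rw [show ∫ t in r..s, weight ψ x.1 x.2 t ^ 2 =
    ∫ t in c + (r - c)..c + (s - c), weight ψ x.1 x.2 t ^ 2 by simp,
    ← intervalIntegral.integral_comp_add_left (fun t ↦ weight ψ x.1 x.2 t ^ 2), mul_assoc,
    ← intervalIntegral.integral_const_mul (Real.exp (2 * ψ c / x.1))]
  congr 1
  refine intervalIntegral.integral_congr fun t ht ↦ ?_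
  rw [uIcc_of_le (show r - c ≤ s - c by linarith [hr.2, hs.1])] at ht
  rw [weight_sq ψ _ _ (hpos t ht), mul_left_comm, ← Real.exp_add]
  congr 2
  ring

end IsRadialPotential

end RadialPauli

/-! ### Convergence of the ground state energy -/

namespace RadialPauli

namespace IsRadialPotential

variable {ρ₁ ρ₂ c : ℝ} {b ψ q : ℝ → ℝ} {φ : Plane → ℝ}

lemma innerNormalDeriv_eq (P : IsRadialPotential ρ₁ ρ₂ b ψ q)
    (hφ : EqOn (radialProfile φ) ψ (Icc ρ₁ ρ₂)) : innerNormalDeriv ρ₁ ρ₂ φ = -q ρ₁ := by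
  rw [innerNormalDeriv, derivWithin_congr hφ (hφ P.left_mem),
    (P.hasDerivAt ρ₁ P.pos).hasDerivWithinAt.derivWithin
      (uniqueDiffOn_Icc P.lt _ P.left_mem)]

lemma outerNormalDeriv_eq (P : IsRadialPotential ρ₁ ρ₂ b ψ q)
    (hφ : EqOn (radialProfile φ) ψ (Icc ρ₁ ρ₂)) : outerNormalDeriv ρ₁ ρ₂ φ = q ρ₂ := by
  rw [outerNormalDeriv, derivWithin_congr hφ (hφ P.right_mem),
    (P.hasDerivAt ρ₂ (P.pos.trans P.lt)).hasDerivWithinAt.derivWithin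
      (uniqueDiffOn_Icc P.lt _ P.right_mem)]

lemma deriv_deriv_radialProfile (P : IsRadialPotential ρ₁ ρ₂ b ψ q)
    (hφ : EqOn (radialProfile φ) ψ (Icc ρ₁ ρ₂)) (hc : c ∈ Ioo ρ₁ ρ₂) (hqc : q c = 0) :
    deriv (deriv (radialProfile φ)) c = b c := by
  have h1 : deriv (radialProfile φ) =ᶠ[𝓝 c] q := by
    filter_upwards [Ioo_mem_nhds hc.1 hc.2] with r hr using P.deriv_radialProfile hφ hr
  rw [h1.deriv_eq, (P.hasDerivAt_deriv c (P.pos.trans hc.1)).deriv, hqc, zero_div, sub_zero]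

lemma limitFunction_eq (P : IsRadialPotential ρ₁ ρ₂ b ψ q)
    (hφ : EqOn (radialProfile φ) ψ (Icc ρ₁ ρ₂)) (hc : c ∈ Ioo ρ₁ ρ₂) (hqc : q c = 0) (m : ℝ) :
    limitFunction ρ₁ ρ₂ φ c m = 2 * √(b c / Real.pi) *
      (-q ρ₁ * (ρ₁ / c) ^ (2 * m + 1) + q ρ₂ * (ρ₂ / c) ^ (2 * m + 1)) := by
  rw [limitFunction, P.innerNormalDeriv_eq hφ, P.outerNormalDeriv_eq hφ,
    P.deriv_deriv_radialProfile hφ hc hqc]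

lemma limitFunction_nonneg (P : IsRadialPotential ρ₁ ρ₂ b ψ q)
    (hφ : EqOn (radialProfile φ) ψ (Icc ρ₁ ρ₂)) (hc : c ∈ Ioo ρ₁ ρ₂) (hqc : q c = 0) (m : ℝ) :
    0 ≤ limitFunction ρ₁ ρ₂ φ c m := by
  have hρ₁ := P.pos
  have hρ₂ := P.pos.trans P.lt
  have hc0 := P.pos.trans hc.1
  have h1 := neg_pos.2 (P.deriv_neg hc hqc P.pos hc.1)
  have h2 := P.deriv_pos hc hqc hc.2
  rw [P.limitFunction_eq hφ hc hqc]
  positivity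

lemma continuous_limitFunction (P : IsRadialPotential ρ₁ ρ₂ b ψ q) (hc : c ∈ Ioo ρ₁ ρ₂) :
    Continuous (limitFunction ρ₁ ρ₂ φ c) := by
  have hc0 := P.pos.trans hc.1
  have h1 : ρ₁ / c ≠ 0 := (div_pos P.pos hc0).ne'
  have h2 : ρ₂ / c ≠ 0 := (div_pos (P.pos.trans P.lt) hc0).ne'
  unfold limitFunction
  refine continuous_const.mul ((continuous_const.mul ?_).add (continuous_const.mul ?_))
  · exact continuous_const.rpow (by fun_prop) fun _ ↦ Or.inl h1
  · exact continuous_const.rpow (by fun_prop) fun _ ↦ Or.inl h2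

/-- The trace of the Green operator is at most its contribution from a neighbourhood `[r, s]` of
the minimum, plus a crude bound for the rest. -/
lemma greenTrace_le (P : IsRadialPotential ρ₁ ρ₂ b ψ q) (h m : ℝ) {r s : ℝ}
    (hr : r ∈ Icc ρ₁ ρ₂) (hs : s ∈ Icc ρ₁ ρ₂) (hrs : r ≤ s) :
    greenTrace ρ₁ ρ₂ ψ h m ≤ ((∫ t in r..s, weight ψ h m t ^ 2) *
      (invWeightIntegral ψ h m ρ₁ s * invWeightIntegral ψ h m r ρ₂) +
      ((∫ t in ρ₁..ρ₂, weight ψ h m t ^ 2) - ∫ t in r..s, weight ψ h m t ^ 2) *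
        (invWeightIntegral ψ h m ρ₁ ρ₂ * invWeightIntegral ψ h m ρ₁ ρ₂)) /
      invWeightIntegral ψ h m ρ₁ ρ₂ := by
  set α := fun t ↦ invWeightIntegral ψ h m ρ₁ t with hα
  set β := fun t ↦ invWeightIntegral ψ h m t ρ₂ with hβ
  set w := fun t ↦ weight ψ h m t ^ 2 with hw
  have hα' : MonotoneOn α (Icc ρ₁ ρ₂) := fun x hx y hy hxy ↦ by
    have := P.invWeightIntegral_add h m P.left_mem hx hy
    have h2 : 0 ≤ invWeightIntegral ψ h m x y := invWeightIntegral_nonneg hxy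
    simp only [hα]
    linarith
  have hβ' : AntitoneOn β (Icc ρ₁ ρ₂) := fun x hx y hy hxy ↦ by
    have := P.invWeightIntegral_add h m hx hy P.right_mem
    have h2 : 0 ≤ invWeightIntegral ψ h m x y := invWeightIntegral_nonneg hxy
    simp only [hβ]
    linarith
  have hα0 : ∀ x ∈ Icc ρ₁ ρ₂, 0 ≤ α x := fun x hx ↦ invWeightIntegral_nonneg hx.1
  have hβ0 : ∀ x ∈ Icc ρ₁ ρ₂, 0 ≤ β x := fun x hx ↦ invWeightIntegral_nonneg hx.2
  have hwc : ContinuousOn w (Icc ρ₁ ρ₂) := (P.continuousOn_weight h m).pow 2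
  have hαc : ContinuousOn α (Icc ρ₁ ρ₂) := fun x hx ↦
    (P.hasDerivWithinAt_invWeight_left h m hx).continuousWithinAt
  have hβc : ContinuousOn β (Icc ρ₁ ρ₂) := fun x hx ↦
    (P.hasDerivWithinAt_invWeight_right h m hx).continuousWithinAt
  have hfc : ContinuousOn (fun t ↦ w t * α t * β t) (Icc ρ₁ ρ₂) := (hwc.mul hαc).mul hβc
  have hw0 : ∀ x, 0 ≤ w x := fun x ↦ sq_nonneg _
  have hbound : ∀ {x y K : ℝ}, x ∈ Icc ρ₁ ρ₂ → y ∈ Icc ρ₁ ρ₂ → x ≤ y →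
      (∀ t ∈ Icc x y, α t * β t ≤ K) →
      ∫ t in x..y, w t * α t * β t ≤ (∫ t in x..y, w t) * K := by
    intro x y K hx hy hxy hK
    rw [← intervalIntegral.integral_mul_const]
    refine intervalIntegral.integral_mono_on hxy
      (intervalIntegrable_of_continuousOn_Icc hfc hx hy)
      ((intervalIntegrable_of_continuousOn_Icc hwc hx hy).mul_const K) fun t ht ↦ ?_
    rw [mul_assoc]
    exact mul_le_mul_of_nonneg_left (hK t ht) (hw0 t)
  have hT : ∀ t ∈ Icc ρ₁ ρ₂, α t * β t ≤ α ρ₂ * α ρ₂ := fun t ht ↦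
    mul_le_mul (hα' ht P.right_mem ht.2) (hβ' P.left_mem ht ht.1) (hβ0 t ht)
      (hα0 _ P.right_mem)
  have e1 := hbound P.left_mem hr hr.1 fun t ht ↦ hT t ⟨ht.1, ht.2.trans hr.2⟩
  have e2 := hbound (K := α s * β r) hr hs hrs fun t ht ↦
    have ht' : t ∈ Icc ρ₁ ρ₂ := ⟨hr.1.trans ht.1, ht.2.trans hs.2⟩
    mul_le_mul (hα' ht' hs ht.2) (hβ' hr ht' ht.1) (hβ0 t ht') (hα0 _ hs)
  have e3 := hbound hs P.right_mem hs.2 fun t ht ↦ hT t ⟨hs.1.trans ht.1, ht.2⟩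
  have hsplit : ∀ {f : ℝ → ℝ}, ContinuousOn f (Icc ρ₁ ρ₂) →
      ∫ t in ρ₁..ρ₂, f t = (∫ t in ρ₁..r, f t) + (∫ t in r..s, f t) + ∫ t in s..ρ₂, f t := by
    intro f hf
    rw [intervalIntegral.integral_add_adjacent_intervals
      (intervalIntegrable_of_continuousOn_Icc hf P.left_mem hr)
      (intervalIntegrable_of_continuousOn_Icc hf hr hs),
      intervalIntegral.integral_add_adjacent_intervals
      (intervalIntegrable_of_continuousOn_Icc hf P.left_mem hs)
      (intervalIntegrable_of_continuousOn_Icc hf hs P.right_mem)]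
  have hle : ∫ t in ρ₁..ρ₂, w t * α t * β t ≤ (∫ t in r..s, w t) * (α s * β r) +
      ((∫ t in ρ₁..ρ₂, w t) - ∫ t in r..s, w t) * (α ρ₂ * α ρ₂) := by
    rw [hsplit hfc, hsplit hwc]
    linarith
  exact div_le_div_of_nonneg_right hle (hα0 _ P.right_mem)

/-- The ground state energy, renormalized, converges as `h → 0⁺` and `m → m₀` jointly. -/
theorem tendsto_renormalizedEigenvalue (P : IsRadialPotential ρ₁ ρ₂ b ψ q)
    (hφ : EqOn (radialProfile φ) ψ (Icc ρ₁ ρ₂)) (hc : c ∈ Ioo ρ₁ ρ₂) (hqc : q c = 0) (m₀ : ℝ) :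
    Tendsto (fun x : ℝ × ℝ ↦ renormalizedEigenvalue ρ₁ ρ₂ φ (ψ c) 1 x.1 x.2)
      (𝓝[>] 0 ×ˢ 𝓝 m₀) (𝓝 (limitFunction ρ₁ ρ₂ φ c m₀)) := by
  obtain ⟨r, hr⟩ := exists_between hc.1
  obtain ⟨s, hs⟩ := exists_between hc.2
  have hrI : r ∈ Ioo ρ₁ ρ₂ := ⟨hr.1, hr.2.trans hc.2⟩
  have hsI : s ∈ Ioo ρ₁ ρ₂ := ⟨hc.1.trans hs.1, hs.2⟩
  have hrs : r < s := hr.2.trans hs.1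
  have hrC := Ioo_subset_Icc_self hrI
  have hsC := Ioo_subset_Icc_self hsI
  have hρ₁ := P.pos
  have hρ₂ := P.pos.trans P.lt
  have hc0 := P.pos.trans hc.1
  have hb := P.field_pos c
  have hp₁ := neg_pos.2 (P.deriv_neg hc hqc P.pos hc.1)
  have hp₂ := P.deriv_pos hc hqc hc.2
  set A₁ := ρ₁ ^ (-(2 * m₀ + 1)) / (2 * -q ρ₁) with hA₁
  set A₂ := ρ₂ ^ (-(2 * m₀ + 1)) / (2 * q ρ₂) with hA₂
  set Γ := c ^ (2 * m₀ + 1) * √(Real.pi / b c) with hΓ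
  have hA₁0 : 0 < A₁ := by positivity
  have hA₂0 : 0 < A₂ := by positivity
  have hΓ0 : 0 < Γ := by positivity
  have hval : limitFunction ρ₁ ρ₂ φ c m₀ = (A₁ + A₂) / (Γ * (A₁ * A₂)) := by
    have h1 : (A₁ + A₂) / (Γ * (A₁ * A₂)) = (A₁⁻¹ + A₂⁻¹) * Γ⁻¹ := by
      field_simp
      ring
    rw [h1, P.limitFunction_eq hφ hc hqc, hA₁, hA₂, hΓ, Real.div_rpow hρ₁.le hc0.le,
      Real.div_rpow hρ₂.le hc0.le, inv_div, inv_div, Real.rpow_neg hρ₁.le, Real.rpow_neg hρ₂.le,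
      ← inv_div (b c) Real.pi, Real.sqrt_inv]
    have := (Real.rpow_pos_of_pos hc0 (2 * m₀ + 1)).ne'
    field_simp
  have hα : ∀ {t}, t ∈ Ioo ρ₁ ρ₂ → Tendsto (fun x : ℝ × ℝ ↦
      x.1⁻¹ * invWeightIntegral ψ x.1 x.2 ρ₁ t) (𝓝[>] 0 ×ˢ 𝓝 m₀) (𝓝 A₁) :=
    fun ht ↦ P.tendsto_invWeightIntegral_left hc hqc ht m₀
  have hβ : ∀ {t}, t ∈ Ioo ρ₁ ρ₂ → Tendsto (fun x : ℝ × ℝ ↦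
      x.1⁻¹ * invWeightIntegral ψ x.1 x.2 t ρ₂) (𝓝[>] 0 ×ˢ 𝓝 m₀) (𝓝 A₂) :=
    fun ht ↦ P.tendsto_invWeightIntegral_right hc hqc ht m₀
  have hT : Tendsto (fun x : ℝ × ℝ ↦ x.1⁻¹ * invWeightIntegral ψ x.1 x.2 ρ₁ ρ₂)
      (𝓝[>] 0 ×ˢ 𝓝 m₀) (𝓝 (A₁ + A₂)) := by
    refine ((hα hrI).add (hβ hrI)).congr fun x ↦ ?_
    rw [← mul_add, P.invWeightIntegral_add _ _ P.left_mem hrC P.right_mem]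
  have hJ := P.tendsto_integral_weight_sq hc hqc ⟨hr.1.le, hr.2⟩ ⟨hs.1, hs.2.le⟩ m₀
  have hM := P.tendsto_integral_weight_sq hc hqc ⟨le_rfl, hc.1⟩ ⟨hc.2, le_rfl⟩ m₀
  rw [← hΓ] at hJ hM
  have hpos : ∀ᶠ x : ℝ × ℝ in 𝓝[>] 0 ×ˢ 𝓝 m₀, 0 < x.1 :=
    tendsto_fst.eventually self_mem_nhdsWithin
  have hupper := hT.div (hJ.mul ((hα hrI).mul (hβ hsI))) (by positivity)
  have hlower := hT.div ((hJ.mul ((hα hsI).mul (hβ hrI))).add ((hM.sub hJ).mul (hT.mul hT)))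
    (by rw [sub_self, zero_mul, add_zero]; positivity)
  rw [sub_self, zero_mul, add_zero, ← hval] at hlower
  rw [← hval] at hupper
  refine tendsto_of_tendsto_of_tendsto_of_le_of_le' hlower hupper ?_ ?_
  · filter_upwards [hpos] with x hx
    have hsq := Real.sqrt_pos.2 hx
    have hsq2 := Real.mul_self_sqrt hx.le
    have h1 := P.inv_greenTrace_le_pauliEigenvalue hφ x.2 hx
    have h2 := P.greenTrace_le x.1 x.2 hrC hsC hrs.le
    have h3 := P.greenTrace_pos hφ x.2 hx
    have h4 := (div_le_div_of_nonneg_left (sq_nonneg x.1) h3 h2).trans h1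
    rw [renormalizedEigenvalue]
    have h5 : Real.exp (-2 * ψ c / x.1) = (Real.exp (2 * ψ c / x.1))⁻¹ := by
      rw [← Real.exp_neg]; congr 1; ring
    have h6 := mul_le_mul_of_nonneg_right (div_le_div_of_nonneg_right h4 hsq.le)
      (Real.exp_pos (-2 * ψ c / x.1)).le
    refine le_of_eq_of_le ?_ h6
    have hE := Real.exp_pos (2 * ψ c / x.1)
    simp only [Pi.div_apply]
    rw [h5]
    generalize Real.exp (2 * ψ c / x.1) = E at hE ⊢
    generalize invWeightIntegral ψ x.1 x.2 ρ₁ ρ₂ = T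
    generalize invWeightIntegral ψ x.1 x.2 ρ₁ s = α
    generalize invWeightIntegral ψ x.1 x.2 r ρ₂ = β
    generalize ∫ t in r..s, weight ψ x.1 x.2 t ^ 2 = J
    generalize ∫ t in ρ₁..ρ₂, weight ψ x.1 x.2 t ^ 2 = M
    generalize √x.1 = k at hsq hsq2 ⊢
    rw [← hsq2]
    field_simp
  · filter_upwards [hpos] with x hx
    have hsq := Real.sqrt_pos.2 hx
    have hsq2 := Real.mul_self_sqrt hx.le
    have h1 := P.pauliEigenvalue_one_le hφ x.2 hx hrI hsI hrs
    have h5 : Real.exp (-2 * ψ c / x.1) = (Real.exp (2 * ψ c / x.1))⁻¹ := by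
      rw [← Real.exp_neg]; congr 1; ring
    rw [renormalizedEigenvalue]
    have h6 := mul_le_mul_of_nonneg_right (div_le_div_of_nonneg_right h1 hsq.le)
      (Real.exp_pos (-2 * ψ c / x.1)).le
    refine h6.trans_eq ?_
    have hE := Real.exp_pos (2 * ψ c / x.1)
    simp only [Pi.div_apply]
    rw [h5]
    generalize Real.exp (2 * ψ c / x.1) = E at hE ⊢
    generalize invWeightIntegral ψ x.1 x.2 ρ₁ ρ₂ = T
    generalize invWeightIntegral ψ x.1 x.2 ρ₁ r = α
    generalize invWeightIntegral ψ x.1 x.2 s ρ₂ = β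
    generalize ∫ t in r..s, weight ψ x.1 x.2 t ^ 2 = J
    generalize √x.1 = k at hsq hsq2 ⊢
    rw [← hsq2]
    field_simp

theorem tendstoUniformlyOn_renormalizedEigenvalue (P : IsRadialPotential ρ₁ ρ₂ b ψ q)
    (hφ : EqOn (radialProfile φ) ψ (Icc ρ₁ ρ₂)) (hc : c ∈ Ioo ρ₁ ρ₂) (hqc : q c = 0) {S : Set ℝ}
    (hS : IsCompact S) :
    TendstoUniformlyOn (fun h m : ℝ ↦ renormalizedEigenvalue ρ₁ ρ₂ φ (ψ c) 1 h m)
      (fun m ↦ limitFunction ρ₁ ρ₂ φ c m) (𝓝[>] 0) S := by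
  rw [← tendstoLocallyUniformlyOn_iff_tendstoUniformlyOn_of_compact hS,
    tendstoLocallyUniformlyOn_iff_forall_tendsto]
  intro m _
  have hle : 𝓝[>] (0 : ℝ) ×ˢ 𝓝[S] m ≤ 𝓝[>] 0 ×ˢ 𝓝 m :=
    prod_mono le_rfl nhdsWithin_le_nhds
  have h1 : Tendsto (fun x : ℝ × ℝ ↦ limitFunction ρ₁ ρ₂ φ c x.2) (𝓝[>] 0 ×ˢ 𝓝 m)
      (𝓝 (limitFunction ρ₁ ρ₂ φ c m)) :=
    ((P.continuous_limitFunction hc).tendsto m).comp tendsto_snd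
  exact ((h1.prodMk_nhds (P.tendsto_renormalizedEigenvalue hφ hc hqc m)).mono_left hle).mono_right
    (nhds_le_uniformity _)

end IsRadialPotential

end RadialPauli

/-! ### Coercivity in the angular momentum -/

namespace RadialPauli

lemma integral_exp_neg_mul_sub_left_le {k x y : ℝ} (hk : 0 < k) (hxy : x ≤ y) :
    ∫ t in x..y, Real.exp (-k * (t - x)) ≤ 1 / k := by
  rw [intervalIntegral.integral_comp_sub_right (fun t ↦ Real.exp (-k * t)), sub_self,
    intervalIntegral.integral_of_le (sub_nonneg.2 hxy)]
  refine (setIntegral_mono_set (exp_neg_integrableOn_Ioi 0 hk)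
    (Eventually.of_forall fun t ↦ (Real.exp_pos _).le) Ioc_subset_Ioi_self.eventuallyLE).trans_eq ?_
  rw [integral_exp_mul_Ioi (neg_lt_zero.2 hk)]
  simp [neg_div_neg_eq]

lemma integral_exp_neg_mul_sub_right_le {k x y : ℝ} (hk : 0 < k) (hxy : x ≤ y) :
    ∫ t in x..y, Real.exp (-k * (y - t)) ≤ 1 / k := by
  rw [intervalIntegral.integral_comp_sub_left (fun t ↦ Real.exp (-k * t)), sub_self]
  have := integral_exp_neg_mul_sub_left_le hk (sub_nonneg.2 hxy)
  simpa using this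

namespace IsRadialPotential

variable {ρ₁ ρ₂ c : ℝ} {b ψ q : ℝ → ℝ} {φ : Plane → ℝ}

lemma continuousOn_exp_mul_potential_div (P : IsRadialPotential ρ₁ ρ₂ b ψ q) (a h : ℝ) :
    ContinuousOn (fun t ↦ Real.exp (a * ψ t / h)) (Icc ρ₁ ρ₂) := by
  have := P.continuousOn_potential.mono P.Icc_subset_Ioi
  fun_prop

lemma exists_integral_exp_two_mul_le (P : IsRadialPotential ρ₁ ρ₂ b ψ q) (hc : c ∈ Ioo ρ₁ ρ₂)
    (hqc : q c = 0) :
    ∃ C > 0, ∀ h, 0 < h → ∫ t in ρ₁..ρ₂, Real.exp (2 * ψ t / h) ≤ C * h := by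
  obtain ⟨κ₁, hκ₁, h₁⟩ := P.exists_linear_upper_bound_left hc hqc hc
  obtain ⟨κ₂, hκ₂, h₂⟩ := P.exists_linear_upper_bound_right hc hqc hc
  refine ⟨1 / (2 * κ₁) + 1 / (2 * κ₂), by positivity, fun h hh ↦ ?_⟩
  have hcC := Ioo_subset_Icc_self hc
  have hi := fun {x y : ℝ} (hx : x ∈ Icc ρ₁ ρ₂) (hy : y ∈ Icc ρ₁ ρ₂) ↦
    intervalIntegrable_of_continuousOn_Icc (P.continuousOn_exp_mul_potential_div 2 h) hx hy
  rw [← intervalIntegral.integral_add_adjacent_intervals (hi P.left_mem hcC) (hi hcC P.right_mem),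
    add_mul]
  refine add_le_add ?_ ?_
  · refine (intervalIntegral.integral_mono_on hc.1.le (hi P.left_mem hcC)
      (g := fun t ↦ Real.exp (-(2 * κ₁ / h) * (t - ρ₁)))
      (Continuous.intervalIntegrable (by fun_prop) _ _) fun t ht ↦ ?_).trans
      ((integral_exp_neg_mul_sub_left_le (by positivity) hc.1.le).trans_eq (by field_simp))
    rw [Real.exp_le_exp, div_le_iff₀ hh,
      show -(2 * κ₁ / h) * (t - ρ₁) * h = 2 * (-κ₁ * (t - ρ₁)) by field_simp]
    linarith [h₁ t ht]
  · refine (intervalIntegral.integral_mono_on hc.2.le (hi hcC P.right_mem)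
      (g := fun t ↦ Real.exp (-(2 * κ₂ / h) * (ρ₂ - t)))
      (Continuous.intervalIntegrable (by fun_prop) _ _) fun t ht ↦ ?_).trans
      ((integral_exp_neg_mul_sub_right_le (by positivity) hc.2.le).trans_eq (by field_simp))
    rw [Real.exp_le_exp, div_le_iff₀ hh,
      show -(2 * κ₂ / h) * (ρ₂ - t) * h = 2 * (-κ₂ * (ρ₂ - t)) by field_simp]
    linarith [h₂ t ht]

lemma exists_integral_exp_neg_two_mul_le (P : IsRadialPotential ρ₁ ρ₂ b ψ q)
    (hc : c ∈ Ioo ρ₁ ρ₂) (hqc : q c = 0) : ∃ C > 0, ∀ h, 0 < h →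
      ∫ t in ρ₁..ρ₂, Real.exp (-2 * ψ t / h) ≤ C * √h * Real.exp (-2 * ψ c / h) := by
  obtain ⟨κ, hκ, hle⟩ := P.exists_quadratic_lower_bound hc hqc
  refine ⟨√(Real.pi / (2 * κ)), by positivity, fun h hh ↦ ?_⟩
  have h1 : ∫ t in ρ₁..ρ₂, Real.exp (-2 * ψ t / h) ≤
      ∫ t in ρ₁..ρ₂, Real.exp (-2 * ψ c / h) * Real.exp (-(2 * κ / h) * (t - c) ^ 2) := by
    refine intervalIntegral.integral_mono_on P.lt.le
      (intervalIntegrable_of_continuousOn_Icc (P.continuousOn_exp_mul_potential_div _ h)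
        P.left_mem P.right_mem) (Continuous.intervalIntegrable (by fun_prop) _ _) fun t ht ↦ ?_
    rw [← Real.exp_add, Real.exp_le_exp, div_le_iff₀ hh,
      show (-2 * ψ c / h + -(2 * κ / h) * (t - c) ^ 2) * h = -2 * (ψ c + κ * (t - c) ^ 2) by
        field_simp; ring]
    linarith [hle t ht]
  refine h1.trans ?_
  rw [intervalIntegral.integral_const_mul, mul_comm]
  refine mul_le_mul_of_nonneg_right ?_ (Real.exp_pos _).le
  rw [intervalIntegral.integral_comp_sub_right (fun t ↦ Real.exp (-(2 * κ / h) * t ^ 2)),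
    intervalIntegral.integral_of_le (by linarith [P.lt])]
  refine (setIntegral_le_integral (integrable_exp_neg_mul_sq (by positivity))
    (Eventually.of_forall fun t ↦ (Real.exp_pos _).le)).trans_eq ?_
  rw [integral_gaussian, ← Real.sqrt_mul (by positivity)]
  congr 1
  field_simp

/-- The angular momentum localizes the kernel `weight(r)² / weight(s)²` near the diagonal, on the
side of the diagonal determined by the sign of `2m + 1`. -/
lemma weight_sq_mul_inv_sq_le (P : IsRadialPotential ρ₁ ρ₂ b ψ q) (h : ℝ) {m r s : ℝ}
    (hr : r ∈ Icc ρ₁ ρ₂) (hs : s ∈ Icc ρ₁ ρ₂) (hm : 0 ≤ (2 * m + 1) * (s - r)) :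
    weight ψ h m r ^ 2 * (weight ψ h m s)⁻¹ ^ 2 ≤
      Real.exp (-(|2 * m + 1| / ρ₂) * |s - r|) * Real.exp (2 * (ψ s - ψ r) / h) := by
  have hr0 := P.pos_of_mem hr
  have hs0 := P.pos_of_mem hs
  have hρ₂ := P.pos.trans P.lt
  rw [weight_sq ψ h m hr0, weight_inv_sq ψ h m hs0, mul_mul_mul_comm, ← Real.exp_add,
    show -2 * ψ r / h + 2 * ψ s / h = 2 * (ψ s - ψ r) / h by ring]
  refine mul_le_mul_of_nonneg_right ?_ (Real.exp_pos _).le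
  rw [Real.rpow_neg hs0.le, ← div_eq_mul_inv, ← Real.div_rpow hr0.le hs0.le,
    Real.rpow_def_of_pos (div_pos hr0 hs0), Real.exp_le_exp]
  have hlog1 : Real.log (r / s) ≤ r / s - 1 := Real.log_le_sub_one_of_pos (div_pos hr0 hs0)
  have hlog2 : Real.log (s / r) ≤ s / r - 1 := Real.log_le_sub_one_of_pos (div_pos hs0 hr0)
  have hinv : Real.log (r / s) = -Real.log (s / r) := by rw [← Real.log_inv, inv_div]
  have e1 : r / s - 1 = -((s - r) / s) := by field_simp; ring
  have e2 : s / r - 1 = -((r - s) / r) := by field_simp; ring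
  rw [e1] at hlog1
  rw [e2] at hlog2
  have e3 : -(|2 * m + 1| / ρ₂) * |s - r| = -((2 * m + 1) * ((s - r) / ρ₂)) := by
    rw [show -(|2 * m + 1| / ρ₂) * |s - r| = -(|2 * m + 1| * |s - r|) / ρ₂ by ring, ← abs_mul,
      abs_of_nonneg hm]
    ring
  rw [e3]
  rcases lt_trichotomy (2 * m + 1) 0 with hn | hn | hn
  · have hsr : s - r ≤ 0 := by
      by_contra hcon
      exact absurd hm (not_le.2 (mul_neg_of_neg_of_pos hn (not_le.1 hcon)))
    have h1 : (r - s) / ρ₂ ≤ (r - s) / r :=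
      div_le_div_of_nonneg_left (by linarith) hr0 hr.2
    have h2 : (s - r) / ρ₂ = -((r - s) / ρ₂) := by ring
    rw [h2]
    nlinarith
  · rw [hn]; simp
  · have hsr : 0 ≤ s - r := nonneg_of_mul_nonneg_right hm hn
    have h1 : (s - r) / ρ₂ ≤ (s - r) / s := div_le_div_of_nonneg_left hsr hs0 hs.2
    nlinarith

/-- A bound for the trace of the Green operator that decays as `|m| → ∞`. The kernel is split
according to `|s - r| ≥ η` or `|s - r| < η`. In the first case the angular momentum contributes a
factor `exp (-k η)`, with `k = |2m + 1| / ρ₂`; in the second one the exponent `2 (ψ s - ψ r) / h` is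
at most `D / h`, which for `D = -ψ c` is half of the exponent in `exp (-2 ψ c / h)`. -/
lemma greenTrace_le_of_angular (P : IsRadialPotential ρ₁ ρ₂ b ψ q) {h m k η D : ℝ} (hh : 0 < h)
    (hk : k = |2 * m + 1| / ρ₂) (hk0 : 0 < k)
    (hη : ∀ r ∈ Icc ρ₁ ρ₂, ∀ s ∈ Icc ρ₁ ρ₂, |s - r| < η → ψ s - ψ r ≤ D / 2) :
    greenTrace ρ₁ ρ₂ ψ h m ≤
      Real.exp (-k * η) * (∫ t in ρ₁..ρ₂, Real.exp (2 * ψ t / h)) *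
        (∫ t in ρ₁..ρ₂, Real.exp (-2 * ψ t / h)) +
      Real.exp (D / h) * (1 / k) * (ρ₂ - ρ₁) := by
  set I := ∫ t in ρ₁..ρ₂, Real.exp (2 * ψ t / h) with hI
  have hexp : ∀ {x y : ℝ}, x ∈ Icc ρ₁ ρ₂ → y ∈ Icc ρ₁ ρ₂ →
      IntervalIntegrable (fun t ↦ Real.exp (2 * ψ t / h)) volume x y := fun hx hy ↦
    intervalIntegrable_of_continuousOn_Icc (P.continuousOn_exp_mul_potential_div 2 h) hx hy
  have hker : ∀ r ∈ Icc ρ₁ ρ₂, ∀ s ∈ Icc ρ₁ ρ₂, 0 ≤ (2 * m + 1) * (s - r) →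
      weight ψ h m r ^ 2 * (weight ψ h m s)⁻¹ ^ 2 ≤
        Real.exp (-k * η) * Real.exp (-2 * ψ r / h) * Real.exp (2 * ψ s / h) +
          Real.exp (D / h) * Real.exp (-k * |s - r|) := by
    intro r hr s hs hm
    have h1 := P.weight_sq_mul_inv_sq_le h hr hs hm
    rw [← hk] at h1
    refine h1.trans ?_
    rcases le_or_gt η |s - r| with hle | hlt
    · refine le_add_of_le_of_nonneg ?_ (by positivity)
      rw [mul_assoc, ← Real.exp_add (-2 * ψ r / h),
        show -2 * ψ r / h + 2 * ψ s / h = 2 * (ψ s - ψ r) / h by ring]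
      refine mul_le_mul_of_nonneg_right (Real.exp_le_exp.2 ?_) (Real.exp_pos _).le
      nlinarith
    · refine le_add_of_nonneg_of_le (by positivity) ?_
      rw [mul_comm]
      refine mul_le_mul_of_nonneg_right (Real.exp_le_exp.2 ?_) (Real.exp_pos _).le
      exact div_le_div_of_nonneg_right (by linarith [hη r hr s hs hlt]) hh.le
  have hsub : ∀ {x y : ℝ}, x ∈ Icc ρ₁ ρ₂ → y ∈ Icc ρ₁ ρ₂ → x ≤ y →
      ∫ t in x..y, Real.exp (2 * ψ t / h) ≤ I := by
    intro x y hx hy hxy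
    exact intervalIntegral.integral_mono_interval hx.1 hxy hy.2
      (Eventually.of_forall fun t ↦ (Real.exp_pos _).le) (hexp P.left_mem P.right_mem)
  have hside : ∀ r ∈ Icc ρ₁ ρ₂, ∀ x ∈ Icc ρ₁ ρ₂, ∀ y ∈ Icc ρ₁ ρ₂, x ≤ y →
      (∀ s ∈ Icc x y, 0 ≤ (2 * m + 1) * (s - r)) →
      ∫ s in x..y, Real.exp (-k * |s - r|) ≤ 1 / k →
      weight ψ h m r ^ 2 * invWeightIntegral ψ h m x y ≤
        Real.exp (-k * η) * I * Real.exp (-2 * ψ r / h) + Real.exp (D / h) * (1 / k) := by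
    intro r hr x hx y hy hxy hm hint
    have hcont : Continuous fun s ↦ Real.exp (-k * |s - r|) := by fun_prop
    have h1 := intervalIntegral.integral_mono_on hxy
      ((intervalIntegrable_of_continuousOn_Icc ((P.continuousOn_weight_inv h m).fun_pow 2) hx hy).const_mul
        (weight ψ h m r ^ 2))
      (((hexp hx hy).const_mul (Real.exp (-k * η) * Real.exp (-2 * ψ r / h))).add
        ((hcont.intervalIntegrable x y).const_mul (Real.exp (D / h))))
      fun s hs ↦ hker r hr s ⟨hx.1.trans hs.1, hs.2.trans hy.2⟩ (hm s hs)
    rw [intervalIntegral.integral_add ((hexp hx hy).const_mul _)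
      ((hcont.intervalIntegrable x y).const_mul _), intervalIntegral.integral_const_mul,
      intervalIntegral.integral_const_mul, intervalIntegral.integral_const_mul] at h1
    refine h1.trans (add_le_add ?_ (mul_le_mul_of_nonneg_left hint (Real.exp_pos _).le))
    rw [mul_right_comm (Real.exp (-k * η)) I]
    exact mul_le_mul_of_nonneg_left (hsub hx hy hxy) (by positivity)
  have hT : 0 < invWeightIntegral ψ h m ρ₁ ρ₂ :=
    P.integral_weight_inv_pos h m P.left_mem P.right_mem P.lt
  have hadd := fun r hr ↦ P.invWeightIntegral_add h m P.left_mem hr P.right_mem (s := r)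
  have hpt : ∀ r ∈ Icc ρ₁ ρ₂, weight ψ h m r ^ 2 * invWeightIntegral ψ h m ρ₁ r *
      invWeightIntegral ψ h m r ρ₂ ≤
      (Real.exp (-k * η) * I * Real.exp (-2 * ψ r / h) + Real.exp (D / h) * (1 / k)) *
        invWeightIntegral ψ h m ρ₁ ρ₂ := by
    intro r hr
    have hα : 0 ≤ invWeightIntegral ψ h m ρ₁ r := invWeightIntegral_nonneg hr.1
    have hβ : 0 ≤ invWeightIntegral ψ h m r ρ₂ := invWeightIntegral_nonneg hr.2
    have hsum := hadd r hr
    rcases le_total 0 (2 * m + 1) with hn | hn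
    · have h1 := hside r hr r hr ρ₂ P.right_mem hr.2
        (fun s hs ↦ mul_nonneg hn (sub_nonneg.2 hs.1)) (by
          refine le_of_eq_of_le (intervalIntegral.integral_congr fun s hs ↦ ?_)
            (integral_exp_neg_mul_sub_left_le hk0 hr.2)
          rw [uIcc_of_le hr.2] at hs
          simp only [abs_of_nonneg (sub_nonneg.2 hs.1)])
      rw [mul_right_comm]
      exact mul_le_mul h1 (by linarith) hα ((mul_nonneg (sq_nonneg _) hβ).trans h1)
    · have h1 := hside r hr ρ₁ P.left_mem r hr hr.1
        (fun s hs ↦ mul_nonneg_of_nonpos_of_nonpos hn (sub_nonpos.2 hs.2)) (by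
          refine le_of_eq_of_le (intervalIntegral.integral_congr fun s hs ↦ ?_)
            (integral_exp_neg_mul_sub_right_le hk0 hr.1)
          rw [uIcc_of_le hr.1] at hs
          simp only [abs_of_nonpos (sub_nonpos.2 hs.2), neg_sub])
      exact mul_le_mul h1 (by linarith) hβ ((mul_nonneg (sq_nonneg _) hα).trans h1)
  have hcα : ContinuousOn (fun r ↦ invWeightIntegral ψ h m ρ₁ r) (Icc ρ₁ ρ₂) := fun x hx ↦
    (P.hasDerivWithinAt_invWeight_left h m hx).continuousWithinAt
  have hcβ : ContinuousOn (fun r ↦ invWeightIntegral ψ h m r ρ₂) (Icc ρ₁ ρ₂) := fun x hx ↦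
    (P.hasDerivWithinAt_invWeight_right h m hx).continuousWithinAt
  have hexp' := intervalIntegrable_of_continuousOn_Icc
    (P.continuousOn_exp_mul_potential_div (-2) h) P.left_mem P.right_mem
  have hmono := intervalIntegral.integral_mono_on P.lt.le
    (intervalIntegrable_of_continuousOn_Icc
      ((((P.continuousOn_weight h m).fun_pow 2).fun_mul hcα).fun_mul hcβ) P.left_mem P.right_mem)
    (((hexp'.const_mul (Real.exp (-k * η) * I)).add
      (intervalIntegrable_const (c := Real.exp (D / h) * (1 / k)))).mul_const
        (invWeightIntegral ψ h m ρ₁ ρ₂)) hpt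
  rw [intervalIntegral.integral_mul_const, intervalIntegral.integral_add (hexp'.const_mul _)
    intervalIntegrable_const, intervalIntegral.integral_const_mul,
    intervalIntegral.integral_const, smul_eq_mul, mul_comm (ρ₂ - ρ₁)] at hmono
  exact (div_le_iff₀ hT).2 hmono

/-- The renormalized ground state energy is bounded below, uniformly in `h`, by a function which
tends to infinity with the angular momentum. -/
theorem exists_coercive_lower_bound (P : IsRadialPotential ρ₁ ρ₂ b ψ q)
    (hφ : EqOn (radialProfile φ) ψ (Icc ρ₁ ρ₂)) (hc : c ∈ Ioo ρ₁ ρ₂) (hqc : q c = 0) :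
    ∃ g : ℝ → ℝ, (∀ m, 0 ≤ g m) ∧ Tendsto g (cocompact ℝ) atTop ∧
      ∀ h, 0 < h → ∀ m, g m ≤ renormalizedEigenvalue ρ₁ ρ₂ φ (ψ c) 1 h m := by
  obtain ⟨C₁, hC₁, hI₁⟩ := P.exists_integral_exp_two_mul_le hc hqc
  obtain ⟨C₂, hC₂, hI₂⟩ := P.exists_integral_exp_neg_two_mul_le hc hqc
  have hρ₂ := P.pos.trans P.lt
  have hlen := sub_pos.2 P.lt
  obtain ⟨D, hD⟩ : ∃ D, D = -ψ c := ⟨_, rfl⟩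
  have hD0 : 0 < D := hD ▸ neg_pos.2 (P.potential_neg hc hqc hc)
  obtain ⟨η, hη0, hη⟩ : ∃ η > 0, ∀ r ∈ Icc ρ₁ ρ₂, ∀ s ∈ Icc ρ₁ ρ₂, |s - r| < η →
      ψ s - ψ r ≤ D / 2 := by
    have huc := isCompact_Icc.uniformContinuousOn_of_continuous
      (P.continuousOn_potential.mono P.Icc_subset_Ioi)
    obtain ⟨η, hη0, hη⟩ := Metric.uniformContinuousOn_iff.1 huc (D / 2) (by positivity)
    exact ⟨η, hη0, fun r hr s hs hrs ↦
      (le_abs_self _).trans (hη s hs r hr hrs).le⟩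
  set k : ℝ → ℝ := fun m ↦ |2 * m + 1| / ρ₂ with hk
  set Q : ℝ → ℝ := fun m ↦ C₁ * C₂ * Real.exp (-k m * η) + (ρ₂ - ρ₁) / (D * √D) * (1 / k m)
    with hQ
  have hk0 : ∀ m, 0 ≤ k m := fun m ↦ by positivity
  have hQ0 : ∀ m, 0 < Q m := fun m ↦ by
    have := hk0 m
    positivity
  have hktop : Tendsto k (cocompact ℝ) atTop := by
    refine Tendsto.atTop_div_const hρ₂ ?_
    refine tendsto_atTop_mono (f := fun m : ℝ ↦ |m| + (|m| - 1)) (fun m ↦ ?_) ?_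
    · have := abs_sub_abs_le_abs_sub (2 * m) (-1)
      rw [abs_mul, abs_neg, abs_one, abs_two, sub_neg_eq_add] at this
      linarith
    · have : Tendsto (fun m : ℝ ↦ |m|) (cocompact ℝ) atTop := tendsto_norm_cocompact_atTop
      exact this.atTop_add_atTop (tendsto_atTop_add_const_right _ (-1) this)
  refine ⟨fun m ↦ if k m = 0 then 0 else (Q m)⁻¹, fun m ↦ ?_, ?_, fun h hh m ↦ ?_⟩
  · beta_reduce
    split_ifs
    exacts [le_rfl, (inv_pos.2 (hQ0 m)).le]
  · have hQlim : Tendsto Q (cocompact ℝ) (𝓝[>] 0) := by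
      refine tendsto_nhdsWithin_iff.2 ⟨?_, Eventually.of_forall hQ0⟩
      have h1 : Tendsto (fun m ↦ Real.exp (-k m * η)) (cocompact ℝ) (𝓝 0) := by
        refine (Real.tendsto_exp_neg_atTop_nhds_zero.comp (hktop.atTop_mul_const hη0)).congr
          fun m ↦ ?_
        simp only [Function.comp, neg_mul]
      have h2 : Tendsto (fun m ↦ 1 / k m) (cocompact ℝ) (𝓝 0) := by
        simp only [one_div]
        exact hktop.inv_tendsto_atTop
      have h3 := (h1.const_mul (C₁ * C₂)).add (h2.const_mul ((ρ₂ - ρ₁) / (D * √D)))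
      rwa [mul_zero, mul_zero, add_zero] at h3
    refine (tendsto_inv_nhdsGT_zero.comp hQlim).congr' ?_
    filter_upwards [hktop.eventually_gt_atTop 0] with m hm
    simp [hm.ne']
  · have hlow := P.inv_greenTrace_le_pauliEigenvalue hφ m hh
    have hGpos := P.greenTrace_pos hφ m hh
    have hs := Real.sqrt_pos.2 hh
    have hs2 := Real.mul_self_sqrt hh.le
    have hE : Real.exp (-2 * ψ c / h) = Real.exp (D / h) * Real.exp (D / h) := by
      rw [← Real.exp_add, hD]; congr 1; ring
    have hren : h ^ 2 / greenTrace ρ₁ ρ₂ ψ h m / √h * Real.exp (-2 * ψ c / h) ≤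
        renormalizedEigenvalue ρ₁ ρ₂ φ (ψ c) 1 h m :=
      mul_le_mul_of_nonneg_right (div_le_div_of_nonneg_right hlow hs.le) (Real.exp_pos _).le
    refine le_trans ?_ hren
    beta_reduce
    split_ifs with hkm
    · positivity
    have hkpos : 0 < k m := lt_of_le_of_ne (hk0 m) (Ne.symm hkm)
    have hG := P.greenTrace_le_of_angular hh (m := m) (k := k m) rfl hkpos hη
    -- `x √x ≤ (x + x²) / 2 ≤ exp x` for `x = D / h`
    have hx : D / h * √(D / h) ≤ Real.exp (D / h) := by
      have hx0 : 0 < D / h := by positivity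
      have h1 := Real.quadratic_le_exp_of_nonneg hx0.le
      have h2 := Real.sq_sqrt hx0.le
      nlinarith [sq_nonneg (√(D / h) - 1)]
    have hx' : Real.exp (D / h) ≤ h * √h * Real.exp (-2 * ψ c / h) * (1 / (D * √D)) := by
      rw [hE, Real.sqrt_div hD0.le] at *
      have h3 : 1 ≤ h * √h * Real.exp (D / h) * (1 / (D * √D)) := by
        rw [mul_one_div, le_div_iff₀ (by positivity), one_mul]
        have h4 := mul_le_mul_of_nonneg_left hx (by positivity : 0 ≤ h * √h)
        refine le_of_eq_of_le ?_ h4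
        field_simp
      have h5 := mul_le_mul_of_nonneg_left h3 (Real.exp_pos (D / h)).le
      linarith
    have hGQ : greenTrace ρ₁ ρ₂ ψ h m ≤ h * √h * Real.exp (-2 * ψ c / h) * Q m := by
      refine hG.trans ?_
      have e1 : Real.exp (-k m * η) * (∫ t in ρ₁..ρ₂, Real.exp (2 * ψ t / h)) *
          (∫ t in ρ₁..ρ₂, Real.exp (-2 * ψ t / h)) ≤
          Real.exp (-k m * η) * (C₁ * h) * (C₂ * √h * Real.exp (-2 * ψ c / h)) := by
        refine mul_le_mul (mul_le_mul_of_nonneg_left (hI₁ h hh) (Real.exp_pos _).le) (hI₂ h hh)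
          (intervalIntegral.integral_nonneg P.lt.le fun t _ ↦ (Real.exp_pos _).le) (by positivity)
      have e2 : Real.exp (D / h) * (1 / k m) * (ρ₂ - ρ₁) ≤
          h * √h * Real.exp (-2 * ψ c / h) * (1 / (D * √D)) * (1 / k m) * (ρ₂ - ρ₁) :=
        mul_le_mul_of_nonneg_right (mul_le_mul_of_nonneg_right hx' (by positivity)) hlen.le
      refine (add_le_add e1 e2).trans_eq ?_
      simp only [hQ]
      ring
    have hQm := hQ0 m
    rw [div_div, div_mul_eq_mul_div, le_div_iff₀ (by positivity), inv_mul_le_iff₀ hQm]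
    calc greenTrace ρ₁ ρ₂ ψ h m * √h ≤ h * √h * Real.exp (-2 * ψ c / h) * Q m * √h :=
          mul_le_mul_of_nonneg_right hGQ hs.le
      _ = h * (√h * √h) * Real.exp (-2 * ψ c / h) * Q m := by ring
      _ = Q m * (h ^ 2 * Real.exp (-2 * ψ c / h)) := by rw [hs2]; ring

end IsRadialPotential

end RadialPauli

/-! ### The Dirichlet problem on the annulus -/

namespace RadialPauli
open scoped InnerProductSpace

section Laplacian

variable {E : Type*} [NormedAddCommGroup E] [InnerProductSpace ℝ E]

/-- The diagonal of the second derivative is the second derivative along lines. -/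
lemma deriv_deriv_line {f : E → ℝ} {x : E} (hf : ContDiffAt ℝ 2 f x) (v : E) :
    deriv (deriv fun t : ℝ ↦ f (x + t • v)) 0 = iteratedFDeriv ℝ 2 f x ![v, v] := by
  have hline : ∀ t : ℝ, HasDerivAt (fun t : ℝ ↦ x + t • v) v t := fun t ↦ by
    simpa using ((hasDerivAt_id t).smul_const v).const_add x
  have hline0 : Tendsto (fun t : ℝ ↦ x + t • v) (𝓝 0) (𝓝 x) := by
    have := (hline 0).continuousAt.tendsto
    rwa [zero_smul, add_zero] at this
  have h1 : (deriv fun t : ℝ ↦ f (x + t • v)) =ᶠ[𝓝 0] fun t ↦ fderiv ℝ f (x + t • v) v := by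
    filter_upwards [hline0.eventually (hf.eventually (by simp))] with t ht
    exact ((ht.differentiableAt (by simp)).hasFDerivAt.comp_hasDerivAt t (hline t)).deriv
  have h2 : HasFDerivAt (fderiv ℝ f) (fderiv ℝ (fderiv ℝ f) x) (x + (0 : ℝ) • v) := by
    rw [zero_smul, add_zero]
    exact ((hf.fderiv_right (m := 1) (by norm_num)).differentiableAt (by simp)).hasFDerivAt
  have h3 : HasDerivAt (fun t : ℝ ↦ fderiv ℝ f (x + t • v)) (fderiv ℝ (fderiv ℝ f) x v) 0 :=
    h2.comp_hasDerivAt 0 (hline 0)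
  have h4 : HasDerivAt (fun t : ℝ ↦ fderiv ℝ f (x + t • v) v) (fderiv ℝ (fderiv ℝ f) x v v) 0 :=
    (ContinuousLinearMap.apply ℝ ℝ v).hasFDerivAt.comp_hasDerivAt 0 h3
  rw [h1.deriv_eq, iteratedFDeriv_two_apply, h4.deriv]
  rfl

lemma iteratedFDeriv_two_nonpos_of_isLocalMax {f : E → ℝ} {x : E} (hf : ContDiffAt ℝ 2 f x)
    (hmax : IsLocalMax f x) (v : E) : iteratedFDeriv ℝ 2 f x ![v, v] ≤ 0 := by
  rw [← deriv_deriv_line hf v]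
  by_contra! hpos
  set g := fun t : ℝ ↦ f (x + t • v) with hg
  have hcont : ContinuousAt (fun t : ℝ ↦ x + t • v) 0 := by fun_prop
  have hx : x + (0 : ℝ) • v = x := by simp
  have hgmax : IsLocalMax g 0 := by
    have h1 : Tendsto (fun t : ℝ ↦ x + t • v) (𝓝 0) (𝓝 x) := by
      have := hcont.tendsto
      rwa [hx] at this
    filter_upwards [h1.eventually hmax] with t ht
    simpa [hg] using ht
  have hgc : ContinuousAt g 0 :=
    ContinuousAt.comp (f := fun t : ℝ ↦ x + t • v) (by rw [hx]; exact hf.continuousAt) hcont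
  -- by the second-derivative test `g` would also have a local minimum, hence be locally constant
  have hgmin := isLocalMin_of_deriv_deriv_pos hpos hgmax.deriv_eq_zero hgc
  have hconst : g =ᶠ[𝓝 0] fun _ ↦ g 0 := by
    filter_upwards [hgmax, hgmin] with t h1 h2 using le_antisymm h1 h2
  have h0 : deriv (deriv g) 0 = 0 := by
    rw [hconst.deriv.deriv_eq]
    simp
  exact hpos.ne' h0

variable [FiniteDimensional ℝ E]

lemma laplacian_nonpos_of_isLocalMax {f : E → ℝ} {x : E} (hf : ContDiffAt ℝ 2 f x)
    (hmax : IsLocalMax f x) : Laplacian.laplacian f x ≤ 0 := by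
  rw [InnerProductSpace.laplacian_eq_iteratedFDeriv_stdOrthonormalBasis]
  exact Finset.sum_nonpos fun i _ ↦ iteratedFDeriv_two_nonpos_of_isLocalMax hf hmax _

/-- The Laplacian of a function of `‖z‖²`. -/
lemma laplacian_comp_norm_sq {η η' : ℝ → ℝ} {η'' : ℝ} {x : E}
    (hη : ∀ᶠ t in 𝓝 (‖x‖ ^ 2), HasDerivAt η (η' t) t) (hη' : HasDerivAt η' η'' (‖x‖ ^ 2))
    (hf : ContDiffAt ℝ 2 (fun z : E ↦ η (‖z‖ ^ 2)) x) :
    Laplacian.laplacian (fun z : E ↦ η (‖z‖ ^ 2)) x =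
      4 * ‖x‖ ^ 2 * η'' + 2 * Module.finrank ℝ E * η' (‖x‖ ^ 2) := by
  set e := stdOrthonormalBasis ℝ E with he
  have hdir : ∀ i, iteratedFDeriv ℝ 2 (fun z : E ↦ η (‖z‖ ^ 2)) x ![e i, e i] =
      4 * η'' * ⟪e i, x⟫_ℝ ^ 2 + 2 * η' (‖x‖ ^ 2) := by
    intro i
    rw [← deriv_deriv_line hf]
    set k : ℝ → ℝ := fun t ↦ ‖x‖ ^ 2 + (2 * t * ⟪e i, x⟫_ℝ + t ^ 2) with hk
    have hnorm : ∀ t : ℝ, ‖x + t • e i‖ ^ 2 = k t := fun t ↦ by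
      rw [norm_add_sq_real, norm_smul, inner_smul_right, real_inner_comm, mul_pow,
        (e.orthonormal.1 i), Real.norm_eq_abs, sq_abs]
      simp only [hk]
      ring
    have hk' : ∀ t, HasDerivAt k (2 * ⟪e i, x⟫_ℝ + 2 * t) t := fun t ↦ by
      have h1 := ((((hasDerivAt_id t).const_mul 2).mul_const ⟪e i, x⟫_ℝ).add
        ((hasDerivAt_id t).pow 2)).const_add (‖x‖ ^ 2)
      refine h1.congr_deriv ?_
      simp
    have hk0 : k 0 = ‖x‖ ^ 2 := by simp [hk]
    simp only [hnorm]
    have h1 : (deriv fun t ↦ η (k t)) =ᶠ[𝓝 0] fun t ↦ η' (k t) * (2 * ⟪e i, x⟫_ℝ + 2 * t) := by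
      have h2 := (hk' 0).continuousAt.tendsto
      rw [hk0] at h2
      filter_upwards [h2.eventually hη] with t ht
      exact (HasDerivAt.comp t ht (hk' t)).deriv
    rw [h1.deriv_eq]
    rw [← hk0] at hη'
    have h3 := (HasDerivAt.comp 0 hη' (hk' 0)).mul
      (((hasDerivAt_id (0 : ℝ)).const_mul 2).const_add (2 * ⟪e i, x⟫_ℝ))
    refine h3.deriv.trans ?_
    simp only [Function.comp, id, hk0, mul_zero, add_zero, mul_one]
    ring
  rw [InnerProductSpace.laplacian_eq_iteratedFDeriv_stdOrthonormalBasis]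
  simp only
  rw [← he, Finset.sum_congr rfl fun i _ ↦ hdir i, Finset.sum_add_distrib, ← Finset.mul_sum,
    ← e.sum_sq_norm_inner_right x]
  simp only [Real.norm_eq_abs, sq_abs, Finset.sum_const, Finset.card_univ, Fintype.card_fin,
    nsmul_eq_mul]
  ring

end Laplacian

lemma isOpen_annulus (ρ₁ ρ₂ : ℝ) : IsOpen (annulus ρ₁ ρ₂) :=
  (isOpen_lt continuous_const continuous_norm).inter (isOpen_lt continuous_norm continuous_const)

lemma isCompact_closedAnnulus (ρ₁ ρ₂ : ℝ) : IsCompact (closedAnnulus ρ₁ ρ₂) := by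
  refine Metric.isCompact_of_isClosed_isBounded
    ((isClosed_le continuous_const continuous_norm).inter
      (isClosed_le continuous_norm continuous_const))
    ((Metric.isBounded_closedBall (x := (0 : Plane)) (r := ρ₂)).subset fun x hx ↦ ?_)
  rw [mem_closedBall_zero_iff]
  exact hx.2

lemma annulus_subset_closedAnnulus (ρ₁ ρ₂ : ℝ) : annulus ρ₁ ρ₂ ⊆ closedAnnulus ρ₁ ρ₂ :=
  fun _ hx ↦ ⟨hx.1.le, hx.2.le⟩

/-- The weak maximum principle on the annulus. -/
lemma nonpos_of_laplacian_nonneg {ρ₁ ρ₂ : ℝ} (hρ : 0 < ρ₂) {w : Plane → ℝ}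
    (hc : ContinuousOn w (closedAnnulus ρ₁ ρ₂))
    (hw : ∀ x ∈ annulus ρ₁ ρ₂, ContDiffAt ℝ 2 w x)
    (hΔ : ∀ x ∈ annulus ρ₁ ρ₂, 0 ≤ Laplacian.laplacian w x)
    (hbd : ∀ x : Plane, ‖x‖ = ρ₁ ∨ ‖x‖ = ρ₂ → w x = 0) {x : Plane}
    (hx : x ∈ closedAnnulus ρ₁ ρ₂) : w x ≤ 0 := by
  by_contra! hpos
  -- a small multiple of `‖z‖²` makes the Laplacian strictly positive
  set ε := w x / (2 * ρ₂ ^ 2) with hε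
  have hε0 : 0 < ε := by positivity
  have hερ : ε * ρ₂ ^ 2 = w x / 2 := by rw [hε]; field_simp
  set s : Plane → ℝ := fun z ↦ ‖z‖ ^ 2 with hs
  have hsC : ∀ z, ContDiffAt ℝ 2 s z := fun z ↦ (contDiff_norm_sq ℝ).contDiffAt
  have hsΔ : ∀ z, Laplacian.laplacian s z = 4 := fun z ↦ by
    have h1 := laplacian_comp_norm_sq (E := Plane) (x := z) (η := fun t ↦ t) (η' := fun _ ↦ 1)
      (Eventually.of_forall fun t ↦ hasDerivAt_id t) (hasDerivAt_const _ 1) (hsC z)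
    rw [finrank_euclideanSpace_fin] at h1
    norm_num at h1
    exact h1
  obtain ⟨y, hy, hmax⟩ := (isCompact_closedAnnulus ρ₁ ρ₂).exists_isMaxOn ⟨x, hx⟩
    (f := w + ε • s) (hc.add (by fun_prop))
  have hxy : w x + ε * ‖x‖ ^ 2 ≤ w y + ε * ‖y‖ ^ 2 := hmax hx
  by_cases hyb : ‖y‖ = ρ₁ ∨ ‖y‖ = ρ₂
  · rw [hbd y hyb] at hxy
    have h1 : ‖y‖ ^ 2 ≤ ρ₂ ^ 2 := pow_le_pow_left₀ (norm_nonneg _) hy.2 2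
    have h2 : 0 ≤ ε * ‖x‖ ^ 2 := by positivity
    nlinarith
  · push Not at hyb
    have hya : y ∈ annulus ρ₁ ρ₂ :=
      ⟨lt_of_le_of_ne hy.1 hyb.1.symm, lt_of_le_of_ne hy.2 hyb.2⟩
    have hloc : IsLocalMax (w + ε • s) y := by
      filter_upwards [(isOpen_annulus ρ₁ ρ₂).mem_nhds hya] with z hz
      exact hmax (annulus_subset_closedAnnulus ρ₁ ρ₂ hz)
    have hεs : ContDiffAt ℝ 2 (ε • s) y := contDiffAt_const.smul (hsC y)
    have h1 : Laplacian.laplacian (w + ε • s) y ≤ 0 :=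
      laplacian_nonpos_of_isLocalMax ((hw y hya).add hεs) hloc
    rw [(hw y hya).laplacian_add hεs, InnerProductSpace.laplacian_smul ε (hsC y), hsΔ,
      smul_eq_mul] at h1
    linarith [hΔ y hya]

/-- Every positive continuous radial field has a radial potential. -/
lemma exists_isRadialPotential {ρ₁ ρ₂ : ℝ} (h₁ : 0 < ρ₁) (h₂ : ρ₁ < ρ₂) {b : ℝ → ℝ}
    (hb : Continuous b) (hb0 : ∀ r, 0 < b r) : ∃ ψ q, IsRadialPotential ρ₁ ρ₂ b ψ q := by
  set F : ℝ → ℝ := fun r ↦ ∫ s in ρ₁..r, s * b s with hF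
  have hF' : ∀ r, HasDerivAt F (r * b r) r := fun r ↦
    intervalIntegral.integral_hasDerivAt_right (Continuous.intervalIntegrable (by fun_prop) _ _)
      (Continuous.stronglyMeasurableAtFilter (by fun_prop) _ _) (by fun_prop)
  have hFc : ContinuousOn (fun s ↦ F s / s) (Ioi 0) := fun s hs ↦
    ((hF' s).continuousAt.div continuousAt_id (ne_of_gt hs)).continuousWithinAt
  set ψ₀ : ℝ → ℝ := fun r ↦ ∫ s in ρ₁..r, F s / s with hψ₀
  have hψ₀' : ∀ r, 0 < r → HasDerivAt ψ₀ (F r / r) r := fun r hr ↦ by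
    refine intervalIntegral.integral_hasDerivAt_right (hFc.mono ?_).intervalIntegrable
      (hFc.stronglyMeasurableAtFilter isOpen_Ioi r hr) (hFc.continuousAt (Ioi_mem_nhds hr))
    exact fun s hs ↦ (lt_min h₁ hr).trans_le hs.1
  have hlog : 0 < Real.log ρ₂ - Real.log ρ₁ := sub_pos.2 (Real.log_lt_log h₁ h₂)
  set K := ψ₀ ρ₂ / (Real.log ρ₂ - Real.log ρ₁) with hK
  refine ⟨fun r ↦ ψ₀ r - K * (Real.log r - Real.log ρ₁), fun r ↦ (F r - K) / r, h₁, h₂, hb, hb0,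
    fun r hr ↦ ?_, fun r hr ↦ ?_, ?_, ?_⟩
  · refine ((hψ₀' r hr).sub (((Real.hasDerivAt_log hr.ne').sub_const _).const_mul K)).congr_deriv ?_
    field_simp
  · refine (((hF' r).sub_const K).div (hasDerivAt_id r) hr.ne').congr_deriv ?_
    simp only [id]
    field_simp
  · simp [hψ₀]
  · rw [hK]
    field_simp
    ring

namespace IsRadialPotential

variable {ρ₁ ρ₂ : ℝ} {b ψ q : ℝ → ℝ}

lemma contDiffOn_potential (P : IsRadialPotential ρ₁ ρ₂ b ψ q) : ContDiffOn ℝ 2 ψ (Ioi 0) := by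
  have hq : ContDiffOn ℝ 1 q (Ioi 0) := by
    rw [show (1 : WithTop ℕ∞) = 0 + 1 by norm_num, contDiffOn_succ_iff_deriv_of_isOpen isOpen_Ioi]
    refine ⟨fun r hr ↦ (P.hasDerivAt_deriv r hr).differentiableAt.differentiableWithinAt,
      by simp, contDiffOn_zero.2 ?_⟩
    exact (P.continuous_field.continuousOn.sub (P.continuousOn_deriv.div continuousOn_id
      fun r hr ↦ ne_of_gt hr)).congr fun r hr ↦ (P.hasDerivAt_deriv r hr).deriv
  rw [show (2 : WithTop ℕ∞) = 1 + 1 by norm_num, contDiffOn_succ_iff_deriv_of_isOpen isOpen_Ioi]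
  exact ⟨fun r hr ↦ (P.hasDerivAt r hr).differentiableAt.differentiableWithinAt,
    by simp, hq.congr fun r hr ↦ (P.hasDerivAt r hr).deriv⟩

lemma contDiffAt_comp_norm (P : IsRadialPotential ρ₁ ρ₂ b ψ q) {x : Plane} (hx : x ≠ 0) :
    ContDiffAt ℝ 2 (fun z : Plane ↦ ψ ‖z‖) x :=
  ContDiffAt.comp x (P.contDiffOn_potential.contDiffAt (Ioi_mem_nhds (norm_pos_iff.2 hx)))
    (contDiffAt_norm ℝ hx)

/-- The radial potential solves `Δ u = b` in the plane. -/
lemma laplacian_comp_norm (P : IsRadialPotential ρ₁ ρ₂ b ψ q) {x : Plane} (hx : x ≠ 0) :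
    Laplacian.laplacian (fun z : Plane ↦ ψ ‖z‖) x = b ‖x‖ := by
  have hx0 := norm_pos_iff.2 hx
  have hfun : (fun z : Plane ↦ ψ ‖z‖) = fun z : Plane ↦ ψ (√(‖z‖ ^ 2)) := by
    funext z
    rw [Real.sqrt_sq (norm_nonneg z)]
  have hC := P.contDiffAt_comp_norm hx
  rw [hfun] at hC ⊢
  have hη : ∀ t, 0 < t → HasDerivAt (fun t ↦ ψ √t) (q √t * (1 / (2 * √t))) t := fun t ht ↦
    HasDerivAt.comp t (P.hasDerivAt √t (Real.sqrt_pos.2 ht)) (Real.hasDerivAt_sqrt ht.ne')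
  have hsq : 0 < ‖x‖ ^ 2 := by positivity
  have hs := Real.hasDerivAt_sqrt hsq.ne'
  have hss : √(‖x‖ ^ 2) = ‖x‖ := Real.sqrt_sq hx0.le
  have h1 : HasDerivAt (fun t ↦ q √t) ((b ‖x‖ - q ‖x‖ / ‖x‖) * (1 / (2 * ‖x‖))) (‖x‖ ^ 2) := by
    have := HasDerivAt.comp (‖x‖ ^ 2) (by rw [hss]; exact P.hasDerivAt_deriv ‖x‖ hx0) hs
    rwa [hss] at this
  have h2 := h1.mul ((hasDerivAt_const (‖x‖ ^ 2) (1 : ℝ)).div (hs.const_mul 2)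
    (by rw [hss]; positivity))
  rw [laplacian_comp_norm_sq (η := fun t ↦ ψ √t) (η' := fun t ↦ q √t * (1 / (2 * √t)))
    (by filter_upwards [Ioi_mem_nhds hsq] with t ht using hη t ht) h2 hC,
    finrank_euclideanSpace_fin]
  simp only [hss, Pi.div_apply]
  field_simp
  ring

/-- Uniqueness for the Dirichlet problem: the scalar potential of a radial field is given by the
radial potential. -/
lemma eq_comp_norm (P : IsRadialPotential ρ₁ ρ₂ b ψ q) {B φ : Plane → ℝ}
    (hφ : IsScalarPotential ρ₁ ρ₂ B φ) (hB : ∀ x ∈ annulus ρ₁ ρ₂, B x = b ‖x‖) {x : Plane}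
    (hx : x ∈ closedAnnulus ρ₁ ρ₂) : φ x = ψ ‖x‖ := by
  have hρ₂ := P.pos.trans P.lt
  set u : Plane → ℝ := fun z ↦ ψ ‖z‖ with hu
  have hne : ∀ z ∈ annulus ρ₁ ρ₂, z ≠ 0 := fun z hz ↦
    norm_pos_iff.1 (P.pos.trans hz.1)
  have huc : ContinuousOn u (closedAnnulus ρ₁ ρ₂) :=
    P.continuousOn_potential.comp continuous_norm.continuousOn fun z hz ↦ P.pos.trans_le hz.1
  have huC : ∀ z ∈ annulus ρ₁ ρ₂, ContDiffAt ℝ 2 u z := fun z hz ↦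
    P.contDiffAt_comp_norm (hne z hz)
  have hφC : ∀ z ∈ annulus ρ₁ ρ₂, ContDiffAt ℝ 2 φ z := fun z hz ↦
    hφ.contDiffOn.contDiffAt ((isOpen_annulus ρ₁ ρ₂).mem_nhds hz)
  have hΔ : ∀ z ∈ annulus ρ₁ ρ₂, Laplacian.laplacian φ z = Laplacian.laplacian u z := fun z hz ↦ by
    rw [hφ.laplacian_eq z hz, hB z hz, P.laplacian_comp_norm (hne z hz)]
  have hu0 : ∀ z : Plane, ‖z‖ = ρ₁ ∨ ‖z‖ = ρ₂ → u z = 0 := by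
    rintro z (hz | hz)
    · simp only [hu, hz, P.left]
    · simp only [hu, hz, P.right]
  have h1 : (φ - u) x ≤ 0 := nonpos_of_laplacian_nonneg hρ₂ (hφ.continuousOn.sub huc)
    (fun z hz ↦ (hφC z hz).sub (huC z hz))
    (fun z hz ↦ by rw [(hφC z hz).laplacian_sub (huC z hz), hΔ z hz, sub_self])
    (fun z hz ↦ by rw [Pi.sub_apply, hφ.boundary_eq z hz, hu0 z hz, sub_self]) hx
  have h2 : (u - φ) x ≤ 0 := nonpos_of_laplacian_nonneg hρ₂ (huc.sub hφ.continuousOn)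
    (fun z hz ↦ (huC z hz).sub (hφC z hz))
    (fun z hz ↦ by rw [(huC z hz).laplacian_sub (hφC z hz), hΔ z hz, sub_self])
    (fun z hz ↦ by rw [Pi.sub_apply, hφ.boundary_eq z hz, hu0 z hz, sub_self]) hx
  exact le_antisymm (sub_nonpos.1 h1) (sub_nonpos.1 h2)

end IsRadialPotential

lemma norm_radial (r : ℝ) : ‖(!₂[r, 0] : Plane)‖ = |r| := by
  rw [EuclideanSpace.norm_eq]
  simp [Real.sqrt_sq_eq_abs]

lemma continuous_radial : Continuous fun r : ℝ ↦ (!₂[r, 0] : Plane) := by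
  refine (PiLp.continuous_toLp 2 _).comp (continuous_pi fun i ↦ ?_)
  fin_cases i
  · exact continuous_id
  · exact continuous_const

/-- A radial field which is bounded below by a positive constant on the annulus has a continuous
positive radial profile, extended to the whole line by freezing it outside `[ρ₁, ρ₂]`. -/
lemma exists_radial_field {ρ₁ ρ₂ : ℝ} (hρ₁ : 0 < ρ₁) (hρ₂ : ρ₁ < ρ₂) {B : Plane → ℝ}
    (hBc : ContinuousOn B (closedAnnulus ρ₁ ρ₂)) (hB : IsRadialOn ρ₁ ρ₂ B)
    (hpos : 0 < fieldInf ρ₁ ρ₂ B) :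
    ∃ b : ℝ → ℝ, Continuous b ∧ (∀ r, 0 < b r) ∧ (∀ x ∈ annulus ρ₁ ρ₂, B x = b ‖x‖) ∧
      ∀ r ∈ Icc ρ₁ ρ₂, fieldInf ρ₁ ρ₂ B ≤ b r := by
  set p : ℝ → ℝ := fun r ↦ max ρ₁ (min r ρ₂) with hp
  have hpm : ∀ r, p r ∈ Icc ρ₁ ρ₂ := fun r ↦
    ⟨le_max_left _ _, max_le hρ₂.le (min_le_right _ _)⟩
  have hpe : ∀ r ∈ Icc ρ₁ ρ₂, p r = r := fun r hr ↦ by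
    simp only [hp]
    rw [min_eq_left hr.2, max_eq_right hr.1]
  have hnorm : ∀ r ∈ Icc ρ₁ ρ₂, ‖(!₂[r, 0] : Plane)‖ = r := fun r hr ↦ by
    rw [norm_radial, abs_of_pos (hρ₁.trans_le hr.1)]
  have hmem : ∀ r ∈ Icc ρ₁ ρ₂, (!₂[r, 0] : Plane) ∈ closedAnnulus ρ₁ ρ₂ := fun r hr ↦ by
    rw [closedAnnulus, mem_ofPred_eq, hnorm r hr]
    exact hr
  have hc : Continuous fun r ↦ B !₂[p r, 0] :=
    hBc.comp_continuous (continuous_radial.comp (by fun_prop)) fun r ↦ hmem _ (hpm r)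
  have hbdd : BddBelow (B '' annulus ρ₁ ρ₂) :=
    ((isCompact_closedAnnulus ρ₁ ρ₂).image_of_continuousOn hBc).bddBelow.mono
      (image_mono (annulus_subset_closedAnnulus ρ₁ ρ₂))
  have hlow : ∀ r ∈ Icc ρ₁ ρ₂, fieldInf ρ₁ ρ₂ B ≤ B !₂[p r, 0] := by
    intro r hr
    rw [← closure_Ioo hρ₂.ne] at hr
    refine closure_minimal (t := {r | fieldInf ρ₁ ρ₂ B ≤ B !₂[p r, 0]}) (fun s hs ↦ ?_)
      (isClosed_le continuous_const hc) hr
    have hs' := Ioo_subset_Icc_self hs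
    refine csInf_le hbdd ⟨_, ?_, rfl⟩
    rw [hpe s hs', annulus, mem_ofPred_eq, hnorm s hs']
    exact hs
  refine ⟨fun r ↦ B !₂[p r, 0], hc, fun r ↦ ?_, fun x hx ↦ ?_, hlow⟩
  · have h1 := hlow _ (hpm r)
    rw [hpe _ (hpm r)] at h1
    exact hpos.trans_le h1
  · have hx' := annulus_subset_closedAnnulus ρ₁ ρ₂ hx
    have hxI : ‖x‖ ∈ Icc ρ₁ ρ₂ := hx'
    simp only
    rw [hpe _ hxI]
    exact hB x hx' _ (hmem _ hxI) (hnorm _ hxI).symm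

end RadialPauli

end

/-! ### Energy asymptotics and spectral gap on the annulus -/

open RadialPauli in
theorem proposition4p2 (ρ₁ ρ₂ : ℝ) (hρ₁ : 0 < ρ₁) (hρ₂ : ρ₁ < ρ₂)
    (B φ : Plane → ℝ)
    (hB_smooth : ContDiffOn ℝ ∞ B (closedAnnulus ρ₁ ρ₂))
    (hB_radial : IsRadialOn ρ₁ ρ₂ B)
    (hB_pos : 0 < fieldInf ρ₁ ρ₂ B)
    (hφ : IsScalarPotential ρ₁ ρ₂ B φ)
    (xmin : Plane) (hxmin : xmin ∈ closedAnnulus ρ₁ ρ₂)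
    (hmin : IsMinOn φ (closedAnnulus ρ₁ ρ₂) xmin) :
    ((∀ m : ℝ, 0 ≤ limitFunction ρ₁ ρ₂ φ ‖xmin‖ m) ∧
      ∀ S : Set ℝ, IsCompact S →
        TendstoUniformlyOn
          (fun h m : ℝ => renormalizedEigenvalue ρ₁ ρ₂ φ (φ xmin) 1 h m)
          (fun m : ℝ => limitFunction ρ₁ ρ₂ φ ‖xmin‖ m) (𝓝[>] 0) S) ∧
    (∀ K : ℝ, 0 < K → ∀ h₀ : ℝ, 0 < h₀ →
      ∃ g : ℝ → ℝ, (∀ m, 0 ≤ g m) ∧ Tendsto g (cocompact ℝ) atTop ∧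
        ∀ h ∈ Ioc 0 h₀, ∀ m : ℝ,
          renormalizedEigenvalue ρ₁ ρ₂ φ (φ xmin) 1 h m ≤ K →
            g m ≤ renormalizedEigenvalue ρ₁ ρ₂ φ (φ xmin) 1 h m) ∧
    (∀ h : ℝ, 0 < h → ∀ j : ℕ, 2 ≤ j → ∀ m : ℝ,
      2 * fieldInf ρ₁ ρ₂ B * √h * Real.exp (-2 * φ xmin / h) ≤
        renormalizedEigenvalue ρ₁ ρ₂ φ (φ xmin) j h m) := by
  obtain ⟨b, hbc, hb0, hBb, hbinf⟩ :=
    exists_radial_field hρ₁ hρ₂ hB_smooth.continuousOn hB_radial hB_pos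
  obtain ⟨ψ, q, P⟩ := exists_isRadialPotential hρ₁ hρ₂ hbc hb0
  have hφψ : ∀ x ∈ closedAnnulus ρ₁ ρ₂, φ x = ψ ‖x‖ := fun x hx ↦ P.eq_comp_norm hφ hBb hx
  have hnorm : ∀ r ∈ Icc ρ₁ ρ₂, ‖(!₂[r, 0] : Plane)‖ = r := fun r hr ↦ by
    rw [norm_radial, abs_of_pos (P.pos_of_mem hr)]
  have hmem : ∀ r ∈ Icc ρ₁ ρ₂, (!₂[r, 0] : Plane) ∈ closedAnnulus ρ₁ ρ₂ := fun r hr ↦ by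
    rw [closedAnnulus, mem_ofPred_eq, hnorm r hr]
    exact hr
  have hprof : EqOn (radialProfile φ) ψ (Icc ρ₁ ρ₂) := fun r hr ↦ by
    rw [radialProfile, hφψ _ (hmem r hr), hnorm r hr]
  obtain ⟨c, hc, hqc⟩ := P.exists_deriv_eq_zero
  have hcI := Ioo_subset_Icc_self hc
  have hxc : ‖xmin‖ = c := by
    refine P.eq_of_isMinOn hc hqc hxmin ?_
    have h1 : φ xmin ≤ φ !₂[c, 0] := hmin (hmem c hcI)
    rwa [hφψ _ hxmin, hφψ _ (hmem c hcI), hnorm c hcI] at h1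
  have hval : φ xmin = ψ c := by rw [hφψ _ hxmin, hxc]
  rw [hxc, hval]
  refine ⟨⟨P.limitFunction_nonneg hprof hc hqc, fun S hS ↦
    P.tendstoUniformlyOn_renormalizedEigenvalue hprof hc hqc hS⟩, fun K _ h₀ _ ↦ ?_,
    fun h hh j hj m ↦ ?_⟩
  · obtain ⟨g, hg0, hg, hle⟩ := P.exists_coercive_lower_bound hprof hc hqc
    exact ⟨g, hg0, hg, fun h hh m _ ↦ hle h hh.1 m⟩
  · refine mul_le_mul_of_nonneg_right ?_ (Real.exp_pos _).le
    have hs := Real.sqrt_pos.2 hh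
    rw [le_div_iff₀ hs, mul_assoc, Real.mul_self_sqrt hh.le]
    linarith [P.two_mul_le_pauliEigenvalue hprof m hh hbinf hj]
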